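/- Let $n\ge 3$, $\chi=8(n-1)$ and $M=SO(2n)/U(n)$, with the metric $g$ given by minus the Cartan–Killing form $\langle\cdot,\cdot\rangle$ on $\mathfrak m=\mathfrak{so}(2n)/\mathfrak u(n)=\{(A,B):=\begin{pmatrix}A&B\\B&-A\end{pmatrix}: A,B \text{ real skew}\}$, Levi-Civita connection $\nabla$, curvature $R(X,Y)=[\nabla_X,\nabla_Y]-\nabla_{[X,Y]}$, and $\mathrm{ad}^2(Z)=-R(\cdot,Z)Z$. Write $(a,H)\in\mathfrak m$ ($a\in\mathbb R$, $H$ a complex skew $(n-2)\times(n-2)$ matrix) for $A=\begin{pmatrix}0&a\\-a&0\end{pmatrix}\oplus\mathrm{Re}H$, $B=0\oplus\mathrm{Im}H$; and $(b,(z_1,z_2))\in\mathfrak m$ ($b\in\mathbb R$, $z_1,z_2\in\mathbb C^{n-2}$) for the pair $(A,B)$ in which $A$ has the rows $\mathrm{Re}z_1,\mathrm{Re}z_2$ and $B$ the rows $\mathrm{Im}z_1,\mathrm{Im}z_2$ in the upper right $2\times(n-2)$ block, $B$ has the upper left block $\begin{pmatrix}0&b\\-b&0\end{pmatrix}$, and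 the remaining blocks are $0$ or fixed by skewness. Put $\mathbf e=\frac1{\sqrt\chi}(1,0)$, a unit vector. Consider smooth flows $\gamma(t,x)$ in $M$, $t$ in an open interval, $x\in\mathbb R$, with $|\gamma_x|_g=1$ and $\gamma_x$ in the algebraic class (the $\mathrm{Ad}(U(n))$-orbit) of $\mathbf e$. A $U(n)$-parallel frame is a smooth lift of $\gamma$ to $SO(2n)$ in which, with $e$ and $\omega$ the induced $\mathfrak m$-valued coframe and $\mathfrak u(n)$-valued connection, $e(\gamma_x)=\mathbf e$ and $u=\omega(\gamma_x)$ is orthogonal to the centralizer $\mathfrak h_\parallel=\mathfrak{su}(2)\oplus\mathfrak u(n-2)$ of $\mathbf e$ in $\mathfrak u(n)$. Its Hasimoto variables $v\in\mathbb R$, $v_1,v_2\in\mathbb C^{n-2}$ are defined by $u=\sqrt\chi\,\mathrm{ad}(\mathbf e)(v,(v_1,v_2))$. Let $\mathrm J$ be the generator of the center $\mathfrak u(1)$ of $\mathfrak u(n-2)$, normalized so that $-\mathrm{ad}(\mathrm J)(b,(z_1,z_2))=(0,(iz_1,iz_2))$, and define $J_\gamma$ on $T_\gamma M$ by $e(J_\gamma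 Z)=-\mathrm{ad}(\mathrm J)e(Z)$. Let $(T_\gamma M)_\parallel=\ker\mathrm{ad}^2(\gamma_x)$, let $(T_\gamma M)_\perp$ be its orthogonal complement, and let $\mathrm{ad}^2(N)_\parallel\gamma_x$ be the projection of $\mathrm{ad}^2(N)\gamma_x$ to $(T_\gamma M)_\parallel$. The $U(1)$ curve flow equation is $$\gamma_t=J_\gamma(\nabla_x\gamma_x)-\tfrac{\chi}{2}\,W,\quad W=\big(\nabla_x-R(\gamma_x,\mathrm{ad}^2(\gamma_x)^{-1}\nabla_x\gamma_x)\big)^{-1}J_\gamma\big(\mathrm{ad}^2(\nabla_x\gamma_x)_\parallel\gamma_x\big),\quad |\gamma_x|_g=1,$$ where $\mathrm{ad}^2(\gamma_x)$ is inverted on $(T_\gamma M)_\perp$, and the inverse of the operator is taken on sections of $J_\gamma((T_\gamma M)_\parallel)$, up to constants of integration. The nonlocal $U(1)$ NLS system is, with $K=D_x^{-1}(v_1\wedge v_2)$ any skew antiderivative, $a\wedge b=a\otimes b-b\otimes a$, $|K|^2=\sum|K_{ij}|^2$, and row vectors multiplying matrices from the left, $$v_t=-\tfrac12(|v_1|^2+|v_2|^2+|K|^2)_x,$$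 $$v_{1t}-\tfrac{i}{\chi}v_1=iv_{1xx}+i(4v^2+|v_1|^2+|v_2|^2)v_1-2v_xv_1-(2i\bar v_{2x}+4v\bar v_2+2iv_1\bar K)K,$$ $$v_{2t}-\tfrac{i}{\chi}v_2=iv_{2xx}+i(4v^2+|v_1|^2+|v_2|^2)v_2-2v_xv_2+(2i\bar v_{1x}+4v\bar v_1-2iv_2\bar K)K.$$ Then: 1. $J_\gamma$ is a degenerate almost complex structure: it commutes with $\mathrm{ad}^2(\gamma_x)$ and preserves $(T_\gamma M)_\perp$, where $J_\gamma^3=-J_\gamma$ and $J_\gamma$ is neither zero nor injective. 2. In a parallel frame with Hasimoto variables $v,v_1,v_2$ and $e(W)=4\chi^{-3/2}(0,iK)$, $K_x=v_1\wedge v_2$, the curve flow equation is equivalent to $e(\gamma_t)=\frac1{\sqrt\chi}\big[(0,(iv_1,iv_2))+(0,-2iK)\big]$. 3. The $U(1)$ NLS system corresponds to the curve flow equation: every solution $(\gamma,W)$ of the latter has a $U(n)$-parallel frame in which $(v,v_1,v_2)$ solves the NLS system with $K$ given by $e(W)=4\chi^{-3/2}(0,iK)$; and every smooth solution $(v,v_1,v_2,K)$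 of the NLS system arises so from a solution $(\gamma,W)$ of the curve flow equation. 4. The curve flow equation is $SO(2n)$-invariant. 5. It preserves arclength: $g(\nabla_xY,\gamma_x)=0$ both for the local part $Y=J_\gamma(\nabla_x\gamma_x)$ and for the nonlocal part $Y=W$. -/

import Mathlib

open scoped Matrix ContDiff Matrix.Norms.Elementwise

noncomputable section

namespace SOU

/-! ### The symmetric Lie algebra `so(2n) = u(n) ⊕ m` -/

/-- Index set of the `n` coordinates of `ℝⁿ` (for `n ≥ 2`), split as `n = 2 + (n - 2)`. -/
abbrev Ix (n : ℕ) : Type := Fin 2 ⊕ Fin (n - 2)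

/-- Real `2n × 2n` matrices. -/
abbrev Mat (n : ℕ) : Type := Matrix (Ix n ⊕ Ix n) (Ix n ⊕ Ix n) ℝ

/-- Complex row vectors with `n - 2` components. -/
abbrev CVec (n : ℕ) : Type := Fin (n - 2) → ℂ

/-- Complex `(n-2) × (n-2)` matrices. -/
abbrev CMat (n : ℕ) : Type := Matrix (Fin (n - 2)) (Fin (n - 2)) ℂ

/-- The group `SO(2n)`. -/
abbrev SO (n : ℕ) : Submonoid (Mat n) := Matrix.specialOrthogonalGroup (Ix n ⊕ Ix n) ℝ

/-- The constant `χ = 8 (n - 1)`. -/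
def chi (n : ℕ) : ℝ := 8 * ((n : ℝ) - 1)

/-- The standard complex structure `J₀` of `ℝ²ⁿ`; `u(n)` is its centralizer in `so(2n)`. -/
def J0 (n : ℕ) : Mat n := Matrix.fromBlocks 0 1 (-1) 0

/-- The matrix `(A, B)` of `m` (for skew `A`, `B`). -/
def mMat {n : ℕ} (A B : Matrix (Ix n) (Ix n) ℝ) : Mat n := Matrix.fromBlocks A B B (-A)

/-- The matrix `(C, D)` of `u(n)` (for skew `C` and symmetric `D`). -/
def hMat {n : ℕ} (C D : Matrix (Ix n) (Ix n) ℝ) : Mat n := Matrix.fromBlocks C D (-D) C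

/-- The Cartan-Killing form of `so(2n)`. -/
def killing {n : ℕ} (A B : Mat n) : ℝ := (2 * (n : ℝ) - 2) * (A * B).trace

/-- The component in `m` of an element of `so(2n)`. -/
def mPart {n : ℕ} (A : Mat n) : Mat n := (1 / 2 : ℝ) • (A + J0 n * A * J0 n)

/-- The component in `u(n)` of an element of `so(2n)`. -/
def hPart {n : ℕ} (A : Mat n) : Mat n := (1 / 2 : ℝ) • (A - J0 n * A * J0 n)

/-- `(a, H) ∈ m_∥`, where `H = H₁ + i H₂` is a complex skew matrix. -/
def parMat {n : ℕ} (a : ℝ) (H : CMat n) : Mat n :=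
  mMat (Matrix.fromBlocks !![0, a; -a, 0] 0 0 (H.map Complex.re))
    (Matrix.fromBlocks 0 0 0 (H.map Complex.im))

/-- `(b, (z₁, z₂)) ∈ m_⊥`, where `b` is real and `z₁`, `z₂` are complex vectors. -/
def perpMat {n : ℕ} (b : ℝ) (z₁ z₂ : CVec n) : Mat n :=
  mMat
    (Matrix.fromBlocks 0 (Matrix.of ![fun j => (z₁ j).re, fun j => (z₂ j).re])
      (-(Matrix.of ![fun j => (z₁ j).re, fun j => (z₂ j).re])ᵀ) 0)
    (Matrix.fromBlocks !![0, b; -b, 0] (Matrix.of ![fun j => (z₁ j).im, fun j => (z₂ j).im])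
      (-(Matrix.of ![fun j => (z₁ j).im, fun j => (z₂ j).im])ᵀ) 0)

/-- The unit-norm element `e = χ^(-1/2) (1, 0)` of the Cartan subspace. -/
def ee (n : ℕ) : Mat n := parMat (1 / √(chi n)) 0

/-- The generator `i` of `u(1)`, the center of `u(n-2) ⊂ h_∥ = su(2) ⊕ u(n-2)`. -/
def Jrm (n : ℕ) : Mat n := hMat 0 (Matrix.fromBlocks 0 0 0 1)

/-- The subalgebra `h_∥` of `h = u(n)`: the centralizer of `e`. -/
def hPar (n : ℕ) : Set (Mat n) := {A | Aᵀ = -A ∧ A * J0 n = J0 n * A ∧ ⁅A, ee n⁆ = 0}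

/-- The orthogonal complement `h_⊥` of `h_∥` in `h = u(n)`. -/
def hPerp (n : ℕ) : Set (Mat n) :=
  {A | Aᵀ = -A ∧ A * J0 n = J0 n * A ∧ ∀ B ∈ hPar n, killing A B = 0}

/-! ### The symmetric space `M = SO(2n)/U(n)`

`M` is realized as the orbit of `J₀` under conjugation, on which `SO(2n)` acts transitively with
isotropy group `U(n)` at `J₀`.  A tangent vector `Z` at `P` is identified with the unique
infinitesimal isometry `ξ = gen P Z ∈ so(2n)` which anticommutes with `P` and satisfies
`[ξ, P] = Z`; at `P = J₀` this identifies the tangent space with `m`. -/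

/-- The symmetric space `M = SO(2n)/U(n)`. -/
def Space (n : ℕ) : Set (Mat n) := {P | ∃ g ∈ SO n, P = g * J0 n * gᵀ}

/-- The embedding of `U(n)` into the real `2n × 2n` matrices. -/
def realify {n : ℕ} (U : Matrix (Ix n) (Ix n) ℂ) : Mat n :=
  hMat (U.map Complex.re) (U.map Complex.im)

/-- The tangent space of `M` at `P`. -/
def IsTangent {n : ℕ} (P Z : Mat n) : Prop := Zᵀ = -Z ∧ Z * P = -(P * Z)

/-- The element of `so(2n)` corresponding to the tangent vector `Z` at `P`. -/
def gen {n : ℕ} (P Z : Mat n) : Mat n := -(1 / 2 : ℝ) • (Z * P)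

/-- The value at `P` of the infinitesimal isometry `ξ`. -/
def vec {n : ℕ} (P ξ : Mat n) : Mat n := ⁅ξ, P⁆

/-- The Riemannian metric, given by minus the Cartan-Killing form. -/
def metric {n : ℕ} (P X Y : Mat n) : ℝ := -killing (gen P X) (gen P Y)

/-- The Riemann tensor `R(X, Y) Z`, given by `-[[e_X, e_Y], e_Z]`. -/
def curv {n : ℕ} (P X Y Z : Mat n) : Mat n :=
  vec P (-⁅⁅gen P X, gen P Y⁆, gen P Z⁆)

/-- The linear map `ad²(Z) = -R(·, Z) Z`. -/
def adSq {n : ℕ} (P Z W : Mat n) : Mat n := -curv P W Z Z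

/-- The covariant derivative `∇_x Z` of a vector field `Z` along a curve `c` in `M`: the
tangential part of the derivative of `Z` (the invariant metric of `M` is a constant multiple of
the one induced by the Euclidean metric of the matrices). -/
def nabla {n : ℕ} (c Z : ℝ → Mat n) (x : ℝ) : Mat n :=
  (1 / 2 : ℝ) • (deriv Z x + c x * deriv Z x * c x)

/-- The principal normal vector `N = ∇_x c_x`. -/
def normal {n : ℕ} (c : ℝ → Mat n) (x : ℝ) : Mat n := nabla c (deriv c) x

/-- The frame components `e ⌋ Z ∈ m` of a tangent vector `Z` at `P = g J₀ g⁻¹` in the frame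
determined by `g ∈ SO(2n)`. -/
def coframe {n : ℕ} (P g Z : Mat n) : Mat n := gᵀ * gen P Z * g

/-- The frame at `P` determined by `g` is adapted to the tangent vector `X`, that is, the frame
components of `X` are `e`. -/
def IsAdapted {n : ℕ} (P X g : Mat n) : Prop :=
  g ∈ SO n ∧ P = g * J0 n * gᵀ ∧ coframe P g X = ee n

/-- `X` is a tangent vector at `P` which belongs to the algebraic equivalence class (the orbit
under the gauge group) of `e`. -/
def InClass {n : ℕ} (P X : Mat n) : Prop := IsTangent P X ∧ ∃ g, IsAdapted P X g

/-- The subspace `(T_P M)_∥`, the null space of `ad²(X)`. -/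
def IsPar {n : ℕ} (P X Z : Mat n) : Prop := IsTangent P Z ∧ adSq P X Z = 0

/-- The subspace `(T_P M)_⊥`, the orthogonal complement of `(T_P M)_∥`. -/
def IsPerp {n : ℕ} (P X Z : Mat n) : Prop :=
  IsTangent P Z ∧ ∀ Y, IsPar P X Y → metric P Z Y = 0

/-- The projection `-(χ²/4) ((5/χ) id + ad²(X)) ad²(X)` onto `(T_P M)_⊥`. -/
def projPerp {n : ℕ} (P X Z : Mat n) : Mat n :=
  -(chi n ^ 2 / 4) • ((5 / chi n) • adSq P X Z + adSq P X (adSq P X Z))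

/-- The projection onto `(T_P M)_∥`. -/
def projPar {n : ℕ} (P X Z : Mat n) : Mat n := Z - projPerp P X Z

open scoped Classical in
/-- The degenerate almost complex structure `J_γ` on `T_P M` for the tangent vector `X = γ_x` at
`P`, given by `e ⌋ J_γ(Z) = -ad(Jrm)(e ⌋ Z)` in an adapted frame; `coframe_Jmap` below shows that
the choice of the frame does not matter. -/
def Jmap {n : ℕ} (P X Z : Mat n) : Mat n :=
  if h : ∃ g, IsAdapted P X g then
    vec P (h.choose * (-⁅Jrm n, coframe P h.choose Z⁆) * h.chooseᵀ)
  else 0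

/-! ### The `U(1)` curve flow equation -/

/-- `Q = ad²(c_x)⁻¹ ∇_x c_x`, where `ad²(c_x)` is inverted on `(T_c M)_⊥`. -/
def IsAdSqInvNormal {n : ℕ} (c Q : ℝ → Mat n) : Prop :=
  ∀ x, IsPerp (c x) (deriv c x) (Q x) ∧ adSq (c x) (deriv c x) (Q x) = normal c x

/-- The vector field `J_c(ad²(∇_x c_x)_∥ c_x)` along `c`. -/
def source {n : ℕ} (c : ℝ → Mat n) (x : ℝ) : Mat n :=
  Jmap (c x) (deriv c x) (projPar (c x) (deriv c x) (adSq (c x) (normal c x) (deriv c x)))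

/-- `W = (∇_x - R(c_x, ad²(c_x)⁻¹ ∇_x c_x))⁻¹ F`.  The operator acts on the sections of the
bundle `J_c((T_c M)_∥)` along `c` (which contains `J_c(ad²(∇_x c_x)_∥ c_x)`); in a parallel frame
it is `D_x`, hence, exactly as for the formal inverse of `D_x`, an inverse image of `F` is
determined up to constants of integration. -/
def IsOpInv {n : ℕ} (c F W : ℝ → Mat n) : Prop :=
  ContDiff ℝ ∞ W ∧
  (∀ x, ∃ Z, IsPar (c x) (deriv c x) Z ∧ W x = Jmap (c x) (deriv c x) Z) ∧
  ∃ Q, IsAdSqInvNormal c Q ∧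
    ∀ x, nabla c W x - curv (c x) (deriv c x) (Q x) (W x) = F x

/-- Partial derivative with respect to `x` of a function of `(t, x)`. -/
def dx {E : Type*} [NormedAddCommGroup E] [NormedSpace ℝ E] (f : ℝ → ℝ → E) (t x : ℝ) : E :=
  deriv (fun y => f t y) x

/-- Partial derivative with respect to `t` of a function of `(t, x)`. -/
def dt {E : Type*} [NormedAddCommGroup E] [NormedSpace ℝ E] (f : ℝ → ℝ → E) (t x : ℝ) : E :=
  deriv (fun s => f s x) t

/-- Smoothness of a function of `(t, x)`, for `t ∈ I` and `x ∈ ℝ`. -/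
def Smooth {E : Type*} [NormedAddCommGroup E] [NormedSpace ℝ E] (I : Set ℝ) (f : ℝ → ℝ → E) :
    Prop :=
  ContDiffOn ℝ ∞ (Function.uncurry f) (I ×ˢ Set.univ)

/-- `c` is a smooth arclength-parameterized curve in `M` whose tangent vector belongs to the
algebraic equivalence class of `e`. -/
def IsUnitCurve {n : ℕ} (c : ℝ → Mat n) : Prop :=
  ContDiff ℝ ∞ c ∧ ∀ x, c x ∈ Space n ∧ InClass (c x) (deriv c x) ∧
    metric (c x) (deriv c x) (deriv c x) = 1

/-- `γ(t, x)` is a smooth non-stretching flow of arclength-parameterized curves in `M`. -/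
def IsUnitFlow {n : ℕ} (I : Set ℝ) (γ : ℝ → ℝ → Mat n) : Prop :=
  Smooth I γ ∧ ∀ t ∈ I, IsUnitCurve (γ t)

/-- `γ` is a solution of the `U(1)` curve flow equation
`γ_t = J_γ(∇_x γ_x) - (χ/2) W`, `|γ_x| = 1`, with the nonlocal vector field
`W = (∇_x - R(γ_x, ad²(γ_x)⁻¹ ∇_x γ_x))⁻¹ J_γ(ad²(∇_x γ_x)_∥ γ_x)`. -/
def IsU1CurveFlow {n : ℕ} (I : Set ℝ) (γ W : ℝ → ℝ → Mat n) : Prop :=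
  IsUnitFlow I γ ∧ Smooth I W ∧ ∀ t ∈ I, IsOpInv (γ t) (source (γ t)) (W t) ∧
    ∀ x, dt γ t x =
      Jmap (γ t x) (dx γ t x) (normal (γ t) x) - (chi n / 2) • W t x

/-! ### Parallel frames and the `U(1)` NLS system -/

/-- The frame components `u = ω ⌋ c_x ∈ u(n)` of the linear connection along the curve
`c = g J₀ g⁻¹`, in the frame determined by `g`. -/
def conn {n : ℕ} (g : ℝ → Mat n) (x : ℝ) : Mat n := hPart ((g x)ᵀ * deriv g x)

/-- The frame along `c` determined by `g` is `U(n)`-parallel: the frame components of `c_x` are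
`e`, and those of the connection lie in `h_⊥`. -/
def IsParallelFrame {n : ℕ} (c g : ℝ → Mat n) : Prop :=
  ContDiff ℝ ∞ g ∧ ∀ x, IsAdapted (c x) (deriv c x) (g x) ∧ conn g x ∈ hPerp n

/-- `g` determines a `U(n)`-parallel frame along the flow `γ`, with Hasimoto variables
`v`, `v₁`, `v₂`, that is, `u = √χ ad(e) (v, (v₁, v₂))`. -/
def IsHasimoto {n : ℕ} (I : Set ℝ) (γ g : ℝ → ℝ → Mat n) (v : ℝ → ℝ → ℝ)
    (v₁ v₂ : ℝ → ℝ → CVec n) : Prop :=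
  Smooth I g ∧ ∀ t ∈ I, IsParallelFrame (γ t) (g t) ∧
    ∀ x, conn (g t) x = √(chi n) • ⁅ee n, perpMat (v t x) (v₁ t x) (v₂ t x)⁆

/-- The outer product `a ∧ b = a ⊗ b - b ⊗ a`. -/
def wedge {n : ℕ} (a b : CVec n) : CMat n := Matrix.vecMulVec a b - Matrix.vecMulVec b a

/-- `|a|²` for a complex vector. -/
def vecSq {n : ℕ} (a : CVec n) : ℝ := ∑ i, ‖a i‖ ^ 2

/-- `|K|²` for a complex matrix. -/
def matSq {n : ℕ} (K : CMat n) : ℝ := ∑ i, ∑ j, ‖K i j‖ ^ 2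

/-- `K = D_x⁻¹ (v₁ ∧ v₂)`: a smooth antiderivative, with skew values. -/
def IsPotential {n : ℕ} (I : Set ℝ) (v₁ v₂ : ℝ → ℝ → CVec n) (K : ℝ → ℝ → CMat n) : Prop :=
  Smooth I K ∧ ∀ t ∈ I, ∀ x, (K t x)ᵀ = -K t x ∧ dx K t x = wedge (v₁ t x) (v₂ t x)

/-- The right-hand side of the evolution equation of `w₁`, with `K = D_x⁻¹ (w₁ ∧ w₂)`:
`i w₁ₓₓ + i (4v² + |w₁|² + |w₂|²) w₁ - 2 vₓ w₁
  - (2i w̄₂ₓ + 4v w̄₂ + 2i w₁ ⌋ K̄) ⌋ K`. -/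
def nlsRHS {n : ℕ} (v : ℝ → ℝ → ℝ) (w₁ w₂ : ℝ → ℝ → CVec n) (K : ℝ → ℝ → CMat n) (t x : ℝ) :
    CVec n :=
  Complex.I • dx (dx w₁) t x
    + (Complex.I * ((4 * v t x ^ 2 + vecSq (w₁ t x) + vecSq (w₂ t x) : ℝ) : ℂ)) • w₁ t x
    - ((2 * dx v t x : ℝ) : ℂ) • w₁ t x
    - ((2 * Complex.I) • star (dx w₂ t x) + ((4 * v t x : ℝ) : ℂ) • star (w₂ t x)
        + (2 * Complex.I) • (w₁ t x ᵥ* (K t x).map (starRingEnd ℂ))) ᵥ* K t x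

/-- The nonlocal `U(1)` NLS system, with `K = D_x⁻¹ (v₁ ∧ v₂)`. -/
def IsU1NLS {n : ℕ} (I : Set ℝ) (v : ℝ → ℝ → ℝ) (v₁ v₂ : ℝ → ℝ → CVec n)
    (K : ℝ → ℝ → CMat n) : Prop :=
  Smooth I v ∧ Smooth I v₁ ∧ Smooth I v₂ ∧ IsPotential I v₁ v₂ K ∧
  ∀ t ∈ I, ∀ x,
    dt v t x = -(1 / 2) *
      dx (fun s y => vecSq (v₁ s y) + vecSq (v₂ s y) + matSq (K s y)) t x ∧
    dt v₁ t x - (Complex.I / (chi n : ℂ)) • v₁ t x = nlsRHS v v₁ v₂ K t x ∧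
    dt v₂ t x - (Complex.I / (chi n : ℂ)) • v₂ t x =
      nlsRHS v v₂ v₁ (fun s y => -K s y) t x

/-- In the frame determined by `g`, the nonlocal vector field `W` of the curve flow has the
components `4 χ^(-3/2) (0, i K) ∈ m_∥`. -/
def IsLinked {n : ℕ} (I : Set ℝ) (γ g W : ℝ → ℝ → Mat n) (K : ℝ → ℝ → CMat n) : Prop :=
  ∀ t ∈ I, ∀ x, IsTangent (γ t x) (W t x) ∧
    coframe (γ t x) (g t x) (W t x) = (4 / √(chi n) ^ 3) • parMat 0 (Complex.I • K t x)

/-! ### Sanity facts: the isotropy group, and well-definedness of `J_γ` -/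

theorem SO_transpose_mul {n : ℕ} {g : Mat n} (hg : g ∈ SO n) : gᵀ * g = 1 := by
  have h := (Matrix.mem_specialOrthogonalGroup_iff.1 hg).1
  exact (Matrix.mem_orthogonalGroup_iff' _ _).1 h

theorem SO_mul_transpose {n : ℕ} {g : Mat n} (hg : g ∈ SO n) : g * gᵀ = 1 := by
  have h := (Matrix.mem_specialOrthogonalGroup_iff.1 hg).1
  exact (Matrix.mem_orthogonalGroup_iff _ _).1 h

theorem J0_mul_J0 (n : ℕ) : J0 n * J0 n = -1 := by
  rw [J0, Matrix.fromBlocks_multiply]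
  simp only [mul_zero, mul_one, mul_neg, zero_add, add_zero, neg_zero]
  rw [show (1 : Mat n) = Matrix.fromBlocks 1 0 0 1 from Matrix.fromBlocks_one.symm,
    Matrix.fromBlocks_neg]
  simp only [neg_zero]

/-- The isotropy group of `J₀` in `SO(2n)` is `U(n)`. -/
theorem isotropy_iff {n : ℕ} {g : Mat n} (hg : g ∈ SO n) :
    g * J0 n * gᵀ = J0 n ↔ ∃ U ∈ Matrix.unitaryGroup (Ix n) ℂ, g = realify U := by
  have h1 := SO_transpose_mul hg
  have hcomm : g * J0 n * gᵀ = J0 n ↔ g * J0 n = J0 n * g := by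
    constructor
    · intro h
      calc g * J0 n = g * J0 n * (gᵀ * g) := by rw [h1, mul_one]
        _ = g * J0 n * gᵀ * g := by noncomm_ring
        _ = J0 n * g := by rw [h]
    · intro h
      rw [h, mul_assoc, SO_mul_transpose hg, mul_one]
  rw [hcomm]
  constructor
  · intro h
    rw [← Matrix.fromBlocks_toBlocks g] at h h1 ⊢
    generalize g.toBlocks₁₁ = A at *
    generalize g.toBlocks₁₂ = B at *
    generalize g.toBlocks₂₁ = C at *
    generalize g.toBlocks₂₂ = D at *
    rw [J0, Matrix.fromBlocks_multiply, Matrix.fromBlocks_multiply, Matrix.fromBlocks_inj] at h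
    obtain ⟨e1, e2, -, -⟩ := h
    simp at e1 e2
    subst e2
    have hC : C = -B := by rw [← e1]
    subst hC
    rw [Matrix.fromBlocks_transpose, Matrix.fromBlocks_multiply, ← Matrix.fromBlocks_one,
      Matrix.fromBlocks_inj] at h1
    obtain ⟨f1, f2, -, -⟩ := h1
    simp at f1 f2
    refine ⟨Matrix.of fun i j => ⟨A i j, B i j⟩, ?_, ?_⟩
    · rw [Matrix.mem_unitaryGroup_iff']
      ext i j
      have g1 := congrFun (congrFun f1 i) j
      have g2 := congrFun (congrFun f2 i) j
      simp only [Matrix.add_apply, Matrix.neg_apply, Matrix.mul_apply, Matrix.transpose_apply]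
        at g1 g2
      apply Complex.ext
      · simp only [Matrix.mul_apply, Matrix.star_apply, Matrix.of_apply, Complex.re_sum,
          Complex.mul_re, Complex.star_def, Complex.conj_re, Complex.conj_im]
        rw [show ((1 : Matrix (Ix n) (Ix n) ℂ) i j).re = (1 : Matrix (Ix n) (Ix n) ℝ) i j by
          by_cases hij : i = j <;> simp [Matrix.one_apply, hij], ← g1, ← Finset.sum_add_distrib]
        exact Finset.sum_congr rfl fun k _ => by ring
      · simp only [Matrix.mul_apply, Matrix.star_apply, Matrix.of_apply, Complex.im_sum,
          Complex.mul_im, Complex.star_def, Complex.conj_re, Complex.conj_im]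
        rw [show ((1 : Matrix (Ix n) (Ix n) ℂ) i j).im = 0 by
          by_cases hij : i = j <;> simp [Matrix.one_apply, hij]]
        rw [← sub_eq_add_neg, ← Finset.sum_sub_distrib] at g2
        refine Eq.trans ?_ g2
        exact Finset.sum_congr rfl fun k _ => by ring
    · rfl
  · rintro ⟨U, -, rfl⟩
    simp [realify, hMat, J0, Matrix.fromBlocks_multiply]

theorem Jrm_eq {n : ℕ} (hn : 2 ≤ n) : Jrm n = J0 n * (1 + chi n • (ee n * ee n)) := by
  have hn' : (2 : ℝ) ≤ n := by exact_mod_cast hn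
  have hc : 0 < chi n := by unfold chi; linarith
  have hs : chi n * ((√(chi n))⁻¹ * (√(chi n))⁻¹) = 1 := by
    rw [← mul_inv, Real.mul_self_sqrt hc.le, mul_inv_cancel₀ hc.ne']
  have h2 : ∀ a : ℝ, !![0, a; -a, 0] * !![0, a; -a, 0]
      = (-(a * a)) • (1 : Matrix (Fin 2) (Fin 2) ℝ) := by
    intro a
    ext i j
    fin_cases i <;> fin_cases j <;> simp [Matrix.mul_apply, Fin.sum_univ_two]
  have hM : ee n = Matrix.fromBlocks
      (Matrix.fromBlocks !![0, (√(chi n))⁻¹; -(√(chi n))⁻¹, 0] 0 0 0) 0 0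
      (-(Matrix.fromBlocks !![0, (√(chi n))⁻¹; -(√(chi n))⁻¹, 0] 0 0 0)) := by
    rw [ee, parMat, mMat, one_div, Matrix.map_zero _ Complex.zero_re,
      Matrix.map_zero _ Complex.zero_im, Matrix.fromBlocks_zero]
  have hA : chi n • (ee n * ee n) = Matrix.fromBlocks (Matrix.fromBlocks (-1) 0 0 0) 0 0
          (Matrix.fromBlocks (-1) 0 0 0) := by
    have hs' : chi n • (-((√(chi n))⁻¹ * (√(chi n))⁻¹)) • (1 : Matrix (Fin 2) (Fin 2) ℝ) = -1 := by
      rw [smul_smul, mul_neg, hs, neg_one_smul]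
    rw [hM, Matrix.fromBlocks_multiply]
    simp only [mul_zero, zero_mul, Matrix.zero_mul, Matrix.mul_zero, add_zero, zero_add,
      neg_mul_neg, Matrix.fromBlocks_multiply, h2,
      Matrix.fromBlocks_smul, smul_zero, hs']
  rw [hA, Jrm, J0, hMat, show (1 : Mat n) = Matrix.fromBlocks (Matrix.fromBlocks 1 0 0 1) 0 0
    (Matrix.fromBlocks 1 0 0 1) by rw [Matrix.fromBlocks_one, Matrix.fromBlocks_one],
    Matrix.fromBlocks_add, Matrix.fromBlocks_multiply]
  simp only [mul_zero, zero_mul, add_zero, zero_add, one_mul, neg_mul, Matrix.fromBlocks_add,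
    add_neg_cancel]

/-- In every adapted frame, `J_γ` acts as `-ad(Jrm)`. -/
theorem coframe_Jmap {n : ℕ} (hn : 2 ≤ n) {P X Z g : Mat n} (hg : IsAdapted P X g)
    (hZ : IsTangent P Z) :
    coframe P g (Jmap P X Z) = -⁅Jrm n, coframe P g Z⁆ := by
  have key : ∀ k : Mat n, IsAdapted P X k →
      k * Jrm n * kᵀ = P * (1 + chi n • (gen P X * gen P X)) := by
    rintro k ⟨hk, hP, hX⟩
    have hk1 := SO_mul_transpose hk
    have hk2 := SO_transpose_mul hk
    have hX' : gen P X = k * ee n * kᵀ := by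
      rw [← hX, coframe]
      calc gen P X = (k * kᵀ) * gen P X * (k * kᵀ) := by rw [hk1, one_mul, mul_one]
        _ = _ := by noncomm_ring
    have e1 : gen P X * gen P X = k * (ee n * ee n) * kᵀ := by
      rw [hX']
      calc _ = k * ee n * (kᵀ * k) * ee n * kᵀ := by noncomm_ring
        _ = _ := by rw [hk2]; noncomm_ring
    have e2 : (1 : Mat n) + chi n • (gen P X * gen P X)
        = k * (1 + chi n • (ee n * ee n)) * kᵀ := by
      rw [e1, mul_add, add_mul, mul_one, hk1, mul_smul_comm, smul_mul_assoc]
    rw [e2, Jrm_eq hn]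
    rw [hP]
    generalize (1 : Mat n) + chi n • (ee n * ee n) = Y
    calc _ = k * J0 n * 1 * Y * kᵀ := by noncomm_ring
      _ = k * J0 n * (kᵀ * k) * Y * kᵀ := by rw [hk2]
      _ = _ := by noncomm_ring
  have hex : ∃ g, IsAdapted P X g := ⟨g, hg⟩
  have hc := hex.choose_spec
  have hg1 := SO_mul_transpose hg.1
  have hg2 := SO_transpose_mul hg.1
  have hh1 := SO_mul_transpose hc.1
  have hPP : P * P = -1 := by
    rw [hg.2.1]
    calc _ = g * J0 n * (gᵀ * g) * J0 n * gᵀ := by noncomm_ring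
      _ = g * (J0 n * J0 n) * gᵀ := by rw [hg2]; noncomm_ring
      _ = -1 := by rw [J0_mul_J0]; simp [hg1]
  have hJm : Jmap P X Z = vec P (-⁅g * Jrm n * gᵀ, gen P Z⁆) := by
    rw [Jmap, dif_pos hex, key g hg, ← key _ hc]
    congr 1
    generalize hex.choose = h at *
    rw [coframe, Ring.lie_def, Ring.lie_def]
    calc _ = -(h * Jrm n * hᵀ * gen P Z * (h * hᵀ) - (h * hᵀ) * gen P Z * h * Jrm n * hᵀ) := by
          noncomm_ring
      _ = _ := by rw [hh1]; noncomm_ring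
  have hT : P * gen P Z = -(gen P Z * P) := by
    have h1 : P * Z = -(Z * P) := by rw [hZ.2, neg_neg]
    simp only [gen, mul_smul_comm, smul_mul_assoc]
    rw [← mul_assoc, h1, ← smul_neg]
    noncomm_ring
  have hC : P * (g * Jrm n * gᵀ) = (g * Jrm n * gᵀ) * P := by
    have hJ : J0 n * Jrm n = Jrm n * J0 n := by
      simp [J0, Jrm, hMat, Matrix.fromBlocks_multiply]
    rw [hg.2.1]
    calc _ = g * J0 n * (gᵀ * g) * Jrm n * gᵀ := by noncomm_ring
      _ = g * (J0 n * Jrm n) * gᵀ := by rw [hg2]; noncomm_ring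
      _ = g * Jrm n * 1 * J0 n * gᵀ := by rw [hJ]; noncomm_ring
      _ = g * Jrm n * (gᵀ * g) * J0 n * gᵀ := by rw [hg2]
      _ = _ := by noncomm_ring
  have hgen : gen P (Jmap P X Z) = -⁅g * Jrm n * gᵀ, gen P Z⁆ := by
    rw [hJm]
    have hA : P * -⁅g * Jrm n * gᵀ, gen P Z⁆ = -(-⁅g * Jrm n * gᵀ, gen P Z⁆ * P) := by
      generalize g * Jrm n * gᵀ = S at *
      generalize gen P Z = ξ at *
      rw [Ring.lie_def]
      calc _ = -((P * S) * ξ - (P * ξ) * S) := by noncomm_ring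
        _ = -(S * -(ξ * P) + ξ * (S * P)) := by
          rw [hC, show (S * P) * ξ = S * (P * ξ) from mul_assoc _ _ _, hT, neg_mul,
            show ξ * P * S = ξ * (S * P) by rw [mul_assoc, hC]]
          noncomm_ring
        _ = _ := by noncomm_ring
    generalize -⁅g * Jrm n * gᵀ, gen P Z⁆ = η at *
    rw [gen, vec, Ring.lie_def, hA]
    have : (η * P - -(η * P)) * P = -(2 : ℝ) • η := by
      calc _ = η * (P * P) + η * (P * P) := by noncomm_ring
        _ = _ := by rw [hPP, mul_neg, mul_one, neg_smul, two_smul, neg_add]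
    rw [this, smul_smul]
    norm_num
  rw [coframe, hgen, coframe, Ring.lie_def, Ring.lie_def]
  calc _ = -((gᵀ * g) * Jrm n * gᵀ * gen P Z * g - gᵀ * gen P Z * g * Jrm n * (gᵀ * g)) := by
        noncomm_ring
    _ = _ := by rw [hg2]; noncomm_ring

end SOU

end

open SOU

/-!
The Lie algebra of `SO(2n)` is modelled by pairs of complex `n × n` matrices: `cx S T` is the real
matrix of the map `z ↦ S z + T z̄`, so that `cx S 0` with skew-Hermitian `S` runs through `u(n)` and
`cx 0 T` with skew `T` through `m`.  Splitting `n = 2 + (n - 2)`, an element of `m` is a block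
matrix `mcx a Z H` with `a ∈ ℂ`, a `2 × (n - 2)` matrix `Z` with the rows `z₁`, `z₂`, and a skew
matrix `H`, and `e` has the only block `a = χ^(-1/2)`.  The operator `ad(e)²` is `0` on `m_∥`
(`a ∈ ℝ` and `H`), and `-4/χ`, `-1/χ` on the two components of `m_⊥` (`a ∈ iℝ` and `Z`); `J` acts as
`0` on `a`, as `i` on `Z` and as `2i` on `H`.  The elements `ucx v Z` of `h_⊥` carry the Hasimoto
variables.  All tensors of the statement become operations on such blocks once they are expressed
in an adapted frame, and `coframe_nabla` does the same for the covariant derivative: it acts as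
`D_x + ad(u)`.

In a parallel frame the principal normal has the components `[u, e]`, and the curvature term of
the nonlocal operator cancels `ad(u)`, which leaves `D_x`.  This gives `IsFramed.isOpInv` and with
it `isU1CurveFlow_iff`, the form of the curve flow equation in Hasimoto variables.

A solution of the curve flow equation has a smooth parallel frame: the transvection along the
velocity, corrected by an element of `h_⊥` which is a polynomial in `ad(ξ)` (`rotGen`), rotates the
tangent vector in the right way, and the frame solves a linear differential equation with this
generator (`IsUnitFlow.exists_frame`).  Smoothness in both variables follows from the Picard series,
since the derivative of the solution in the parameter solves an equation of the same kind
(`linearSol_augmented`).  Such a frame is unique up to a rotation fixing `e`, depending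
on `t`, and this gauge is fixed by prescribing the component in `h_∥` of the connection in `t`
direction along `x = 0` (`gaugeGen`, `gaugeBlock`).

The Maurer–Cartan equation of the frame (`flatness`) then splits into blocks (`zeroCurv_iff`).  Its
`m`-part yields `K_x = v₁ ∧ v₂` and the off-diagonal block `omOff` of the connection in `t`
direction; the trace of the `2 × 2` block of its `u(n)`-part yields the equation for `v`, the
diagonal blocks can be integrated in `x`, with constants that vanish by the choice of the gauge, and
the off-diagonal block is the evolution equation for `v₁` and `v₂` (`IsU1CurveFlow.exists_nls`).
Conversely, a solution of the NLS system defines `U = e + u` and `V = nlsV` with zero curvature; the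
linear system `g_x = g U`, `g_t = g V` has a solution in `SO(2n)` (`exists_frame_of_zeroCurv`), and
`γ = g J₀ gᵀ` solves the curve flow equation (`IsU1NLS.exists_flow`).

Invariance holds because an isometry moves frames along without changing components.  Arclength is
preserved because the component of `∇_x Y` along `e` is, for the local part, the real part of a
multiple of `i |Z|²`, and for the nonlocal part zero since `W` commutes with `e`.
-/

noncomputable section

namespace SOU

/-! ### Linear differential equations depending smoothly on a parameter -/

section LinearODE

open Set Filter Topology MeasureTheory

universe u

variable {E : Type u} [NormedAddCommGroup E] [NormedSpace ℝ E]

/-- The Picard iterates of the equation `X_x = A(t, x) X` with `X(t, 0) = b t`. -/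
def picardIter (A : ℝ → ℝ → E →L[ℝ] E) (b : ℝ → E) : ℕ → ℝ → ℝ → E
  | 0 => fun t _ => b t
  | k + 1 => fun t x => ∫ y in (0 : ℝ)..x, A t y (picardIter A b k t y)

/-- The solution of `X_x = A(t, x) X`, `X(t, 0) = b t`, as the sum of the Picard iterates. -/
def linearSol (A : ℝ → ℝ → E →L[ℝ] E) (b : ℝ → E) (t x : ℝ) : E :=
  ∑' k, picardIter A b k t x

variable {A : ℝ → ℝ → E →L[ℝ] E} {b : ℝ → E}

theorem continuous_picardIter (hA : Continuous (Function.uncurry A)) (hb : Continuous b) (k : ℕ) :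
    Continuous (Function.uncurry (picardIter A b k)) := by
  induction k with
  | zero => exact hb.comp continuous_fst
  | succ k ih =>
    have h : Continuous (Function.uncurry fun (p : ℝ × ℝ) (y : ℝ) =>
        A p.1 y (picardIter A b k p.1 y)) := by
      have h1 : Continuous fun q : (ℝ × ℝ) × ℝ => A q.1.1 q.2 :=
        hA.comp (continuous_fst.fst.prodMk continuous_snd)
      have h2 : Continuous fun q : (ℝ × ℝ) × ℝ => picardIter A b k q.1.1 q.2 :=
        ih.comp (continuous_fst.fst.prodMk continuous_snd)
      exact h1.clm_apply h2
    exact intervalIntegral.continuous_parametric_intervalIntegral_of_continuous h continuous_snd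

theorem continuous_picard_integrand (hA : Continuous (Function.uncurry A)) (hb : Continuous b)
    (k : ℕ) (t : ℝ) : Continuous fun y => A t y (picardIter A b k t y) :=
  (hA.comp (Continuous.prodMk_right t)).clm_apply
    ((continuous_picardIter hA hb k).comp (Continuous.prodMk_right t))

theorem hasDerivAt_picardIter_succ [CompleteSpace E] (hA : Continuous (Function.uncurry A))
    (hb : Continuous b) (k : ℕ) (t x : ℝ) :
    HasDerivAt (picardIter A b (k + 1) t) (A t x (picardIter A b k t x)) x :=
  intervalIntegral.integral_hasDerivAt_right
    ((continuous_picard_integrand hA hb k t).intervalIntegrable _ _)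
    ((continuous_picard_integrand hA hb k t).stronglyMeasurableAtFilter _ _)
    (continuous_picard_integrand hA hb k t).continuousAt

/-- The factorial in the bound is gained by integrating `|x|^k` at each step. -/
theorem norm_picardIter_le {C B R : ℝ} {t : ℝ} (hB : ‖b t‖ ≤ B)
    (hC : ∀ y, |y| ≤ R → ‖A t y‖ ≤ C) (hC0 : 0 ≤ C) (k : ℕ) :
    ∀ x, |x| ≤ R → ‖picardIter A b k t x‖ ≤ B * ((C * |x|) ^ k / k.factorial) := by
  have hB0 : 0 ≤ B := (norm_nonneg _).trans hB
  induction k with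
  | zero => intro x _; simpa [picardIter] using hB
  | succ k ih =>
    intro x hx
    have key : ‖picardIter A b (k + 1) t x‖
        ≤ |∫ y in (0 : ℝ)..x, C * (B * ((C * |y|) ^ k / k.factorial))| := by
      refine intervalIntegral.norm_integral_le_abs_of_norm_le ?_ ?_
      · refine (ae_restrict_iff' measurableSet_uIoc).2 (ae_of_all _ fun y hy => ?_)
        have hy' : |y| ≤ R := by
          rw [mem_uIoc] at hy
          rw [abs_le] at hx ⊢
          rcases hy with ⟨h1, h2⟩ | ⟨h1, h2⟩ <;> constructor <;> linarith
        exact ((A t y).le_opNorm _).trans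
          (mul_le_mul (hC y hy') (ih y hy') (norm_nonneg _) hC0)
      · exact Continuous.intervalIntegrable (by fun_prop) _ _
    refine key.trans (le_of_eq ?_)
    have hint : ∀ z : ℝ, 0 ≤ z → ∫ y in (0 : ℝ)..z, C * (B * ((C * |y|) ^ k / k.factorial))
        = B * ((C * z) ^ (k + 1) / (k + 1).factorial) := by
      intro z hz
      have e : ∫ y in (0 : ℝ)..z, C * (B * ((C * |y|) ^ k / k.factorial))
          = ∫ y in (0 : ℝ)..z, (C ^ (k + 1) * B / k.factorial) * y ^ k := by
        refine intervalIntegral.integral_congr fun y hy => ?_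
        rw [uIcc_of_le hz] at hy
        simp only [abs_of_nonneg hy.1]
        ring
      rw [e, intervalIntegral.integral_const_mul, integral_pow, Nat.factorial_succ]
      push_cast
      have : (k.factorial : ℝ) ≠ 0 := by positivity
      field_simp
      ring
    rcases le_total 0 x with h | h
    · rw [hint x h, abs_of_nonneg h, abs_of_nonneg]
      positivity
    · have e2 : ∫ y in (0 : ℝ)..x, C * (B * ((C * |y|) ^ k / k.factorial))
          = -∫ y in (0 : ℝ)..(-x), C * (B * ((C * |y|) ^ k / k.factorial)) := by
        have := intervalIntegral.integral_comp_neg (a := 0) (b := -x)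
          (fun y => C * (B * ((C * |y|) ^ k / k.factorial)))
        simp only [abs_neg, neg_neg, neg_zero] at this
        rw [this, intervalIntegral.integral_symm]
      rw [e2, hint (-x) (by linarith), abs_neg, abs_of_nonpos h, abs_of_nonneg]
      have : 0 ≤ -x := by linarith
      positivity

/-- On every box the Picard iterates are bounded by the terms of an exponential series. -/
theorem exists_picard_bound (hA : Continuous (Function.uncurry A)) (hb : Continuous b) (R : ℝ) :
    ∃ w : ℕ → ℝ, Summable w ∧
      (∀ k t x, |t| ≤ R → |x| ≤ R → ‖picardIter A b k t x‖ ≤ w k) ∧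
      ∃ C, 0 ≤ C ∧ ∀ t x, |t| ≤ R → |x| ≤ R → ‖A t x‖ ≤ C := by
  have hK : IsCompact (Icc (-R) R) := isCompact_Icc
  obtain ⟨B, hB⟩ := hK.exists_bound_of_continuousOn hb.continuousOn
  obtain ⟨C, hC⟩ := (hK.prod hK).exists_bound_of_continuousOn hA.continuousOn
  have hC' : ∀ t x, |t| ≤ R → |x| ≤ R → ‖A t x‖ ≤ max C 0 := fun t x ht hx =>
    (hC (t, x) ⟨abs_le.1 ht, abs_le.1 hx⟩).trans (le_max_left _ _)
  refine ⟨fun k => max B 0 * ((max C 0 * R) ^ k / k.factorial),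
    (Real.summable_pow_div_factorial _).mul_left _, fun k t x ht hx => ?_,
    max C 0, le_max_right _ _, hC'⟩
  refine (norm_picardIter_le (B := max B 0) ((hB t (abs_le.1 ht)).trans (le_max_left _ _))
    (hC' t · ht) (le_max_right _ _) k x hx).trans ?_
  have : max C 0 * |x| ≤ max C 0 * R := mul_le_mul_of_nonneg_left hx (le_max_right _ _)
  show max B 0 * ((max C 0 * |x|) ^ k / k.factorial) ≤ max B 0 * ((max C 0 * R) ^ k / k.factorial)
  gcongr

theorem continuous_linearSol [CompleteSpace E] (hA : Continuous (Function.uncurry A))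
    (hb : Continuous b) :
    Continuous (Function.uncurry (linearSol A b)) := by
  rw [continuous_iff_continuousAt]
  rintro ⟨t, x⟩
  set R := max |t| |x| + 1
  obtain ⟨w, hw, hbd, -⟩ := exists_picard_bound hA hb R
  have ht : |t| < R := (le_max_left _ _).trans_lt (lt_add_one _)
  have hx : |x| < R := (le_max_right _ _).trans_lt (lt_add_one _)
  have hcont : ContinuousOn (fun p : ℝ × ℝ => ∑' k, picardIter A b k p.1 p.2)
      (Ioo (-R) R ×ˢ Ioo (-R) R) :=
    continuousOn_tsum (fun k => (continuous_picardIter hA hb k).continuousOn) hw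
      fun k p hp => hbd k _ _ (abs_le.2 ⟨hp.1.1.le, hp.1.2.le⟩) (abs_le.2 ⟨hp.2.1.le, hp.2.2.le⟩)
  exact hcont.continuousAt (prod_mem_nhds (Ioo_mem_nhds (abs_lt.1 ht).1 (abs_lt.1 ht).2)
    (Ioo_mem_nhds (abs_lt.1 hx).1 (abs_lt.1 hx).2))

theorem linearSol_zero (t : ℝ) : linearSol A b t 0 = b t := by
  rw [linearSol, tsum_eq_single 0]
  · rfl
  · intro k hk
    obtain ⟨j, rfl⟩ := Nat.exists_eq_succ_of_ne_zero hk
    simp [picardIter]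

theorem hasDerivAt_linearSol [CompleteSpace E] (hA : Continuous (Function.uncurry A))
    (hb : Continuous b) (t x : ℝ) : HasDerivAt (linearSol A b t) (A t x (linearSol A b t x)) x := by
  set R := max |t| |x| + 1
  obtain ⟨w, hw, hbd, C, hC0, hC⟩ := exists_picard_bound hA hb R
  have ht : |t| < R := (le_max_left _ _).trans_lt (lt_add_one _)
  have hx : |x| < R := (le_max_right _ _).trans_lt (lt_add_one _)
  have hsum : ∀ y, |y| ≤ R → Summable fun k => picardIter A b k t y := fun y hy =>
    .of_norm_bounded hw fun k => hbd k t y ht.le hy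
  have hD : HasDerivAt (fun y => ∑' k, picardIter A b (k + 1) t y)
      (∑' k, A t x (picardIter A b k t x)) x := by
    refine hasDerivAt_tsum_of_isPreconnected (t := Ioo (-R) R) (hw.mul_left C) isOpen_Ioo
      isPreconnected_Ioo (fun k y _ => hasDerivAt_picardIter_succ hA hb k t y)
      (fun k y hy => ?_) (y₀ := x) (abs_lt.1 hx)
      ((summable_nat_add_iff 1).2 (hsum x hx.le)) (abs_lt.1 hx)
    have hy' : |y| ≤ R := abs_le.2 ⟨hy.1.le, hy.2.le⟩
    exact ((A t y).le_opNorm _).trans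
      (mul_le_mul (hC t y ht.le hy') (hbd k t y ht.le hy') (norm_nonneg _) hC0)
  rw [← (A t x).map_tsum (hsum x hx.le)] at hD
  refine (hD.const_add (b t)).congr_of_eventuallyEq ?_
  filter_upwards [Ioo_mem_nhds (abs_lt.1 hx).1 (abs_lt.1 hx).2] with y hy
  exact (hsum y (abs_le.2 ⟨hy.1.le, hy.2.le⟩)).tsum_eq_zero_add

/-- The coefficients of the equation satisfied by the pair `(X, X_t)`. -/
def augmented (A A' : ℝ → ℝ → E →L[ℝ] E) (t x : ℝ) : E × E →L[ℝ] E × E :=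
  ((A t x).comp (ContinuousLinearMap.fst ℝ E E)).prod
    ((A t x).comp (ContinuousLinearMap.snd ℝ E E) +
      (A' t x).comp (ContinuousLinearMap.fst ℝ E E))

section Param

variable {A' : ℝ → ℝ → E →L[ℝ] E} {b' : ℝ → E}

theorem continuous_augmented (hA : Continuous (Function.uncurry A))
    (hA' : Continuous (Function.uncurry A')) :
    Continuous (Function.uncurry (augmented A A')) := by
  have h1 : Continuous fun p : ℝ × ℝ => A p.1 p.2 := hA
  have h2 : Continuous fun p : ℝ × ℝ => A' p.1 p.2 := hA'
  exact (ContinuousLinearMap.prodₗᵢ ℝ (E := E × E) (F := E) (G := E)).continuous.comp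
    ((h1.clm_comp continuous_const).prodMk
      ((h1.clm_comp continuous_const).add (h2.clm_comp continuous_const)))

/-- The Picard iterates of the equation of `(X, X_t)` are those of `X` and their derivatives. -/
theorem picardIter_augmented [CompleteSpace E] (hA : Continuous (Function.uncurry A))
    (hA' : Continuous (Function.uncurry A')) (hb : Continuous b) (hb' : Continuous b')
    (hdA : ∀ t x, HasDerivAt (fun s => A s x) (A' t x) t) (hdb : ∀ t, HasDerivAt b (b' t) t)
    (k : ℕ) : ∀ t x,
      (picardIter (augmented A A') (fun t => (b t, b' t)) k t x).1 = picardIter A b k t x ∧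
      HasDerivAt (fun s => picardIter A b k s x)
        (picardIter (augmented A A') (fun t => (b t, b' t)) k t x).2 t := by
  have hAA := continuous_augmented hA hA'
  have hbb : Continuous fun t => (b t, b' t) := hb.prodMk hb'
  induction k with
  | zero => exact fun t x => ⟨rfl, hdb t⟩
  | succ k ih =>
    intro t x
    have hcont := continuous_picard_integrand hAA hbb k t
    have hint := hcont.intervalIntegrable (μ := volume) 0 x
    have e1 : (picardIter (augmented A A') (fun t => (b t, b' t)) (k + 1) t x).1
        = ∫ y in (0 : ℝ)..x, (augmented A A' t y
          (picardIter (augmented A A') (fun t => (b t, b' t)) k t y)).1 :=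
      ((ContinuousLinearMap.fst ℝ E E).intervalIntegral_comp_comm hint).symm
    have e2 : (picardIter (augmented A A') (fun t => (b t, b' t)) (k + 1) t x).2
        = ∫ y in (0 : ℝ)..x, (augmented A A' t y
          (picardIter (augmented A A') (fun t => (b t, b' t)) k t y)).2 :=
      ((ContinuousLinearMap.snd ℝ E E).intervalIntegral_comp_comm hint).symm
    refine ⟨?_, ?_⟩
    · rw [e1]
      exact intervalIntegral.integral_congr fun y _ => by
        simp [augmented, (ih t y).1]
    · rw [e2]
      have hF' : Continuous fun p : ℝ × ℝ => (augmented A A' p.1 p.2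
          (picardIter (augmented A A') (fun t => (b t, b' t)) k p.1 p.2)).2 :=
        (Continuous.clm_apply (f := fun p : ℝ × ℝ => augmented A A' p.1 p.2) hAA
          (continuous_picardIter hAA hbb k)).snd
      obtain ⟨C, hC⟩ := ((isCompact_Icc (a := t - 1) (b := t + 1)).prod
        (isCompact_uIcc (a := (0 : ℝ)) (b := x))).exists_bound_of_continuousOn hF'.continuousOn
      refine (intervalIntegral.hasDerivAt_integral_of_dominated_loc_of_deriv_le
        (bound := fun _ => C) (s := Icc (t - 1) (t + 1))
        (F' := fun s y => (augmented A A' s y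
          (picardIter (augmented A A') (fun t => (b t, b' t)) k s y)).2)
        (Icc_mem_nhds (by linarith) (by linarith))
        (Eventually.of_forall fun s =>
          (continuous_picard_integrand hA hb k s).aestronglyMeasurable)
        ((continuous_picard_integrand hA hb k t).intervalIntegrable _ _)
        (hcont.snd.aestronglyMeasurable)
        (ae_of_all _ fun y hy s hs => hC (s, y) ⟨hs, uIoc_subset_uIcc hy⟩)
        intervalIntegrable_const
        (ae_of_all _ fun y _ s _ => ?_)).2
      have := (hdA s y).clm_apply (ih s y).2
      simpa [augmented, (ih s y).1, add_comm] using this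

/-- The solution is differentiable in the parameter, and `(X, X_t)` solves the augmented equation:
the series of the `t` derivatives of the Picard iterates converges uniformly on boxes. -/
theorem linearSol_augmented [CompleteSpace E] (hA : Continuous (Function.uncurry A))
    (hA' : Continuous (Function.uncurry A')) (hb : Continuous b) (hb' : Continuous b')
    (hdA : ∀ t x, HasDerivAt (fun s => A s x) (A' t x) t) (hdb : ∀ t, HasDerivAt b (b' t) t)
    (t x : ℝ) :
    HasDerivAt (fun s => linearSol A b s x)
      (linearSol (augmented A A') (fun t => (b t, b' t)) t x).2 t := by
  have hAA := continuous_augmented hA hA'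
  have hbb : Continuous fun t => (b t, b' t) := hb.prodMk hb'
  have hP := picardIter_augmented hA hA' hb hb' hdA hdb
  set R := max |t| |x| + 1
  obtain ⟨w, hw, hbd, -⟩ := exists_picard_bound hAA hbb R
  have ht : |t| < R := (le_max_left _ _).trans_lt (lt_add_one _)
  have hx : |x| < R := (le_max_right _ _).trans_lt (lt_add_one _)
  have hsum : Summable fun k => picardIter (augmented A A') (fun t => (b t, b' t)) k t x :=
    .of_norm_bounded hw fun k => hbd k t x ht.le hx.le
  have e : (linearSol (augmented A A') (fun t => (b t, b' t)) t x).2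
      = ∑' k, (picardIter (augmented A A') (fun t => (b t, b' t)) k t x).2 :=
    (ContinuousLinearMap.snd ℝ E E).map_tsum hsum
  rw [e]
  refine hasDerivAt_tsum_of_isPreconnected (t := Ioo (-R) R) hw isOpen_Ioo
    isPreconnected_Ioo (fun k s _ => (hP k s x).2) (fun k s hs => ?_) (y₀ := t) (abs_lt.1 ht)
    ?_ (abs_lt.1 ht)
  · exact (norm_snd_le _).trans (hbd k s x (abs_le.2 ⟨hs.1.le, hs.2.le⟩) hx.le)
  · exact (hsum.map (ContinuousLinearMap.fst ℝ E E)
      (ContinuousLinearMap.fst ℝ E E).continuous).congr fun k => (hP k t x).1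

end Param

end LinearODE

/-! ### Functions of two real variables and their partial derivatives -/

section Partial

open Set Filter Topology

variable {F : Type*} [NormedAddCommGroup F] [NormedSpace ℝ F]

theorem hasDerivAt_fst_of_uncurry {f : ℝ → ℝ → F} {t x : ℝ}
    (h : DifferentiableAt ℝ (Function.uncurry f) (t, x)) :
    HasDerivAt (fun s => f s x) (fderiv ℝ (Function.uncurry f) (t, x) (1, 0)) t :=
  HasFDerivAt.comp_hasDerivAt (l := Function.uncurry f) t h.hasFDerivAt
    ((hasDerivAt_id t).prodMk (hasDerivAt_const t x))

theorem hasDerivAt_snd_of_uncurry {f : ℝ → ℝ → F} {t x : ℝ}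
    (h : DifferentiableAt ℝ (Function.uncurry f) (t, x)) :
    HasDerivAt (fun y => f t y) (fderiv ℝ (Function.uncurry f) (t, x) (0, 1)) x :=
  HasFDerivAt.comp_hasDerivAt (l := Function.uncurry f) x h.hasFDerivAt
    ((hasDerivAt_const x t).prodMk (hasDerivAt_id x))

/-- A function of two variables is of class `C^(m+1)` if its partial derivatives are of class
`C^m`. -/
theorem contDiff_succ_of_partial {f f₁ f₂ : ℝ → ℝ → F} {m : ℕ}
    (h1 : ∀ t x, HasDerivAt (fun s => f s x) (f₁ t x) t)
    (h2 : ∀ t x, HasDerivAt (fun y => f t y) (f₂ t x) x)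
    (c1 : ContDiff ℝ m (Function.uncurry f₁)) (c2 : ContDiff ℝ m (Function.uncurry f₂)) :
    ContDiff ℝ (m + 1) (Function.uncurry f) := by
  let T : F →L[ℝ] (ℝ →L[ℝ] F) := ContinuousLinearMap.smulRightL ℝ ℝ F 1
  have e : ∀ p : ℝ × ℝ, HasFDerivAt (Function.uncurry f)
      ((T (f₁ p.1 p.2)).coprod (T (f₂ p.1 p.2))) p := by
    intro p
    exact (hasStrictFDerivAt_uncurry_coprod (f := f) (f₁ := fun t x => T (f₁ t x))
      (f₂ := fun t x => T (f₂ t x))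
      (Eventually.of_forall fun v => (h1 v.1 v.2).hasFDerivAt)
      (Eventually.of_forall fun v => (h2 v.1 v.2).hasFDerivAt)
      (T.continuous.comp c1.continuous).continuousAt
      (T.continuous.comp c2.continuous).continuousAt).hasFDerivAt
  rw [contDiff_succ_iff_hasFDerivAt]
  refine ⟨fun p => (T (f₁ p.1 p.2)).coprod (T (f₂ p.1 p.2)), ?_, e⟩
  have e3 : (fun p : ℝ × ℝ => (T (f₁ p.1 p.2)).coprod (T (f₂ p.1 p.2))) = fun p =>
      (T (f₁ p.1 p.2)).comp (ContinuousLinearMap.fst ℝ ℝ ℝ)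
        + (T (f₂ p.1 p.2)).comp (ContinuousLinearMap.snd ℝ ℝ ℝ) := by
    funext p
    ext <;> simp
  rw [e3]
  exact ((T.contDiff.comp c1).clm_comp contDiff_const).add
    ((T.contDiff.comp c2).clm_comp contDiff_const)

end Partial

/-! ### Smoothness of the solutions of linear differential equations -/

section LinearODE

open Set Filter Topology

universe u

/-- Induction on the order of differentiability, for all equations at once: `X_x = A X` and the
second component `X_t` of the solution of the augmented equation are again expressed by solutions.
-/
theorem contDiff_linearSol_nat (m : ℕ) : ∀ {E : Type u} [NormedAddCommGroup E] [NormedSpace ℝ E]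
    [CompleteSpace E] {A : ℝ → ℝ → E →L[ℝ] E} {b : ℝ → E},
    ContDiff ℝ ∞ (Function.uncurry A) → ContDiff ℝ ∞ b →
    ContDiff ℝ m (Function.uncurry (linearSol A b)) := by
  induction m with
  | zero =>
    intro E _ _ _ A b hA hb
    exact contDiff_zero.2 (continuous_linearSol hA.continuous hb.continuous)
  | succ m ih =>
    intro E _ _ _ A b hA hb
    let A' : ℝ → ℝ → E →L[ℝ] E := fun t x => fderiv ℝ (Function.uncurry A) (t, x) (1, 0)
    have hA' : ContDiff ℝ ∞ (Function.uncurry A') :=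
      (hA.fderiv_right (m := ∞) le_rfl).clm_apply contDiff_const
    have hb' : ContDiff ℝ ∞ (deriv b) := (contDiff_infty_iff_deriv.1 hb).2
    have hne : (∞ : WithTop ℕ∞) ≠ 0 := by simp
    have hdA : ∀ t x, HasDerivAt (fun s => A s x) (A' t x) t := fun t x =>
      hasDerivAt_fst_of_uncurry (hA.differentiable hne _)
    have hdb : ∀ t, HasDerivAt b (deriv b t) t := fun t =>
      (hb.differentiable hne t).hasDerivAt
    have hAA : ContDiff ℝ ∞ (Function.uncurry (augmented A A')) := by
      have h1 : ContDiff ℝ ∞ fun p : ℝ × ℝ => A p.1 p.2 := hA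
      have h2 : ContDiff ℝ ∞ fun p : ℝ × ℝ => A' p.1 p.2 := hA'
      exact (ContinuousLinearMap.prodₗᵢ ℝ (E := E × E) (F := E) (G := E)
          ).toContinuousLinearEquiv.contDiff.comp
        ((h1.clm_comp contDiff_const).prodMk
          ((h1.clm_comp contDiff_const).add (h2.clm_comp contDiff_const)))
    refine contDiff_succ_of_partial
      (fun t x => linearSol_augmented hA.continuous hA'.continuous hb.continuous hb'.continuous
        hdA hdb t x)
      (fun t x => hasDerivAt_linearSol hA.continuous hb.continuous t x)
      (ih hAA (hb.prodMk hb')).snd ?_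
    exact (hA.of_le (mod_cast le_top)).clm_apply (ih hA hb)

theorem contDiff_linearSol {E : Type u} [NormedAddCommGroup E] [NormedSpace ℝ E]
    [CompleteSpace E] {A : ℝ → ℝ → E →L[ℝ] E} {b : ℝ → E}
    (hA : ContDiff ℝ ∞ (Function.uncurry A)) (hb : ContDiff ℝ ∞ b) :
    ContDiff ℝ ∞ (Function.uncurry (linearSol A b)) :=
  contDiff_infty.2 fun m => contDiff_linearSol_nat m hA hb

end LinearODE

/-! ### Linear differential equations on open intervals -/

section LinearODE

open Set Filter Topology

universe u

/-- A nonempty open interval is diffeomorphic to the real line. -/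
theorem exists_reparametrization {I : Set ℝ} (hI : IsOpen I) (hIc : I.OrdConnected)
    (hne : I.Nonempty) :
    ∃ φ ψ : ℝ → ℝ, ContDiff ℝ ∞ φ ∧ (∀ s, φ s ∈ I) ∧ ContDiffOn ℝ ∞ ψ I ∧
      ∀ t ∈ I, φ (ψ t) = t := by
  have hpc : IsPreconnected I := isPreconnected_iff_ordConnected.2 hIc
  have hlow : ∀ a, (∀ t ∈ I, a ≤ t) → ∀ t ∈ I, a < t := by
    intro a ha t ht
    obtain ⟨s, u, hu, hsub⟩ := mem_nhds_iff_exists_Ioo_subset.1 (hI.mem_nhds ht)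
    obtain ⟨r, hr1, hr2⟩ := exists_between hu.1
    exact (ha r (hsub ⟨hr1, hr2.trans hu.2⟩)).trans_lt hr2
  have hupp : ∀ a, (∀ t ∈ I, t ≤ a) → ∀ t ∈ I, t < a := by
    intro a ha t ht
    obtain ⟨s, u, hu, hsub⟩ := mem_nhds_iff_exists_Ioo_subset.1 (hI.mem_nhds ht)
    obtain ⟨r, hr1, hr2⟩ := exists_between hu.2
    exact hr1.trans_le (ha r (hsub ⟨hu.1.trans hr1, hr2⟩))
  by_cases hb : BddBelow I <;> by_cases ha : BddAbove I
  · set a := sInf I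
    set b := sSup I
    have h1 : ∀ t ∈ I, a < t := hlow a fun t ht => csInf_le hb ht
    have h2 : ∀ t ∈ I, t < b := hupp b fun t ht => le_csSup ha ht
    have hab : a < b := hne.elim fun t ht => (h1 t ht).trans (h2 t ht)
    have hpos : ∀ s : ℝ, 0 < 1 + Real.exp (-s) := fun s => by positivity
    refine ⟨fun s => a + (b - a) / (1 + Real.exp (-s)),
      fun t => Real.log (t - a) - Real.log (b - t), ?_, ?_, ?_, ?_⟩
    · exact contDiff_const.add (contDiff_const.div
        (contDiff_const.add (Real.contDiff_exp.comp contDiff_neg)) fun s => (hpos s).ne')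
    · intro s
      refine IsConnected.Ioo_csInf_csSup_subset ⟨hne, hpc⟩ hb ha ⟨?_, ?_⟩
      · have := div_pos (sub_pos.2 hab) (hpos s)
        show a < a + (b - a) / (1 + Real.exp (-s))
        linarith
      · have : (b - a) / (1 + Real.exp (-s)) < b - a := by
          rw [div_lt_iff₀ (hpos s)]
          nlinarith [Real.exp_pos (-s)]
        show a + (b - a) / (1 + Real.exp (-s)) < b
        linarith
    · exact ((contDiffOn_id.sub contDiffOn_const).log fun t ht => (sub_pos.2 (h1 t ht)).ne').sub
        ((contDiffOn_const.sub contDiffOn_id).log fun t ht => (sub_pos.2 (h2 t ht)).ne')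
    · intro t ht
      have e1 := sub_pos.2 (h1 t ht)
      have e2 := sub_pos.2 (h2 t ht)
      simp only [neg_sub]
      rw [Real.exp_sub, Real.exp_log e1, Real.exp_log e2]
      field_simp
      ring
  · set a := sInf I
    have h1 : ∀ t ∈ I, a < t := hlow a fun t ht => csInf_le hb ht
    refine ⟨fun s => a + Real.exp s, fun t => Real.log (t - a),
      contDiff_const.add Real.contDiff_exp, fun s => ?_, ?_, fun t ht => ?_⟩
    · exact hpc.Ioi_csInf_subset hb ha (lt_add_of_pos_right _ (Real.exp_pos s))
    · exact (contDiffOn_id.sub contDiffOn_const).log fun t ht => (sub_pos.2 (h1 t ht)).ne'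
    · simp [Real.exp_log (sub_pos.2 (h1 t ht))]
  · set b := sSup I
    have h2 : ∀ t ∈ I, t < b := hupp b fun t ht => le_csSup ha ht
    refine ⟨fun s => b - Real.exp s, fun t => Real.log (b - t),
      contDiff_const.sub Real.contDiff_exp, fun s => ?_, ?_, fun t ht => ?_⟩
    · exact hpc.Iio_csSup_subset hb ha (sub_lt_self _ (Real.exp_pos s))
    · exact (contDiffOn_const.sub contDiffOn_id).log fun t ht => (sub_pos.2 (h2 t ht)).ne'
    · simp [Real.exp_log (sub_pos.2 (h2 t ht))]
  · have := hpc.eq_univ_of_unbounded hb ha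
    exact ⟨id, id, contDiff_id, fun s => this ▸ mem_univ _, contDiffOn_id, fun t _ => rfl⟩

variable {E : Type u} [NormedAddCommGroup E] [NormedSpace ℝ E] [CompleteSpace E]

/-- Linear differential equations with a parameter in an open interval have smooth solutions. -/
theorem exists_linear_flow {I : Set ℝ} (hI : IsOpen I) (hIc : I.OrdConnected)
    {A : ℝ → ℝ → E →L[ℝ] E} (hA : Smooth I A) {b : ℝ → E} (hb : ContDiffOn ℝ ∞ b I) :
    ∃ X : ℝ → ℝ → E, Smooth I X ∧ (∀ t ∈ I, X t 0 = b t) ∧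
      ∀ t ∈ I, ∀ x, HasDerivAt (X t) (A t x (X t x)) x := by
  rcases I.eq_empty_or_nonempty with rfl | hne
  · exact ⟨fun _ _ => 0, by simp [Smooth, contDiffOn_empty], by simp, by simp⟩
  obtain ⟨φ, ψ, hφ, hφI, hψ, hφψ⟩ := exists_reparametrization hI hIc hne
  have hA' : ContDiff ℝ ∞ (Function.uncurry fun s x => A (φ s) x) :=
    hA.comp_contDiff ((hφ.comp contDiff_fst).prodMk contDiff_snd) fun p => ⟨hφI _, mem_univ _⟩
  have hb' : ContDiff ℝ ∞ fun s => b (φ s) := hb.comp_contDiff hφ hφI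
  refine ⟨fun t x => linearSol (fun s x => A (φ s) x) (fun s => b (φ s)) (ψ t) x, ?_, ?_, ?_⟩
  · exact (contDiff_linearSol hA' hb').comp_contDiffOn
      ((hψ.comp contDiffOn_fst fun p hp => hp.1).prodMk contDiffOn_snd)
  · intro t ht
    simp only [linearSol_zero, hφψ t ht]
  · intro t ht x
    have := hasDerivAt_linearSol hA'.continuous hb'.continuous (ψ t) x
    simpa only [hφψ t ht] using this

/-- Linear differential equations on an open interval have smooth solutions. -/
theorem exists_linear_curve {I : Set ℝ} (hI : IsOpen I) (hIc : I.OrdConnected)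
    {A : ℝ → E →L[ℝ] E} (hA : ContDiffOn ℝ ∞ A I) {t₀ : ℝ} (ht₀ : t₀ ∈ I) (b : E) :
    ∃ X : ℝ → E, ContDiffOn ℝ ∞ X I ∧ X t₀ = b ∧ ∀ t ∈ I, HasDerivAt X (A t (X t)) t := by
  obtain ⟨φ, ψ, hφ, hφI, hψ, hφψ⟩ := exists_reparametrization hI hIc ⟨t₀, ht₀⟩
  set s₀ := ψ t₀
  have hne : (∞ : WithTop ℕ∞) ≠ 0 := by simp
  have hsh : ContDiff ℝ ∞ fun x : ℝ => φ (x + s₀) := hφ.comp (contDiff_id.add contDiff_const)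
  let A' : ℝ → ℝ → E →L[ℝ] E := fun _ x => deriv φ (x + s₀) • A (φ (x + s₀))
  have hA' : ContDiff ℝ ∞ (Function.uncurry A') := by
    have h1 : ContDiff ℝ ∞ (deriv φ) := (contDiff_infty_iff_deriv.1 hφ).2
    have h2 : ContDiff ℝ ∞ fun x => deriv φ (x + s₀) • A (φ (x + s₀)) :=
      (h1.comp (contDiff_id.add contDiff_const)).smul (hA.comp_contDiff hsh fun x => hφI _)
    exact h2.comp contDiff_snd
  have hb' : ContDiff ℝ ∞ fun _ : ℝ => b := contDiff_const
  have hψs : ContDiffOn ℝ ∞ (fun t => ψ t - s₀) I := hψ.sub contDiffOn_const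
  refine ⟨fun t => linearSol A' (fun _ => b) 0 (ψ t - s₀), ?_, ?_, ?_⟩
  · exact (contDiff_linearSol hA' hb').comp_contDiffOn (contDiffOn_const.prodMk hψs)
  · simp [s₀, linearSol_zero]
  · intro t ht
    have hd : HasDerivAt (fun t => ψ t - s₀) (deriv ψ t) t :=
      ((hψ.differentiableOn hne t ht).differentiableAt (hI.mem_nhds ht)).hasDerivAt.sub_const _
    have h1 := (hasDerivAt_linearSol hA'.continuous hb'.continuous 0 (ψ t - s₀)).scomp t hd
    have hone : deriv ψ t * deriv φ (ψ t) = 1 := by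
      have e1 : HasDerivAt (fun s => φ (ψ s)) (deriv φ (ψ t) * deriv ψ t) t :=
        (hφ.differentiable hne (ψ t)).hasDerivAt.comp t
          ((hψ.differentiableOn hne t ht).differentiableAt (hI.mem_nhds ht)).hasDerivAt
      have e2 : HasDerivAt (fun s => φ (ψ s)) 1 t :=
        (hasDerivAt_id t).congr_of_eventuallyEq
          (Filter.eventually_of_mem (hI.mem_nhds ht) fun s hs => hφψ s hs)
      rw [mul_comm, e1.unique e2]
    have e3 : ∀ z : E, deriv ψ t • A' 0 (ψ t - s₀) z = A t z := fun z => by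
      simp only [A', sub_add_cancel, hφψ t ht, smul_apply, smul_smul, hone, one_smul]
    rw [e3] at h1
    exact h1

end LinearODE

/-! ### Smooth functions of `(t, x)` -/

section Partial

open Set Filter Topology

variable {F : Type*} [NormedAddCommGroup F] [NormedSpace ℝ F] {I : Set ℝ} {f : ℝ → ℝ → F}

theorem infty_ne_zero : (∞ : WithTop ℕ∞) ≠ 0 := by simp

theorem two_le_infty : (2 : WithTop ℕ∞) ≤ ∞ :=
  WithTop.coe_le_coe.2 (le_top : (2 : ℕ∞) ≤ ⊤)

theorem isOpen_strip (hI : IsOpen I) : IsOpen (I ×ˢ (univ : Set ℝ)) := hI.prod isOpen_univ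

theorem Smooth.contDiffAt (hf : Smooth I f) (hI : IsOpen I) {t : ℝ} (ht : t ∈ I) (x : ℝ) :
    ContDiffAt ℝ ∞ (Function.uncurry f) (t, x) :=
  ContDiffOn.contDiffAt (f := Function.uncurry f) hf
    ((isOpen_strip hI).mem_nhds ⟨ht, mem_univ x⟩)

theorem Smooth.differentiableAt (hf : Smooth I f) (hI : IsOpen I) {t : ℝ} (ht : t ∈ I) (x : ℝ) :
    DifferentiableAt ℝ (Function.uncurry f) (t, x) :=
  (hf.contDiffAt hI ht x).differentiableAt infty_ne_zero

theorem Smooth.dx_eq (hf : Smooth I f) (hI : IsOpen I) {t : ℝ} (ht : t ∈ I) (x : ℝ) :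
    dx f t x = fderiv ℝ (Function.uncurry f) (t, x) (0, 1) :=
  (hasDerivAt_snd_of_uncurry (hf.differentiableAt hI ht x)).deriv

theorem Smooth.dt_eq (hf : Smooth I f) (hI : IsOpen I) {t : ℝ} (ht : t ∈ I) (x : ℝ) :
    dt f t x = fderiv ℝ (Function.uncurry f) (t, x) (1, 0) :=
  (hasDerivAt_fst_of_uncurry (hf.differentiableAt hI ht x)).deriv

theorem Smooth.hasDerivAt_dx (hf : Smooth I f) (hI : IsOpen I) {t : ℝ} (ht : t ∈ I) (x : ℝ) :
    HasDerivAt (f t) (dx f t x) x := by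
  rw [hf.dx_eq hI ht]
  exact hasDerivAt_snd_of_uncurry (hf.differentiableAt hI ht x)

theorem Smooth.hasDerivAt_dt (hf : Smooth I f) (hI : IsOpen I) {t : ℝ} (ht : t ∈ I) (x : ℝ) :
    HasDerivAt (fun s => f s x) (dt f t x) t := by
  rw [hf.dt_eq hI ht]
  exact hasDerivAt_fst_of_uncurry (hf.differentiableAt hI ht x)

theorem Smooth.fderiv_apply (hf : Smooth I f) (hI : IsOpen I) (w : ℝ × ℝ) :
    ContDiffOn ℝ ∞ (fun p => fderiv ℝ (Function.uncurry f) p w) (I ×ˢ univ) :=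
  (ContDiffOn.fderiv_of_isOpen hf (isOpen_strip hI) le_rfl).clm_apply contDiffOn_const

theorem Smooth.dx (hf : Smooth I f) (hI : IsOpen I) : Smooth I (dx f) :=
  (hf.fderiv_apply hI (0, 1)).congr fun p hp => hf.dx_eq hI hp.1 p.2

theorem Smooth.dt (hf : Smooth I f) (hI : IsOpen I) : Smooth I (dt f) :=
  (hf.fderiv_apply hI (1, 0)).congr fun p hp => hf.dt_eq hI hp.1 p.2

/-- Mixed partial derivatives commute. -/
theorem Smooth.dx_dt (hf : Smooth I f) (hI : IsOpen I) {t : ℝ} (ht : t ∈ I) (x : ℝ) :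
    SOU.dx (SOU.dt f) t x = SOU.dt (SOU.dx f) t x := by
  have hd : DifferentiableAt ℝ (fderiv ℝ (Function.uncurry f)) (t, x) :=
    ((hf.contDiffAt hI ht x).fderiv_right (m := 1) (by rw [one_add_one_eq_two]; exact two_le_infty)
      ).differentiableAt one_ne_zero
  have key : ∀ w₁ w₂ : ℝ × ℝ, fderiv ℝ (fun p => fderiv ℝ (Function.uncurry f) p w₁) (t, x) w₂
      = fderiv ℝ (fderiv ℝ (Function.uncurry f)) (t, x) w₂ w₁ := by
    intro w₁ w₂
    rw [fderiv_clm_apply hd (differentiableAt_const _)]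
    simp
  have hnhds : I ×ˢ (univ : Set ℝ) ∈ 𝓝 (t, x) := (isOpen_strip hI).mem_nhds ⟨ht, mem_univ x⟩
  have h1 : Function.uncurry (SOU.dt f) =ᶠ[𝓝 (t, x)]
      fun p => fderiv ℝ (Function.uncurry f) p (1, 0) :=
    eventually_of_mem hnhds fun p hp => hf.dt_eq hI hp.1 p.2
  have h2 : Function.uncurry (SOU.dx f) =ᶠ[𝓝 (t, x)]
      fun p => fderiv ℝ (Function.uncurry f) p (0, 1) :=
    eventually_of_mem hnhds fun p hp => hf.dx_eq hI hp.1 p.2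
  rw [(hf.dt hI).dx_eq hI ht, (hf.dx hI).dt_eq hI ht, h1.fderiv_eq, h2.fderiv_eq, key, key]
  exact ((hf.contDiffAt hI ht x).isSymmSndFDerivAt (by simpa using two_le_infty)) (0, 1) (1, 0)

theorem Smooth.slice (hf : Smooth I f) {t : ℝ} (ht : t ∈ I) : ContDiff ℝ ∞ (f t) :=
  ContDiffOn.comp_contDiff (g := Function.uncurry f) hf (contDiff_const.prodMk contDiff_id)
    fun _ => ⟨ht, mem_univ _⟩

theorem Smooth.slice_left (hf : Smooth I f) (x : ℝ) : ContDiffOn ℝ ∞ (fun t => f t x) I :=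
  ContDiffOn.comp (g := Function.uncurry f) hf (contDiffOn_id.prodMk contDiffOn_const)
    fun _ ht => ⟨ht, mem_univ _⟩

theorem Smooth.of_left {b : ℝ → F} (hb : ContDiffOn ℝ ∞ b I) : Smooth I fun t _ => b t :=
  hb.comp contDiffOn_fst fun _ hp => hp.1

theorem Smooth.congr {f₁ : ℝ → ℝ → F} (hf : Smooth I f) (h : ∀ t ∈ I, ∀ x, f₁ t x = f t x) :
    Smooth I f₁ :=
  ContDiffOn.congr hf fun p hp => h p.1 hp.1 p.2

theorem dt_congr (hI : IsOpen I) {f₁ : ℝ → ℝ → F} (h : ∀ t ∈ I, ∀ x, f₁ t x = f t x) {t : ℝ}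
    (ht : t ∈ I) (x : ℝ) : dt f₁ t x = dt f t x :=
  Filter.EventuallyEq.deriv_eq (eventually_of_mem (hI.mem_nhds ht) fun s hs => h s hs x)

end Partial

/-! ### Calculus of matrix-valued functions -/

section MatrixCalculus

variable {V W : Type*} [NormedAddCommGroup V] [NormedSpace ℝ V] [FiniteDimensional ℝ V]
  [NormedAddCommGroup W] [NormedSpace ℝ W]

theorem _root_.HasDerivAt.linearMap (L : V →ₗ[ℝ] W) {f : ℝ → V} {f' : V} {x : ℝ}
    (hf : HasDerivAt f f' x) : HasDerivAt (fun y => L (f y)) (L f') x :=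
  (LinearMap.toContinuousLinearMap L).hasFDerivAt.comp_hasDerivAt x hf

theorem _root_.ContDiffOn.linearMap (L : V →ₗ[ℝ] W) {D : Type*} [NormedAddCommGroup D]
    [NormedSpace ℝ D] {f : D → V} {s : Set D} (hf : ContDiffOn ℝ ∞ f s) :
    ContDiffOn ℝ ∞ (fun y => L (f y)) s :=
  (LinearMap.toContinuousLinearMap L).contDiff.comp_contDiffOn hf

theorem Smooth.linearMap (L : V →ₗ[ℝ] W) {I : Set ℝ} {f : ℝ → ℝ → V} (hf : Smooth I f) :
    Smooth I fun t x => L (f t x) :=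
  ContDiffOn.linearMap L hf

variable {l m k : Type*} [Fintype l] [Fintype m] [Fintype k] {R : Type*} [NormedRing R]
  [NormedAlgebra ℝ R] [FiniteDimensional ℝ R]

/-- Matrix multiplication as a continuous bilinear map. -/
def matMulCLM (l m k R : Type*) [Fintype l] [Fintype m] [Fintype k] [NormedRing R]
    [NormedAlgebra ℝ R] [FiniteDimensional ℝ R] :
    Matrix l m R →L[ℝ] Matrix m k R →L[ℝ] Matrix l k R :=
  (LinearMap.mk₂ ℝ (fun (A : Matrix l m R) (B : Matrix m k R) => A * B) Matrix.add_mul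
    Matrix.smul_mul Matrix.mul_add (fun c A B => Matrix.mul_smul A c B)).toContinuousBilinearMap

theorem _root_.HasDerivAt.matrixMul {A : ℝ → Matrix l m R} {B : ℝ → Matrix m k R}
    {A' : Matrix l m R} {B' : Matrix m k R} {x : ℝ} (hA : HasDerivAt A A' x)
    (hB : HasDerivAt B B' x) : HasDerivAt (fun y => A y * B y) (A' * B x + A x * B') x := by
  have := (matMulCLM l m k R).hasDerivAt_of_bilinear (fun _ => hA) (fun _ => hB)
  rw [add_comm]
  exact this

theorem _root_.ContDiffOn.matrixMul {D : Type*} [NormedAddCommGroup D] [NormedSpace ℝ D]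
    {s : Set D} {A : D → Matrix l m R} {B : D → Matrix m k R} (hA : ContDiffOn ℝ ∞ A s)
    (hB : ContDiffOn ℝ ∞ B s) : ContDiffOn ℝ ∞ (fun y => A y * B y) s :=
  (matMulCLM l m k R).isBoundedBilinearMap.contDiff.comp_contDiffOn (hA.prodMk hB)

theorem Smooth.matrixMul {I : Set ℝ} {A : ℝ → ℝ → Matrix l m R} {B : ℝ → ℝ → Matrix m k R}
    (hA : Smooth I A) (hB : Smooth I B) : Smooth I fun t x => A t x * B t x :=
  ContDiffOn.matrixMul hA hB

theorem _root_.HasDerivAt.matrixTranspose {A : ℝ → Matrix l m R} {A' : Matrix l m R} {x : ℝ}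
    (hA : HasDerivAt A A' x) : HasDerivAt (fun y => (A y)ᵀ) A'ᵀ x :=
  hA.linearMap (Matrix.transposeLinearEquiv l m ℝ R).toLinearMap

theorem _root_.ContDiffOn.matrixTranspose {D : Type*} [NormedAddCommGroup D] [NormedSpace ℝ D]
    {s : Set D} {A : D → Matrix l m R} (hA : ContDiffOn ℝ ∞ A s) :
    ContDiffOn ℝ ∞ (fun y => (A y)ᵀ) s :=
  hA.linearMap (Matrix.transposeLinearEquiv l m ℝ R).toLinearMap

theorem Smooth.matrixTranspose {I : Set ℝ} {A : ℝ → ℝ → Matrix l m R} (hA : Smooth I A) :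
    Smooth I fun t x => (A t x)ᵀ :=
  ContDiffOn.matrixTranspose hA

end MatrixCalculus

/-! ### The complex model of `so(2n)` -/

section Conj

variable {l m k : Type*}

/-- The entrywise complex conjugate of a matrix. -/
def cj (M : Matrix l m ℂ) : Matrix l m ℂ := M.map (starRingEnd ℂ)

@[simp] theorem cj_cj (M : Matrix l m ℂ) : cj (cj M) = M := by ext i j; simp [cj]
@[simp] theorem cj_zero : cj (0 : Matrix l m ℂ) = 0 := by ext i j; simp [cj]
@[simp] theorem cj_add (M N : Matrix l m ℂ) : cj (M + N) = cj M + cj N := by ext i j; simp [cj]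
@[simp] theorem cj_sub (M N : Matrix l m ℂ) : cj (M - N) = cj M - cj N := by ext i j; simp [cj]
@[simp] theorem cj_neg (M : Matrix l m ℂ) : cj (-M) = -cj M := by ext i j; simp [cj]
@[simp] theorem cj_smul (c : ℂ) (M : Matrix l m ℂ) : cj (c • M) = star c • cj M := by
  ext i j; simp [cj]
@[simp] theorem cj_real_smul (c : ℝ) (M : Matrix l m ℂ) : cj (c • M) = c • cj M := by
  ext i j; simp [cj]
@[simp] theorem cj_mul [Fintype m] (M : Matrix l m ℂ) (N : Matrix m k ℂ) :
    cj (M * N) = cj M * cj N := Matrix.map_mul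
@[simp] theorem cj_one [DecidableEq l] : cj (1 : Matrix l l ℂ) = 1 := by simp [cj]
@[simp] theorem cj_transpose (M : Matrix l m ℂ) : cj Mᵀ = Mᴴ := rfl
@[simp] theorem cj_conjTranspose (M : Matrix l m ℂ) : cj Mᴴ = Mᵀ := by
  ext i j; simp [cj]
@[simp] theorem transpose_cj (M : Matrix l m ℂ) : (cj M)ᵀ = Mᴴ := rfl
@[simp] theorem conjTranspose_cj (M : Matrix l m ℂ) : (cj M)ᴴ = Mᵀ := by
  ext i j; simp [cj]
@[simp] theorem transpose_conjTranspose' (M : Matrix l m ℂ) : Mᵀᴴ = cj M := rfl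
@[simp] theorem conjTranspose_transpose' (M : Matrix l m ℂ) : Mᴴᵀ = cj M := rfl

@[simp] theorem cj_fromBlocks {l' m' : Type*} (A : Matrix l m ℂ) (B : Matrix l m' ℂ)
    (C : Matrix l' m ℂ) (D : Matrix l' m' ℂ) :
    cj (Matrix.fromBlocks A B C D) = Matrix.fromBlocks (cj A) (cj B) (cj C) (cj D) :=
  Matrix.fromBlocks_map ..

/-- Entrywise conjugation as a real-linear map. -/
def cjLin (l m : Type*) : Matrix l m ℂ →ₗ[ℝ] Matrix l m ℂ where
  toFun := cj
  map_add' := cj_add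
  map_smul' := cj_real_smul

theorem map_re_mul [Fintype m] (M : Matrix l m ℂ) (N : Matrix m k ℂ) :
    (M * N).map Complex.re = M.map Complex.re * N.map Complex.re
      - M.map Complex.im * N.map Complex.im := by
  ext i j
  simp [Matrix.mul_apply, Finset.sum_sub_distrib]

theorem map_im_mul [Fintype m] (M : Matrix l m ℂ) (N : Matrix m k ℂ) :
    (M * N).map Complex.im = M.map Complex.re * N.map Complex.im
      + M.map Complex.im * N.map Complex.re := by
  ext i j
  simp [Matrix.mul_apply, Finset.sum_add_distrib]

end Conj

section Model

variable {n : ℕ}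

/-- Complex `n × n` matrices. -/
abbrev CM (n : ℕ) : Type := Matrix (Ix n) (Ix n) ℂ

/-- The real matrix of the real-linear map `z ↦ S z + T z̄` of `ℂⁿ`, where `ℝ²ⁿ` is identified
with `ℂⁿ` by `(p, q) ↦ p + i q`.  In this model `J₀` is `-i`, the elements of `u(n)` are the maps
`z ↦ S z` with skew-Hermitian `S`, and `(A, B) ∈ m` is the map `z ↦ (A + i B) z̄`. -/
def cx (S T : CM n) : Mat n :=
  Matrix.fromBlocks (S.map Complex.re + T.map Complex.re) (T.map Complex.im - S.map Complex.im)
    (S.map Complex.im + T.map Complex.im) (S.map Complex.re - T.map Complex.re)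

/-- `cx` as a real-linear map. -/
def cxLin (n : ℕ) : CM n × CM n →ₗ[ℝ] Mat n where
  toFun p := cx p.1 p.2
  map_add' p q := by
    simp only [cx, Matrix.fromBlocks_add, Prod.fst_add, Prod.snd_add]
    congr 1 <;> ext i j <;> simp <;> ring
  map_smul' c p := by
    simp only [cx, Matrix.fromBlocks_smul, Prod.smul_fst, Prod.smul_snd, RingHom.id_apply]
    congr 1 <;> ext i j <;> simp <;> ring

theorem cx_add (S T S' T' : CM n) : cx S T + cx S' T' = cx (S + S') (T + T') :=
  ((cxLin n).map_add (S, T) (S', T')).symm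

theorem cx_sub (S T S' T' : CM n) : cx S T - cx S' T' = cx (S - S') (T - T') :=
  ((cxLin n).map_sub (S, T) (S', T')).symm

theorem cx_neg (S T : CM n) : -cx S T = cx (-S) (-T) :=
  ((cxLin n).map_neg (S, T)).symm

theorem cx_smul (c : ℝ) (S T : CM n) : c • cx S T = cx (c • S) (c • T) :=
  ((cxLin n).map_smul c (S, T)).symm

theorem cx_zero : cx (0 : CM n) 0 = 0 := (cxLin n).map_zero

theorem cx_mul (S T S' T' : CM n) :
    cx S T * cx S' T' = cx (S * S' + T * cj T') (S * T' + T * cj S') := by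
  have h1 : ∀ M : CM n, (cj M).map Complex.re = M.map Complex.re := fun M => by
    ext i j; simp [cj]
  have h2 : ∀ M : CM n, (cj M).map Complex.im = -M.map Complex.im := fun M => by
    ext i j; simp [cj]
  have h3 : ∀ M N : CM n, (M + N).map Complex.re = M.map Complex.re + N.map Complex.re :=
    fun M N => by ext i j; simp
  have h4 : ∀ M N : CM n, (M + N).map Complex.im = M.map Complex.im + N.map Complex.im :=
    fun M N => by ext i j; simp
  simp only [cx, Matrix.fromBlocks_multiply, map_re_mul, map_im_mul, h1, h2, h3, h4]
  congr 1 <;> noncomm_ring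

theorem cx_transpose (S T : CM n) : (cx S T)ᵀ = cx Sᴴ Tᵀ := by
  simp only [cx, Matrix.fromBlocks_transpose]
  congr 1 <;> ext i j <;> simp <;> ring

theorem J0_eq_cx (n : ℕ) : J0 n = cx (-(Complex.I • 1)) 0 := by
  simp only [J0, cx]
  congr 1 <;> ext i j <;> rcases eq_or_ne i j with rfl | h <;> simp [*]

theorem one_eq_cx (n : ℕ) : (1 : Mat n) = cx 1 0 := by
  rw [← Matrix.fromBlocks_one]
  simp only [cx]
  congr 1 <;> ext i j <;> rcases eq_or_ne i j with rfl | h <;> simp [*]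

/-- The complex-linear part `S` of the real-linear map `z ↦ S z + T z̄`. -/
def clin (n : ℕ) : Mat n →ₗ[ℝ] CM n where
  toFun X := Matrix.of fun i j =>
    ⟨(X (.inl i) (.inl j) + X (.inr i) (.inr j)) / 2,
      (X (.inr i) (.inl j) - X (.inl i) (.inr j)) / 2⟩
  map_add' X Y := by
    ext i j
    apply Complex.ext <;> simp <;> ring
  map_smul' c X := by
    ext i j
    apply Complex.ext <;> simp <;> ring

/-- The conjugate-linear part `T` of the real-linear map `z ↦ S z + T z̄`. -/
def alin (n : ℕ) : Mat n →ₗ[ℝ] CM n where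
  toFun X := Matrix.of fun i j =>
    ⟨(X (.inl i) (.inl j) - X (.inr i) (.inr j)) / 2,
      (X (.inr i) (.inl j) + X (.inl i) (.inr j)) / 2⟩
  map_add' X Y := by
    ext i j
    apply Complex.ext <;> simp <;> ring
  map_smul' c X := by
    ext i j
    apply Complex.ext <;> simp <;> ring

@[simp] theorem clin_cx (S T : CM n) : clin n (cx S T) = S := by
  ext i j
  apply Complex.ext <;> simp [clin, cx]
  ring

@[simp] theorem alin_cx (S T : CM n) : alin n (cx S T) = T := by
  ext i j
  apply Complex.ext <;> simp [alin, cx]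
  ring

theorem cx_clin_alin (X : Mat n) : cx (clin n X) (alin n X) = X := by
  ext (i | i) (j | j) <;> simp [clin, alin, cx] <;> ring

theorem cx_inj {S T S' T' : CM n} : cx S T = cx S' T' ↔ S = S' ∧ T = T' := by
  refine ⟨fun h => ⟨?_, ?_⟩, by rintro ⟨rfl, rfl⟩; rfl⟩
  · simpa using congrArg (clin n) h
  · simpa using congrArg (alin n) h

theorem hPart_cx (S T : CM n) : hPart (cx S T) = cx S 0 := by
  have h : (2⁻¹ : ℝ) • S + (2⁻¹ : ℝ) • S = S := by module
  simp [hPart, J0_eq_cx, cx_mul, cx_sub, cx_smul, smul_smul, h]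

theorem mPart_cx (S T : CM n) : mPart (cx S T) = cx 0 T := by
  have h : (2⁻¹ : ℝ) • T + (2⁻¹ : ℝ) • T = T := by module
  simp [mPart, J0_eq_cx, cx_mul, cx_add, cx_smul, smul_smul, h]

theorem trace_cx (S T : CM n) : (cx S T).trace = 2 * S.trace.re := by
  simp only [Matrix.trace, Fintype.sum_sum_type, Matrix.diag_apply, cx, Matrix.fromBlocks_apply₁₁,
    Matrix.fromBlocks_apply₂₂, Matrix.add_apply, Matrix.sub_apply, Matrix.map_apply,
    Complex.add_re, Complex.re_sum]
  simp only [Finset.sum_add_distrib, Finset.sum_sub_distrib]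
  ring

theorem lie_cx_zero_zero (T T' : CM n) : ⁅cx 0 T, cx 0 T'⁆ = cx (T * cj T' - T' * cj T) 0 := by
  simp [Ring.lie_def, cx_mul, cx_sub]

theorem lie_cx_zero_right (S T : CM n) : ⁅cx S 0, cx 0 T⁆ = cx 0 (S * T - T * cj S) := by
  simp [Ring.lie_def, cx_mul, cx_sub]

/-- `ζ ∈ m`. -/
def IsM (ζ : Mat n) : Prop := ζᵀ = -ζ ∧ ζ * J0 n = -(J0 n * ζ)

/-- `ζ ∈ u(n)`. -/
def IsH (ζ : Mat n) : Prop := ζᵀ = -ζ ∧ ζ * J0 n = J0 n * ζ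

theorem isM_iff {ζ : Mat n} : IsM ζ ↔ ∃ T : CM n, Tᵀ = -T ∧ ζ = cx 0 T := by
  constructor
  · rintro ⟨h1, h2⟩
    obtain ⟨S, T, rfl⟩ : ∃ S T, ζ = cx S T := ⟨_, _, (cx_clin_alin ζ).symm⟩
    rw [J0_eq_cx, cx_mul, cx_mul, cx_neg, cx_inj] at h2
    have hS : S = 0 := by
      have := h2.1
      simp only [cj_zero, mul_zero, zero_mul, add_zero, mul_neg, neg_mul, neg_neg, mul_smul_comm,
        smul_mul_assoc, mul_one, one_mul] at this
      have h3 : (2 * Complex.I) • S = 0 := by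
        rw [two_mul, add_smul]
        nth_rewrite 1 [← this]
        simp
      simpa using h3
    subst hS
    rw [cx_transpose, cx_neg, cx_inj] at h1
    exact ⟨T, h1.2, rfl⟩
  · rintro ⟨T, hT, rfl⟩
    refine ⟨by simp [cx_transpose, cx_neg, hT], ?_⟩
    simp [J0_eq_cx, cx_mul, cx_neg]

theorem isH_iff {ζ : Mat n} : IsH ζ ↔ ∃ S : CM n, Sᴴ = -S ∧ ζ = cx S 0 := by
  constructor
  · rintro ⟨h1, h2⟩
    obtain ⟨S, T, rfl⟩ : ∃ S T, ζ = cx S T := ⟨_, _, (cx_clin_alin ζ).symm⟩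
    rw [J0_eq_cx, cx_mul, cx_mul, cx_inj] at h2
    have hT : T = 0 := by
      have := h2.2
      simp at this
      have h3 : (2 * Complex.I) • T = 0 := by
        rw [two_mul, add_smul]
        nth_rewrite 1 [this]
        simp
      simpa using h3
    subst hT
    rw [cx_transpose, cx_neg, cx_inj] at h1
    exact ⟨S, h1.1, rfl⟩
  · rintro ⟨S, hS, rfl⟩
    refine ⟨by simp [cx_transpose, cx_neg, hS], ?_⟩
    simp [J0_eq_cx, cx_mul]

theorem IsM.mPart_add {μ η : Mat n} (hμ : IsM μ) (hη : IsH η) : mPart (μ + η) = μ := by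
  obtain ⟨T, -, rfl⟩ := isM_iff.1 hμ
  obtain ⟨S, -, rfl⟩ := isH_iff.1 hη
  simp [cx_add, mPart_cx]

theorem IsM.hPart_add {μ η : Mat n} (hμ : IsM μ) (hη : IsH η) : hPart (μ + η) = η := by
  obtain ⟨T, -, rfl⟩ := isM_iff.1 hμ
  obtain ⟨S, -, rfl⟩ := isH_iff.1 hη
  simp [cx_add, hPart_cx]

theorem isH_hPart {X : Mat n} (hX : Xᵀ = -X) : IsH (hPart X) := by
  obtain ⟨S, T, rfl⟩ : ∃ S T, X = cx S T := ⟨_, _, (cx_clin_alin X).symm⟩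
  rw [cx_transpose, cx_neg, cx_inj] at hX
  rw [hPart_cx]
  exact isH_iff.2 ⟨S, hX.1, rfl⟩

theorem mPart_add_hPart (X : Mat n) : mPart X + hPart X = X := by
  obtain ⟨S, T, rfl⟩ : ∃ S T, X = cx S T := ⟨_, _, (cx_clin_alin X).symm⟩
  simp [mPart_cx, hPart_cx, cx_add]

theorem IsM.lie {μ η : Mat n} (hμ : IsM μ) (hη : IsM η) : IsH ⁅μ, η⁆ := by
  obtain ⟨T, hT, rfl⟩ := isM_iff.1 hμ
  obtain ⟨T', hT', rfl⟩ := isM_iff.1 hη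
  rw [lie_cx_zero_zero]
  refine isH_iff.2 ⟨_, ?_, rfl⟩
  have e : ∀ M : CM n, Mᵀ = -M → Mᴴ = -cj M := fun M h => by
    rw [← cj_transpose, h, cj_neg]
  simp [Matrix.conjTranspose_mul, hT, hT', e]

theorem IsH.lie {μ η : Mat n} (hμ : IsH μ) (hη : IsM η) : IsM ⁅μ, η⁆ := by
  obtain ⟨S, hS, rfl⟩ := isH_iff.1 hμ
  obtain ⟨T', hT', rfl⟩ := isM_iff.1 hη
  rw [lie_cx_zero_right]
  refine isM_iff.2 ⟨_, ?_, rfl⟩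
  have e : Sᵀ = -cj S := by rw [← cj_conjTranspose, hS, cj_neg]
  simp [Matrix.transpose_mul, hT', e, hS]

end Model

/-! ### Block coordinates -/

section Blocks

variable {n : ℕ}

/-- Complex `2 × (n - 2)` matrices. -/
abbrev ZMat (n : ℕ) : Type := Matrix (Fin 2) (Fin (n - 2)) ℂ

/-- The symplectic matrix of size two. -/
def eps : Matrix (Fin 2) (Fin 2) ℂ := !![0, 1; -1, 0]

@[simp] theorem eps_mul_eps : eps * eps = -1 := by
  ext i j; fin_cases i <;> fin_cases j <;> simp [eps]
@[simp] theorem eps_transpose : epsᵀ = -eps := by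
  ext i j; fin_cases i <;> fin_cases j <;> simp [eps]
@[simp] theorem cj_eps : cj eps = eps := by
  ext i j; fin_cases i <;> fin_cases j <;> simp [eps, cj]
@[simp] theorem eps_conjTranspose : epsᴴ = -eps := by
  rw [← cj_transpose, eps_transpose, cj_neg, cj_eps]
@[simp] theorem eps_mul_eps_mul {k : Type*} (M : Matrix (Fin 2) k ℂ) :
    eps * (eps * M) = -M := by
  rw [← Matrix.mul_assoc, eps_mul_eps, Matrix.neg_mul, Matrix.one_mul]
@[simp] theorem mul_eps_mul_eps {k : Type*} (M : Matrix k (Fin 2) ℂ) :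
    M * eps * eps = -M := by
  rw [Matrix.mul_assoc, eps_mul_eps, Matrix.mul_neg, Matrix.mul_one]

/-- The action of `gl(2)` on skew forms of the plane is multiplication by the trace; this is why
the centralizer of `e` in `u(2)` is `su(2)`. -/
theorem eps_mul_transpose_add (M : Matrix (Fin 2) (Fin 2) ℂ) :
    eps * Mᵀ + M * eps = M.trace • eps := by
  ext i j
  fin_cases i <;> fin_cases j <;>
    simp [eps, Matrix.mul_apply, Matrix.vecMul, dotProduct, Fin.sum_univ_two, Matrix.trace,
      add_comm]

theorem smul_eps_inj {a b : ℂ} : a • eps = b • eps ↔ a = b := by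
  refine ⟨fun h => ?_, fun h => h ▸ rfl⟩
  simpa [eps] using congrFun (congrFun h 0) 1

theorem eq_smul_eps {M : Matrix (Fin 2) (Fin 2) ℂ} (h : Mᵀ = -M) : M = (M 0 1) • eps := by
  have e : ∀ i j, M j i = -M i j := fun i j => congrFun (congrFun h i) j
  have h0 : ∀ i, M i i = 0 := fun i => self_eq_neg.1 (e i i)
  ext i j
  fin_cases i <;> fin_cases j <;> simp [eps, h0, e 0 1]

/-- The matrix with rows `z₁`, `z₂`. -/
def zMat (z₁ z₂ : CVec n) : ZMat n := Matrix.of ![z₁, z₂]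

/-- The element of `m` with blocks `a ε`, `Z`, `H`, where `ε` is the symplectic `2 × 2` matrix. -/
def mcx (a : ℂ) (Z : ZMat n) (H : CMat n) : Mat n :=
  cx 0 (Matrix.fromBlocks (a • eps) Z (-Zᵀ) H)

/-- The element `√χ ad(e) (b, Z)` of `h_⊥`. -/
def ucx (b : ℝ) (Z : ZMat n) : Mat n :=
  cx (Matrix.fromBlocks ((2 * b * Complex.I) • 1) (eps * cj Z) (Zᵀ * eps) 0) 0

/-- The constant `χ^(-1/2)`. -/
def kap (n : ℕ) : ℝ := 1 / √(chi n)

/-- The commutator is antisymmetric. -/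
theorem lie_swap (A B : Mat n) : ⁅A, B⁆ = -⁅B, A⁆ := by simp [Ring.lie_def]

theorem chi_pos (hn : 3 ≤ n) : 0 < chi n := by
  have : (3 : ℝ) ≤ n := by exact_mod_cast hn
  unfold chi
  linarith

theorem kap_pos (hn : 3 ≤ n) : 0 < kap n := by
  have := Real.sqrt_pos.2 (chi_pos hn)
  unfold kap
  positivity

theorem kap_mul_sqrt (hn : 3 ≤ n) : √(chi n) * kap n = 1 := by
  have := Real.sqrt_pos.2 (chi_pos hn)
  unfold kap
  field_simp

theorem chi_mul_kap (hn : 3 ≤ n) : chi n * (kap n * kap n) = 1 := by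
  have h := kap_mul_sqrt hn
  have h2 := Real.mul_self_sqrt (chi_pos hn).le
  calc chi n * (kap n * kap n) = (√(chi n) * kap n) * (√(chi n) * kap n) := by
        rw [← h2]; simp only [Real.sqrt_mul_self (Real.sqrt_nonneg _)]; ring
    _ = 1 := by rw [h, one_mul]

theorem parMat_eq (a : ℝ) (H : CMat n) : parMat a H = mcx a 0 H := by
  simp only [parMat, mcx, mMat, cx]
  congr 1 <;> ext (i | i) (j | j) <;> (try fin_cases i) <;> (try fin_cases j) <;> simp [eps]

theorem perpMat_eq (b : ℝ) (z₁ z₂ : CVec n) :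
    perpMat b z₁ z₂ = mcx (b * Complex.I) (zMat z₁ z₂) 0 := by
  simp only [perpMat, mcx, mMat, cx, zMat]
  congr 1 <;> ext (i | i) (j | j) <;> (try fin_cases i) <;> (try fin_cases j) <;> simp [eps]

theorem ee_eq (n : ℕ) : ee n = mcx (kap n) 0 0 := parMat_eq _ _

theorem Jrm_eq_cx (n : ℕ) :
    Jrm n = cx (Matrix.fromBlocks 0 0 0 (-(Complex.I • 1))) 0 := by
  simp only [Jrm, hMat, cx]
  congr 1 <;> ext (i | i) (j | j) <;> simp [Matrix.one_apply] <;> split_ifs <;> simp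

theorem mcx_inj {a a' : ℂ} {Z Z' : ZMat n} {H H' : CMat n} :
    mcx a Z H = mcx a' Z' H' ↔ a = a' ∧ Z = Z' ∧ H = H' := by
  rw [mcx, mcx, cx_inj, Matrix.fromBlocks_inj, smul_eps_inj]
  exact ⟨fun h => ⟨h.2.1, h.2.2.1, h.2.2.2.2⟩, by rintro ⟨rfl, rfl, rfl⟩; simp⟩

theorem mcx_add (a a' : ℂ) (Z Z' : ZMat n) (H H' : CMat n) :
    mcx a Z H + mcx a' Z' H' = mcx (a + a') (Z + Z') (H + H') := by
  simp [mcx, cx_add, Matrix.fromBlocks_add, add_smul, add_comm]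

theorem mcx_smul (c : ℝ) (a : ℂ) (Z : ZMat n) (H : CMat n) :
    c • mcx a Z H = mcx (c * a) (c • Z) (c • H) := by
  simp [mcx, cx_smul, Matrix.fromBlocks_smul]
  rw [← Complex.coe_smul, smul_smul]

theorem mcx_zero : mcx 0 (0 : ZMat n) 0 = 0 := by
  simp [mcx, Matrix.fromBlocks_zero, cx_zero]

theorem mcx_neg (a : ℂ) (Z : ZMat n) (H : CMat n) : -mcx a Z H = mcx (-a) (-Z) (-H) := by
  have := mcx_smul (-1) a Z H
  simpa using this

theorem mcx_sub (a a' : ℂ) (Z Z' : ZMat n) (H H' : CMat n) :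
    mcx a Z H - mcx a' Z' H' = mcx (a - a') (Z - Z') (H - H') := by
  rw [sub_eq_add_neg, mcx_neg, mcx_add, sub_eq_add_neg, sub_eq_add_neg, sub_eq_add_neg]

theorem isM_iff_mcx {ζ : Mat n} :
    IsM ζ ↔ ∃ (a : ℂ) (Z : ZMat n) (H : CMat n), Hᵀ = -H ∧ ζ = mcx a Z H := by
  rw [isM_iff]
  constructor
  · rintro ⟨T, hT, rfl⟩
    rw [← Matrix.fromBlocks_toBlocks T] at hT ⊢
    rw [Matrix.fromBlocks_transpose, Matrix.fromBlocks_neg, Matrix.fromBlocks_inj] at hT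
    refine ⟨T.toBlocks₁₁ 0 1, T.toBlocks₁₂, T.toBlocks₂₂, hT.2.2.2, ?_⟩
    rw [mcx, ← eq_smul_eps hT.1, ← neg_eq_iff_eq_neg.2 hT.2.2.1]
  · rintro ⟨a, Z, H, hH, rfl⟩
    exact ⟨_, by simp [Matrix.fromBlocks_transpose, Matrix.fromBlocks_neg, hH], rfl⟩

theorem isM_mcx {a : ℂ} {Z : ZMat n} {H : CMat n} (hH : Hᵀ = -H) : IsM (mcx a Z H) :=
  isM_iff_mcx.2 ⟨a, Z, H, hH, rfl⟩

theorem isM_mcx_zero (a : ℂ) (Z : ZMat n) : IsM (mcx a Z 0) := isM_mcx (by simp)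

theorem isM_ee (n : ℕ) : IsM (ee n) := ee_eq n ▸ isM_mcx_zero _ _

theorem isH_ucx (b : ℝ) (Z : ZMat n) : IsH (ucx b Z) := by
  refine isH_iff.2 ⟨_, ?_, rfl⟩
  rw [Matrix.fromBlocks_conjTranspose, Matrix.fromBlocks_neg]
  simp

theorem isH_Jrm (n : ℕ) : IsH (Jrm n) := by
  refine isH_iff.2 ⟨_, ?_, Jrm_eq_cx n⟩
  rw [Matrix.fromBlocks_conjTranspose, Matrix.fromBlocks_neg]
  simp

/-- `ad(e)` annihilates the blocks `a ∈ ℝ` and `H`, which form `m_∥`, and maps `m_⊥` to `h_⊥`. -/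
theorem lie_ee_mcx (a : ℂ) (Z : ZMat n) (H : CMat n) :
    ⁅ee n, mcx a Z H⁆ = kap n • ucx a.im Z := by
  rw [ee_eq, mcx, mcx, lie_cx_zero_zero, ucx, cx_smul, cx_inj]
  refine ⟨?_, by simp⟩
  simp only [cj_fromBlocks, Matrix.fromBlocks_multiply, Matrix.fromBlocks_smul, sub_eq_add_neg,
    Matrix.fromBlocks_neg, Matrix.fromBlocks_add]
  congr 1
  · simp only [cj_smul, cj_eps, Matrix.smul_mul, Matrix.mul_smul, eps_mul_eps,
      Matrix.transpose_zero, neg_zero, Matrix.zero_mul, cj_zero, Matrix.mul_zero, add_zero,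
      smul_neg, neg_neg, smul_smul]
    rw [← Complex.coe_smul, smul_smul, ← neg_smul, ← add_smul]
    congr 1
    apply Complex.ext <;> simp <;> ring
  · simp
  · simp
  · simp

/-- `ad(e)` maps `h_⊥` back to `m_⊥`; the factor is four times larger on the component `b` than on
the component `Z`. -/
theorem lie_ee_ucx (b : ℝ) (Z : ZMat n) :
    ⁅ee n, ucx b Z⁆ = -(kap n • mcx (4 * b * Complex.I) Z 0) := by
  rw [ee_eq, mcx, mcx, ucx, lie_swap, lie_cx_zero_right, cx_smul, neg_inj, cx_inj]
  refine ⟨by simp, ?_⟩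
  simp only [cj_fromBlocks, Matrix.fromBlocks_multiply, Matrix.fromBlocks_smul, sub_eq_add_neg,
    Matrix.fromBlocks_neg, Matrix.fromBlocks_add]
  congr 1
  · simp only [cj_smul, cj_one, Matrix.smul_mul, Matrix.mul_smul, Matrix.transpose_zero,
      neg_zero, Matrix.zero_mul, Matrix.mul_zero, add_zero, smul_smul,
      Matrix.one_mul, Matrix.mul_one]
    rw [← Complex.coe_smul, smul_smul, ← neg_smul, ← add_smul]
    congr 1
    apply Complex.ext <;> simp
    ring
  · simp
  · simp
  · simp

theorem lie_ucx_ee (b : ℝ) (Z : ZMat n) :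
    ⁅ucx b Z, ee n⁆ = kap n • mcx (4 * b * Complex.I) Z 0 := by
  rw [lie_swap, lie_ee_ucx, neg_neg]

theorem neg_lie_Jrm_mcx (a : ℂ) (Z : ZMat n) (H : CMat n) :
    -⁅Jrm n, mcx a Z H⁆ = mcx 0 (Complex.I • Z) ((2 * Complex.I) • H) := by
  rw [Jrm_eq_cx, mcx, mcx, lie_cx_zero_right, cx_neg, cx_inj]
  refine ⟨by simp, ?_⟩
  simp only [cj_fromBlocks, Matrix.fromBlocks_multiply, sub_eq_add_neg,
    Matrix.fromBlocks_neg, Matrix.fromBlocks_add]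
  congr 1
  · simp
  · simp
  · simp
  · simp [two_mul, add_smul]

/-- The bracket of `h_⊥` with the elements of `m` whose block `H` vanishes; the block `Zᵀ ε Z` is
the wedge product of the rows of `Z`. -/
theorem lie_ucx_mcx (b : ℝ) (a : ℂ) (Z : ZMat n) :
    ⁅ucx b Z, mcx a Z 0⁆ = mcx (4 * b * Complex.I * a - (Z * Zᴴ).trace)
      ((2 * b * Complex.I + a) • Z) ((2 : ℝ) • (Zᵀ * eps * Z)) := by
  rw [ucx, mcx, mcx, lie_cx_zero_right, cx_inj]
  refine ⟨rfl, ?_⟩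
  simp only [cj_fromBlocks, Matrix.fromBlocks_multiply, sub_eq_add_neg,
    Matrix.fromBlocks_neg, Matrix.fromBlocks_add]
  congr 1
  · have h := eps_mul_transpose_add (Z * Zᴴ)
    rw [Matrix.transpose_mul, conjTranspose_transpose'] at h
    rw [add_smul, neg_smul, ← h]
    simp [smul_smul, Matrix.mul_assoc]
    module
  · simp [add_smul]
  · simp [add_smul]
  · simp [two_smul, Matrix.mul_assoc]

theorem wedge_eq (z₁ z₂ : CVec n) : wedge z₁ z₂ = (zMat z₁ z₂)ᵀ * eps * zMat z₁ z₂ := by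
  ext i j
  simp [wedge, zMat, eps, Matrix.mul_apply, Fin.sum_univ_two, Matrix.vecMulVec_apply]
  ring

theorem trace_fromBlocks' {l m : Type*} [Fintype l] [Fintype m] (A : Matrix l l ℂ)
    (B : Matrix l m ℂ) (C : Matrix m l ℂ) (D : Matrix m m ℂ) :
    (Matrix.fromBlocks A B C D).trace = A.trace + D.trace := by
  simp [Matrix.trace, Fintype.sum_sum_type]

/-- The Cartan-Killing form is negative definite on `m`: its value is a negative multiple of the
real part of a Hermitian form in the blocks. -/
theorem killing_mcx (a a' : ℂ) (Z Z' : ZMat n) (H H' : CMat n) (hH' : H'ᵀ = -H') :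
    killing (mcx a Z H) (mcx a' Z' H') = -(2 * (n : ℝ) - 2) * 2 *
      (2 * (a * star a') + 2 * (Z * Z'ᴴ).trace + (H * H'ᴴ).trace).re := by
  have e : H'ᴴ = -cj H' := by rw [← cj_transpose, hH', cj_neg]
  rw [killing, mcx, mcx, cx_mul, trace_cx]
  simp only [cj_fromBlocks, Matrix.fromBlocks_multiply, zero_mul, zero_add,
    trace_fromBlocks', Matrix.trace_add, cj_neg, cj_transpose, Matrix.mul_neg,
    Matrix.neg_mul, Matrix.trace_neg, e, cj_smul, cj_eps, Matrix.smul_mul, Matrix.mul_smul,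
    eps_mul_eps, Matrix.trace_smul, Matrix.trace_one]
  have t : (Zᵀ * cj Z').trace = (Z * Z'ᴴ).trace := by
    rw [← Matrix.trace_transpose, Matrix.transpose_mul, Matrix.transpose_transpose,
      transpose_cj, Matrix.trace_mul_comm]
  rw [t]
  simp
  ring

/-- The Cartan-Killing form is invariant. -/
theorem killing_lie (A B C : Mat n) : killing ⁅A, B⁆ C = killing A ⁅B, C⁆ := by
  have h1 : ((A * B - B * A) * C).trace = (A * (B * C - C * B)).trace := by
    rw [Matrix.sub_mul, Matrix.mul_sub, Matrix.trace_sub, Matrix.trace_sub, Matrix.mul_assoc,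
      Matrix.mul_assoc B A C, Matrix.trace_mul_comm B, Matrix.mul_assoc A C B]
  rw [killing, killing, Ring.lie_def, Ring.lie_def, h1]

end Blocks

/-! ### Tangent vectors in frames -/

section Frames

variable {n : ℕ} {P X g : Mat n}

/-- `g ∈ SO(2n)` determines a frame at the point `P = g J₀ g⁻¹`. -/
def IsFrame (P g : Mat n) : Prop := g ∈ SO n ∧ P = g * J0 n * gᵀ

theorem IsAdapted.isFrame (h : IsAdapted P X g) : IsFrame P g := ⟨h.1, h.2.1⟩

theorem IsFrame.left_inv (h : IsFrame P g) : gᵀ * g = 1 := SO_transpose_mul h.1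

theorem IsFrame.right_inv (h : IsFrame P g) : g * gᵀ = 1 := SO_mul_transpose h.1

theorem IsFrame.left_inv_mul (h : IsFrame P g) (X : Mat n) : gᵀ * (g * X) = X := by
  rw [← mul_assoc, h.left_inv, one_mul]

theorem IsFrame.right_inv_mul (h : IsFrame P g) (X : Mat n) : g * (gᵀ * X) = X := by
  rw [← mul_assoc, h.right_inv, one_mul]

theorem J0_mul_J0_mul (X : Mat n) : J0 n * (J0 n * X) = -X := by
  rw [← mul_assoc, J0_mul_J0, neg_mul, one_mul]

theorem J0_transpose (n : ℕ) : (J0 n)ᵀ = -J0 n := by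
  rw [J0_eq_cx, cx_transpose, cx_neg]
  simp

/-- The tangent vector at `g J₀ g⁻¹` with components `ζ ∈ m` in the frame `g`. -/
def frameVec (g ζ : Mat n) : Mat n := g * ⁅ζ, J0 n⁆ * gᵀ

theorem coframe_add (P g Z Z' : Mat n) :
    coframe P g (Z + Z') = coframe P g Z + coframe P g Z' := by
  simp [coframe, gen, add_mul, mul_add]

theorem coframe_smul (P g : Mat n) (c : ℝ) (Z : Mat n) :
    coframe P g (c • Z) = c • coframe P g Z := by
  simp [coframe, gen, smul_comm c]

theorem coframe_neg (P g Z : Mat n) : coframe P g (-Z) = -coframe P g Z := by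
  simp [coframe, gen]

theorem coframe_sub (P g Z Z' : Mat n) :
    coframe P g (Z - Z') = coframe P g Z - coframe P g Z' := by
  rw [sub_eq_add_neg, coframe_add, coframe_neg, sub_eq_add_neg]

theorem IsTangent.add {Z Z' : Mat n} (h : IsTangent P Z) (h' : IsTangent P Z') :
    IsTangent P (Z + Z') := by
  refine ⟨by simp [h.1, h'.1, add_comm], ?_⟩
  rw [add_mul, mul_add, h.2, h'.2, neg_add]

theorem IsTangent.smul {Z : Mat n} (c : ℝ) (h : IsTangent P Z) : IsTangent P (c • Z) := by
  refine ⟨by simp [h.1], ?_⟩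
  rw [smul_mul_assoc, mul_smul_comm, h.2, smul_neg]

theorem IsTangent.neg {Z : Mat n} (h : IsTangent P Z) : IsTangent P (-Z) := by
  simpa using h.smul (-1)

theorem IsTangent.sub {Z Z' : Mat n} (h : IsTangent P Z) (h' : IsTangent P Z') :
    IsTangent P (Z - Z') := by
  rw [sub_eq_add_neg]
  exact h.add h'.neg

theorem IsFrame.coframe_eq (h : IsFrame P g) (Z : Mat n) :
    coframe P g Z = -(1 / 2 : ℝ) • (gᵀ * Z * g * J0 n) := by
  rw [coframe, gen, h.2]
  simp only [mul_smul_comm, smul_mul_assoc, mul_assoc, h.left_inv, mul_one]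

theorem IsFrame.gen_eq (h : IsFrame P g) (Z : Mat n) : gen P Z = g * coframe P g Z * gᵀ := by
  simp only [coframe, mul_assoc, h.right_inv, h.right_inv_mul, mul_one]

theorem IsFrame.vec_eq (h : IsFrame P g) (ζ : Mat n) :
    vec P (g * ζ * gᵀ) = frameVec g ζ := by
  rw [vec, frameVec, Ring.lie_def, Ring.lie_def, h.2]
  simp only [mul_assoc, h.left_inv_mul, mul_sub, sub_mul]

theorem IsFrame.isM_coframe (h : IsFrame P g) {Z : Mat n} (hZ : IsTangent P Z) :
    IsM (coframe P g Z) := by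
  have h1 : (gᵀ * Z * g)ᵀ = -(gᵀ * Z * g) := by
    simp [Matrix.transpose_mul, hZ.1, mul_assoc]
  have h2 : (gᵀ * Z * g) * J0 n = -(J0 n * (gᵀ * Z * g)) := by
    have e := congrArg (fun Y => gᵀ * Y * g) hZ.2
    simp only [h.2, mul_assoc, h.left_inv, mul_one, mul_neg, neg_mul, h.left_inv_mul] at e
    simpa only [mul_assoc] using e
  rw [h.coframe_eq]
  generalize gᵀ * Z * g = Y at *
  refine ⟨?_, ?_⟩
  · rw [Matrix.transpose_smul, Matrix.transpose_mul, J0_transpose, h1, neg_mul_neg, ← smul_neg,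
      h2, neg_neg]
  · rw [smul_mul_assoc, mul_smul_comm, h2, ← smul_neg]
    simp only [neg_mul, mul_neg, neg_neg, mul_assoc, h2, J0_mul_J0_mul]

theorem IsFrame.frameVec_coframe (h : IsFrame P g) {Z : Mat n} (hZ : IsTangent P Z) :
    frameVec g (coframe P g Z) = Z := by
  have h2 : (gᵀ * Z * g) * J0 n = -(J0 n * (gᵀ * Z * g)) := by
    have e := congrArg (fun Y => gᵀ * Y * g) hZ.2
    simp only [h.2, mul_assoc, h.left_inv, mul_one, mul_neg, neg_mul, h.left_inv_mul] at e
    simpa only [mul_assoc] using e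
  have h3 : ⁅coframe P g Z, J0 n⁆ = gᵀ * Z * g := by
    rw [h.coframe_eq]
    generalize gᵀ * Z * g = Y at *
    rw [Ring.lie_def, smul_mul_assoc, mul_smul_comm, ← smul_sub, h2]
    simp only [neg_mul, mul_neg, mul_assoc, h2, J0_mul_J0_mul, neg_neg]
    module
  rw [frameVec, h3]
  simp only [mul_assoc, h.right_inv, h.right_inv_mul, mul_one]

theorem IsFrame.isTangent_frameVec (h : IsFrame P g) {ζ : Mat n} (hζ : IsM ζ) :
    IsTangent P (frameVec g ζ) := by
  have e : ⁅ζ, J0 n⁆ = (-2 : ℝ) • (J0 n * ζ) := by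
    rw [Ring.lie_def, hζ.2]; module
  rw [frameVec, e]
  refine ⟨?_, ?_⟩
  · simp only [Matrix.transpose_mul, Matrix.transpose_smul, Matrix.transpose_transpose,
      J0_transpose, hζ.1, neg_mul_neg, hζ.2]
    simp [mul_assoc]
  · rw [h.2]
    simp only [smul_mul_assoc, mul_smul_comm, mul_assoc, h.left_inv_mul]
    rw [← mul_assoc ζ, hζ.2]
    simp [mul_assoc]

theorem IsFrame.coframe_frameVec (h : IsFrame P g) {ζ : Mat n} (hζ : IsM ζ) :
    coframe P g (frameVec g ζ) = ζ := by
  have e : ⁅ζ, J0 n⁆ = (-2 : ℝ) • (J0 n * ζ) := by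
    rw [Ring.lie_def, hζ.2]; module
  rw [h.coframe_eq, frameVec, e]
  simp only [smul_mul_assoc, mul_smul_comm, mul_assoc, h.left_inv_mul, h.left_inv, mul_one, hζ.2,
    mul_neg, J0_mul_J0_mul]
  module

theorem IsFrame.coframe_vec (h : IsFrame P g) {ζ : Mat n} (hζ : IsM ζ) :
    coframe P g (vec P (g * ζ * gᵀ)) = ζ := by
  rw [h.vec_eq, h.coframe_frameVec hζ]

theorem IsFrame.isTangent_vec (h : IsFrame P g) {ζ : Mat n} (hζ : IsM ζ) :
    IsTangent P (vec P (g * ζ * gᵀ)) := by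
  rw [h.vec_eq]
  exact h.isTangent_frameVec hζ

theorem IsFrame.coframe_injective (h : IsFrame P g) {Z Z' : Mat n} (hZ : IsTangent P Z)
    (hZ' : IsTangent P Z') (e : coframe P g Z = coframe P g Z') : Z = Z' := by
  rw [← h.frameVec_coframe hZ, e, h.frameVec_coframe hZ']

theorem IsFrame.conj_lie (h : IsFrame P g) (A B : Mat n) :
    ⁅g * A * gᵀ, g * B * gᵀ⁆ = g * ⁅A, B⁆ * gᵀ := by
  rw [Ring.lie_def, Ring.lie_def]
  simp only [mul_assoc, h.left_inv_mul, mul_sub, sub_mul]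

theorem IsM.neg {ζ : Mat n} (h : IsM ζ) : IsM (-ζ) := by
  refine ⟨by simp [h.1], by simp [h.2]⟩

theorem IsFrame.curv_eq (h : IsFrame P g) (X Y Z : Mat n) :
    curv P X Y Z = vec P (g * -⁅⁅coframe P g X, coframe P g Y⁆, coframe P g Z⁆ * gᵀ) := by
  rw [curv, h.gen_eq, h.gen_eq, h.gen_eq, h.conj_lie, h.conj_lie]
  simp

theorem IsFrame.isM_curv (h : IsFrame P g) {X Y Z : Mat n} (hX : IsTangent P X)
    (hY : IsTangent P Y) (hZ : IsTangent P Z) :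
    IsM (-⁅⁅coframe P g X, coframe P g Y⁆, coframe P g Z⁆) :=
  ((h.isM_coframe hX).lie (h.isM_coframe hY)).lie (h.isM_coframe hZ) |>.neg

theorem IsFrame.isTangent_curv (h : IsFrame P g) {X Y Z : Mat n} (hX : IsTangent P X)
    (hY : IsTangent P Y) (hZ : IsTangent P Z) : IsTangent P (curv P X Y Z) := by
  rw [h.curv_eq]
  exact h.isTangent_vec (h.isM_curv hX hY hZ)

theorem IsFrame.coframe_curv (h : IsFrame P g) {X Y Z : Mat n} (hX : IsTangent P X)
    (hY : IsTangent P Y) (hZ : IsTangent P Z) :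
    coframe P g (curv P X Y Z) = -⁅⁅coframe P g X, coframe P g Y⁆, coframe P g Z⁆ := by
  rw [h.curv_eq, h.coframe_vec (h.isM_curv hX hY hZ)]

theorem IsFrame.isTangent_adSq (h : IsFrame P g) {X Z : Mat n} (hX : IsTangent P X)
    (hZ : IsTangent P Z) : IsTangent P (adSq P X Z) :=
  (h.isTangent_curv hZ hX hX).neg

theorem IsFrame.coframe_adSq (h : IsFrame P g) {X Z : Mat n} (hX : IsTangent P X)
    (hZ : IsTangent P Z) :
    coframe P g (adSq P X Z) = ⁅⁅coframe P g Z, coframe P g X⁆, coframe P g X⁆ := by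
  rw [adSq, coframe_neg, h.coframe_curv hZ hX hX, neg_neg]

theorem IsFrame.metric_eq (h : IsFrame P g) (X Y : Mat n) :
    metric P X Y = -killing (coframe P g X) (coframe P g Y) := by
  rw [metric, h.gen_eq, h.gen_eq, killing, killing]
  have e : (g * coframe P g X * gᵀ * (g * coframe P g Y * gᵀ)).trace
      = (coframe P g X * coframe P g Y).trace := by
    rw [show g * coframe P g X * gᵀ * (g * coframe P g Y * gᵀ)
      = g * (coframe P g X * coframe P g Y * gᵀ) by
        simp only [mul_assoc, h.left_inv_mul], Matrix.trace_mul_comm]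
    simp only [mul_assoc, h.left_inv, mul_one]
  rw [e]

theorem isTangent_Jmap {Z : Mat n} (hg : ∃ g, IsAdapted P X g) (hZ : IsTangent P Z) :
    IsTangent P (Jmap P X Z) := by
  have hc := hg.choose_spec
  rw [Jmap, dif_pos hg]
  exact hc.isFrame.isTangent_vec ((isH_Jrm n).lie (hc.isFrame.isM_coframe hZ)).neg

/-! ### The eigenspaces of `ad²(X)` in an adapted frame -/

/-- On `m`, the operator `ad(e)²` has the eigenvalues `0` on `m_∥`, `-4/χ` on the component `b` and
`-1/χ` on the component `Z` of `m_⊥`. -/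
theorem lie_lie_ee (a : ℂ) (Z : ZMat n) (H : CMat n) :
    ⁅⁅mcx a Z H, ee n⁆, ee n⁆
      = mcx (-(4 * (kap n * kap n) * a.im * Complex.I)) (-((kap n * kap n) • Z)) 0 := by
  have e : ⁅mcx a Z H, ee n⁆ = -(kap n • ucx a.im Z) := by rw [lie_swap, lie_ee_mcx]
  have e2 : ⁅-(kap n • ucx a.im Z), ee n⁆ = -(kap n • ⁅ucx a.im Z, ee n⁆) := by
    simp [Ring.lie_def, smul_sub]
    abel
  rw [e, e2, lie_ucx_ee, smul_smul, mcx_smul, mcx_neg]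
  congr 1
  · push_cast; ring
  · simp

/-- Every tangent vector has block coordinates in an adapted frame. -/
theorem IsFrame.exists_mcx (h : IsFrame P g) {Z : Mat n} (hZ : IsTangent P Z) :
    ∃ (a : ℂ) (z : ZMat n) (H : CMat n), Hᵀ = -H ∧ coframe P g Z = mcx a z H :=
  isM_iff_mcx.1 (h.isM_coframe hZ)

theorem IsAdapted.coframe_adSq (h : IsAdapted P X g) (hX : IsTangent P X) {Z : Mat n}
    (hZ : IsTangent P Z) {a : ℂ} {z : ZMat n} {H : CMat n} (hc : coframe P g Z = mcx a z H) :
    coframe P g (adSq P X Z)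
      = mcx (-(4 * (kap n * kap n) * a.im * Complex.I)) (-((kap n * kap n) • z)) 0 := by
  rw [h.isFrame.coframe_adSq hX hZ, h.2.2, hc, lie_lie_ee]

/-- The null space of `ad²(X)` is `m_∥`, the blocks `a ∈ ℝ` and `H`. -/
theorem IsAdapted.isPar_iff (hn : 3 ≤ n) (h : IsAdapted P X g) (hX : IsTangent P X) {Z : Mat n}
    (hZ : IsTangent P Z) {a : ℂ} {z : ZMat n} {H : CMat n} (hc : coframe P g Z = mcx a z H) :
    IsPar P X Z ↔ a.im = 0 ∧ z = 0 := by
  have hk := (kap_pos hn).ne'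
  have hA := h.coframe_adSq hX hZ hc
  have hz : coframe P g (0 : Mat n) = 0 := by simp [coframe, gen]
  constructor
  · rintro ⟨-, h0⟩
    rw [h0, hz, ← mcx_zero, mcx_inj] at hA
    refine ⟨?_, ?_⟩
    · simpa [hk] using hA.1
    · simpa [hk] using hA.2.1
  · rintro ⟨h1, h2⟩
    refine ⟨hZ, h.isFrame.coframe_injective (h.isFrame.isTangent_adSq hX hZ)
      (by simp [IsTangent]) ?_⟩
    rw [hA, hz, h1, h2, ← mcx_zero]
    simp

/-- Definiteness of the Cartan-Killing form on `m_∥`. -/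
theorem killing_mcx_self_eq_zero (hn : 3 ≤ n) {a : ℝ} {H : CMat n} (hH : Hᵀ = -H)
    (h : killing (mcx a 0 H) (mcx a 0 H) = 0) : a = 0 ∧ H = 0 := by
  have hn' : (3 : ℝ) ≤ n := by exact_mod_cast hn
  rw [killing_mcx _ _ _ _ _ _ hH] at h
  have h1 : -(2 * (n : ℝ) - 2) * 2 ≠ 0 := by
    have : 0 < 2 * (n : ℝ) - 2 := by linarith
    nlinarith
  have h2 := (mul_eq_zero.1 h).resolve_left h1
  have htr : (H * Hᴴ).trace.re = ∑ i, ∑ j, ‖H i j‖ ^ 2 := by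
    rw [Matrix.trace, Complex.re_sum]
    refine Finset.sum_congr rfl fun i _ => ?_
    rw [Matrix.diag_apply, Matrix.mul_apply, Complex.re_sum]
    refine Finset.sum_congr rfl fun j _ => ?_
    rw [Matrix.conjTranspose_apply, ← Complex.normSq_eq_norm_sq, Complex.star_def, Complex.mul_conj,
      Complex.ofReal_re]
  have e : (2 * ((a : ℂ) * star (a : ℂ)) + 2 * ((0 : ZMat n) * (0 : ZMat n)ᴴ).trace
      + (H * Hᴴ).trace).re = 2 * (a * a) + ∑ i, ∑ j, ‖H i j‖ ^ 2 := by
    simp [htr]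
  rw [e] at h2
  have hs : 0 ≤ ∑ i, ∑ j, ‖H i j‖ ^ 2 := by positivity
  refine ⟨by nlinarith [mul_self_nonneg a], ?_⟩
  have hs0 : ∑ i, ∑ j, ‖H i j‖ ^ 2 = 0 := by nlinarith [mul_self_nonneg a]
  ext i j
  rw [Finset.sum_eq_zero_iff_of_nonneg (fun i _ => by positivity)] at hs0
  have := hs0 i (Finset.mem_univ _)
  rw [Finset.sum_eq_zero_iff_of_nonneg (fun i _ => by positivity)] at this
  simpa using this j (Finset.mem_univ _)

/-- The orthogonal complement is `m_⊥`, the blocks `a ∈ iℝ` and `Z`. -/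
theorem IsAdapted.isPerp_iff (hn : 3 ≤ n) (h : IsAdapted P X g) (hX : IsTangent P X) {Z : Mat n}
    (hZ : IsTangent P Z) {a : ℂ} {z : ZMat n} {H : CMat n} (hH : Hᵀ = -H)
    (hc : coframe P g Z = mcx a z H) :
    IsPerp P X Z ↔ a.re = 0 ∧ H = 0 := by
  constructor
  · rintro ⟨-, h0⟩
    have hM : IsM (mcx (a.re : ℂ) (0 : ZMat n) H) := isM_mcx hH
    have hT := h.isFrame.isTangent_frameVec hM
    have hcY := h.isFrame.coframe_frameVec hM
    have := h0 _ ((h.isPar_iff hn hX hT hcY).2 ⟨by simp, rfl⟩)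
    rw [h.isFrame.metric_eq, hc, hcY, neg_eq_zero] at this
    refine killing_mcx_self_eq_zero hn hH ?_
    rw [← this, killing_mcx _ _ _ _ _ _ hH, killing_mcx _ _ _ _ _ _ hH]
    congr 1
    simp
  · rintro ⟨h1, rfl⟩
    refine ⟨hZ, fun Y hY => ?_⟩
    obtain ⟨a', z', H', hH', hc'⟩ := h.isFrame.exists_mcx hY.1
    obtain ⟨h2, rfl⟩ := (h.isPar_iff hn hX hY.1 hc').1 hY
    rw [h.isFrame.metric_eq, hc, hc', killing_mcx _ _ _ _ _ _ hH']
    simp [h1, h2]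

/-- The polynomial `projPerp` in `ad²(X)` takes the value `1` at the eigenvalues `-4/χ`, `-1/χ` and
`0` at the eigenvalue `0`, so that `projPar` is the projection onto `m_∥`. -/
theorem IsAdapted.coframe_projPar (hn : 3 ≤ n) (h : IsAdapted P X g) (hX : IsTangent P X)
    {Z : Mat n} (hZ : IsTangent P Z) {a : ℂ} {z : ZMat n} {H : CMat n}
    (hc : coframe P g Z = mcx a z H) :
    IsTangent P (projPar P X Z) ∧ coframe P g (projPar P X Z) = mcx a.re 0 H := by
  have h1 := h.isFrame.isTangent_adSq hX hZ
  have h2 := h.isFrame.isTangent_adSq hX h1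
  have c1 := h.coframe_adSq hX hZ hc
  have c2 := h.coframe_adSq hX h1 c1
  refine ⟨hZ.sub (((h1.smul _).add h2).smul _), ?_⟩
  have hk := chi_mul_kap hn
  have hχ := (chi_pos hn).ne'
  rw [projPar, projPerp, coframe_sub, coframe_smul, coframe_add, coframe_smul, c1, c2, hc]
  simp only [mcx_smul, mcx_add, mcx_sub]
  have hkk : 5 / chi n = 5 * (kap n * kap n) := by field_simp; linarith
  have hkC : (chi n : ℂ) * ((kap n : ℂ) * kap n) = 1 := by exact_mod_cast hk
  rw [hkk]
  congr 1
  · have him : (-(4 * ((kap n : ℂ) * kap n) * a.im * Complex.I)).im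
        = -(4 * (kap n * kap n) * a.im) := by simp
    rw [him]
    push_cast
    linear_combination -Complex.re_add_im a
      - (chi n * ((kap n : ℂ) * kap n) + 1) * a.im * Complex.I * hkC
  · ext i j
    simp
    linear_combination -(chi n * ((kap n : ℂ) * kap n) + 1) * z i j * hkC
  · simp

/-- In block coordinates `J` is `0` on the block of size two, multiplication by `i` on `Z` and by
`2i` on `H`. -/
theorem IsAdapted.coframe_Jmap (hn : 3 ≤ n) (h : IsAdapted P X g) {Z : Mat n}
    (hZ : IsTangent P Z) {a : ℂ} {z : ZMat n} {H : CMat n} (hc : coframe P g Z = mcx a z H) :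
    coframe P g (Jmap P X Z) = mcx 0 (Complex.I • z) ((2 * Complex.I) • H) := by
  rw [SOU.coframe_Jmap (by omega) h hZ, hc, neg_lie_Jrm_mcx]

end Frames

/-! ### The degenerate almost complex structure -/

section AlmostComplex

variable {n : ℕ} {P X : Mat n}

theorem Jmap_adSq (hn : 3 ≤ n) (hX : InClass P X) {Z : Mat n} (hZ : IsTangent P Z) :
    Jmap P X (adSq P X Z) = adSq P X (Jmap P X Z) := by
  obtain ⟨hXt, g, hg⟩ := hX
  obtain ⟨a, z, H, hH, hc⟩ := hg.isFrame.exists_mcx hZ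
  have hA := hg.isFrame.isTangent_adSq hXt hZ
  have hJ := isTangent_Jmap ⟨g, hg⟩ hZ
  refine hg.isFrame.coframe_injective (isTangent_Jmap ⟨g, hg⟩ hA)
    (hg.isFrame.isTangent_adSq hXt hJ) ?_
  rw [hg.coframe_Jmap hn hA (hg.coframe_adSq hXt hZ hc),
    hg.coframe_adSq hXt hJ (hg.coframe_Jmap hn hZ hc)]
  congr 1
  · simp
  · rw [smul_neg, smul_comm]
  · simp

theorem IsPerp.Jmap (hn : 3 ≤ n) (hX : InClass P X) {Z : Mat n} (hZ : IsPerp P X Z) :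
    IsPerp P X (Jmap P X Z) ∧
      SOU.Jmap P X (SOU.Jmap P X (SOU.Jmap P X Z)) = -SOU.Jmap P X Z := by
  obtain ⟨hXt, g, hg⟩ := hX
  obtain ⟨a, z, H, hH, hc⟩ := hg.isFrame.exists_mcx hZ.1
  obtain ⟨-, rfl⟩ := (hg.isPerp_iff hn hXt hZ.1 hH hc).1 hZ
  have hJ := isTangent_Jmap ⟨g, hg⟩ hZ.1
  have c1 := hg.coframe_Jmap hn hZ.1 hc
  have hJJ := isTangent_Jmap ⟨g, hg⟩ hJ
  have c2 := hg.coframe_Jmap hn hJ c1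
  refine ⟨(hg.isPerp_iff hn hXt hJ (by simp) c1).2 (by simp), ?_⟩
  refine hg.isFrame.coframe_injective (isTangent_Jmap ⟨g, hg⟩ hJJ) hJ.neg ?_
  rw [hg.coframe_Jmap hn hJJ c2, coframe_neg, c1, mcx_neg]
  congr 1
  · simp
  · simp [smul_smul]
  · simp

/-- The vector with the single component `b = 1` in `m_⊥` is annihilated by `J`. -/
theorem exists_isPerp_Jmap_eq_zero (hn : 3 ≤ n) (hX : InClass P X) :
    ∃ Z, IsPerp P X Z ∧ Z ≠ 0 ∧ Jmap P X Z = 0 := by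
  obtain ⟨hXt, g, hg⟩ := hX
  have hM : IsM (mcx Complex.I (0 : ZMat n) 0) := isM_mcx_zero _ _
  have hT := hg.isFrame.isTangent_frameVec hM
  have hc := hg.isFrame.coframe_frameVec hM
  have hz : coframe P g (0 : Mat n) = mcx 0 0 0 := by simp [coframe, gen, mcx_zero]
  refine ⟨_, (hg.isPerp_iff hn hXt hT (by simp) hc).2 (by simp), fun h => ?_, ?_⟩
  · rw [h, hz, mcx_inj] at hc
    exact Complex.I_ne_zero hc.1.symm
  · refine hg.isFrame.coframe_injective (isTangent_Jmap ⟨g, hg⟩ hT) (by simp [IsTangent]) ?_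
    rw [hg.coframe_Jmap hn hT hc, hz]
    simp

/-- `J` is multiplication by `i` on the component `Z`, which exists because `n - 2 > 0`. -/
theorem exists_isPerp_Jmap_ne_zero (hn : 3 ≤ n) (hX : InClass P X) :
    ∃ Z, IsPerp P X Z ∧ Jmap P X Z ≠ 0 := by
  obtain ⟨hXt, g, hg⟩ := hX
  have hM : IsM (mcx 0 (Matrix.of fun _ _ => 1 : ZMat n) 0) := isM_mcx_zero _ _
  have hT := hg.isFrame.isTangent_frameVec hM
  have hc := hg.isFrame.coframe_frameVec hM
  have hz : coframe P g (0 : Mat n) = mcx 0 0 0 := by simp [coframe, gen, mcx_zero]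
  refine ⟨_, (hg.isPerp_iff hn hXt hT (by simp) hc).2 (by simp), fun h => ?_⟩
  have hJ := hg.coframe_Jmap hn hT hc
  rw [h, hz, mcx_inj] at hJ
  have := congrFun (congrFun hJ.2.1 0) ⟨0, by omega⟩
  simp at this
  exact Complex.I_ne_zero this.symm

end AlmostComplex

/-! ### Covariant derivatives in a moving frame -/

section MovingFrame

variable {n : ℕ}

theorem IsM.hasDerivAt {ζ : ℝ → Mat n} {ζ' : Mat n} {x : ℝ} (h : ∀ y, IsM (ζ y))
    (hd : HasDerivAt ζ ζ' x) : IsM ζ' := by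
  constructor
  · have h1 := hd.matrixTranspose
    simp only [fun y => (h y).1] at h1
    exact h1.unique hd.neg
  · have h1 := hd.matrixMul (hasDerivAt_const x (J0 n))
    have h2 := ((hasDerivAt_const x (J0 n)).matrixMul hd).neg
    simp only [fun y => (h y).2, mul_zero, add_zero, zero_mul, zero_add] at h1 h2
    exact h1.unique h2

/-- The Maurer–Cartan form of an orthogonal frame is skew. -/
theorem transpose_mul_deriv_skew {g : ℝ → Mat n} {g' : Mat n} {x : ℝ}
    (h : ∀ᶠ y in nhds x, (g y)ᵀ * g y = 1) (hd : HasDerivAt g g' x) :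
    ((g x)ᵀ * g')ᵀ = -((g x)ᵀ * g') := by
  have h1 := hd.matrixTranspose.matrixMul hd
  have h2 : HasDerivAt (fun y => (g y)ᵀ * g y) 0 x :=
    (hasDerivAt_const x (1 : Mat n)).congr_of_eventuallyEq h
  rw [Matrix.transpose_mul, Matrix.transpose_transpose]
  exact eq_neg_of_add_eq_zero_left (h1.unique h2)

/-- In a moving frame, `∇_x` acts as `D_x + [u, ·]`, where `u` is the connection. -/
theorem coframe_nabla {c g Z : ℝ → Mat n} {x : ℝ} {g' ζ' : Mat n}
    (hf : ∀ y, IsFrame (c y) (g y)) (hg : HasDerivAt g g' x)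
    (hZ : ∀ y, IsTangent (c y) (Z y))
    (hζ : HasDerivAt (fun y => coframe (c y) (g y) (Z y)) ζ' x) :
    IsTangent (c x) (nabla c Z x) ∧ coframe (c x) (g x) (nabla c Z x)
      = ζ' + ⁅hPart ((g x)ᵀ * g'), coframe (c x) (g x) (Z x)⁆ := by
  have hM : ∀ y, IsM (coframe (c y) (g y) (Z y)) := fun y => (hf y).isM_coframe (hZ y)
  have hM' : IsM ζ' := IsM.hasDerivAt hM hζ
  have hU := transpose_mul_deriv_skew (.of_forall fun y => (hf y).left_inv) hg
  have hZd : HasDerivAt (fun y => frameVec (g y) (coframe (c y) (g y) (Z y)))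
      ((g' * ⁅coframe (c x) (g x) (Z x), J0 n⁆ + g x * ⁅ζ', J0 n⁆) * (g x)ᵀ
        + g x * ⁅coframe (c x) (g x) (Z x), J0 n⁆ * g'ᵀ) x := by
    have hb : HasDerivAt (fun y => ⁅coframe (c y) (g y) (Z y), J0 n⁆) ⁅ζ', J0 n⁆ x := by
      have h1 := hζ.matrixMul (hasDerivAt_const x (J0 n))
      have h2 := (hasDerivAt_const x (J0 n)).matrixMul hζ
      simp only [mul_zero, add_zero, zero_mul, zero_add] at h1 h2
      exact h1.sub h2
    exact (hg.matrixMul hb).matrixMul hg.matrixTranspose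
  have hd : deriv Z x = (g' * ⁅coframe (c x) (g x) (Z x), J0 n⁆ + g x * ⁅ζ', J0 n⁆) * (g x)ᵀ
      + g x * ⁅coframe (c x) (g x) (Z x), J0 n⁆ * g'ᵀ :=
    (hZd.congr_of_eventuallyEq (f₁ := Z) (.of_forall fun y =>
      ((hf y).frameVec_coframe (hZ y)).symm)).deriv
  have hH := isH_hPart hU
  have hA : IsM (ζ' + ⁅hPart ((g x)ᵀ * g'), coframe (c x) (g x) (Z x)⁆) := by
    obtain ⟨T, hT, e⟩ := isM_iff.1 hM'
    obtain ⟨T2, hT2, e2⟩ := isM_iff.1 (hH.lie (hM x))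
    rw [e, e2]
    exact isM_iff.2 ⟨T + T2, by rw [Matrix.transpose_add, hT, hT2, neg_add], by simp [cx_add]⟩
  have key : nabla c Z x
      = frameVec (g x) (ζ' + ⁅hPart ((g x)ᵀ * g'), coframe (c x) (g x) (Z x)⁆) := by
    have hgU : g' = g x * ((g x)ᵀ * g') := by rw [(hf x).right_inv_mul]
    have hgU' : g'ᵀ = -((g x)ᵀ * g') * (g x)ᵀ := by
      rw [← hU, Matrix.transpose_mul, Matrix.transpose_transpose, mul_assoc, (hf x).right_inv,
        mul_one]
    rw [nabla, hd, hgU', frameVec]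
    nth_rewrite 1 3 [hgU]
    have hMx := hM x
    have hc := (hf x).2
    have hinv := (hf x).left_inv_mul
    generalize coframe (c x) (g x) (Z x) = ζ at *
    generalize (g x)ᵀ * g' = U at *
    rw [hc]
    have e : (1 / 2 : ℝ) • ((U * ⁅ζ, J0 n⁆ + ⁅ζ', J0 n⁆ - ⁅ζ, J0 n⁆ * U)
        + J0 n * (U * ⁅ζ, J0 n⁆ + ⁅ζ', J0 n⁆ - ⁅ζ, J0 n⁆ * U) * J0 n)
        = ⁅ζ' + ⁅hPart U, ζ⁆, J0 n⁆ := by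
      show mPart _ = _
      obtain ⟨T, -, rfl⟩ := isM_iff.1 hMx
      obtain ⟨T', -, rfl⟩ := isM_iff.1 hM'
      obtain ⟨S, R, rfl⟩ : ∃ S R, U = cx S R := ⟨_, _, (cx_clin_alin U).symm⟩
      rw [hPart_cx, J0_eq_cx]
      simp only [Ring.lie_def, cx_mul, cx_sub, cx_add, mPart_cx, cx_inj]
      refine ⟨by simp, ?_⟩
      simp [mul_add, add_mul, mul_sub]
      module
    rw [← e]
    simp only [mul_smul_comm, smul_mul_assoc]
    congr 1
    simp only [mul_assoc, hinv, mul_add, add_mul, mul_sub, sub_mul, neg_mul, mul_neg]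
    abel
  exact ⟨key ▸ (hf x).isTangent_frameVec hA, by rw [key, (hf x).coframe_frameVec hA]⟩

end MovingFrame

/-! ### Geometric quantities in a parallel frame -/

section Framed

variable {n : ℕ}

/-- `g` is an adapted frame along the curve `c` in which the connection is
`√χ ad(e) (v, Z) ∈ h_⊥`. -/
structure IsFramed (c g : ℝ → Mat n) (v : ℝ → ℝ) (Z : ℝ → ZMat n) : Prop where
  contDiff : ContDiff ℝ ∞ g
  adapted : ∀ x, IsAdapted (c x) (deriv c x) (g x)
  tangent : ∀ x, IsTangent (c x) (deriv c x)
  conn_eq : ∀ x, conn g x = ucx (v x) (Z x)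

theorem sqrt_smul_lie_ee_perpMat (hn : 3 ≤ n) (b : ℝ) (z₁ z₂ : CVec n) :
    √(chi n) • ⁅ee n, perpMat b z₁ z₂⁆ = ucx b (zMat z₁ z₂) := by
  rw [perpMat_eq, lie_ee_mcx, smul_smul, kap_mul_sqrt hn, one_smul]
  simp

theorem kap_cube (n : ℕ) : 4 / √(chi n) ^ 3 = 4 * kap n ^ 3 := by
  unfold kap
  ring

/-- The components of the nonlocal vector field in block coordinates. -/
theorem linked_eq (K : CMat n) :
    (4 / √(chi n) ^ 3) • parMat 0 (Complex.I • K)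
      = mcx 0 0 ((4 * kap n ^ 3) • (Complex.I • K)) := by
  rw [parMat_eq, mcx_smul, kap_cube]
  simp

variable {c g : ℝ → Mat n} {v : ℝ → ℝ} {Z : ℝ → ZMat n}

namespace IsFramed

theorem hasDerivAt (h : IsFramed c g v Z) (x : ℝ) : HasDerivAt g (deriv g x) x :=
  (h.contDiff.differentiable infty_ne_zero x).hasDerivAt

theorem coframe_nabla (h : IsFramed c g v Z) {Y : ℝ → Mat n} {x : ℝ} {ζ' : Mat n}
    (hY : ∀ y, IsTangent (c y) (Y y))
    (hζ : HasDerivAt (fun y => coframe (c y) (g y) (Y y)) ζ' x) :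
    IsTangent (c x) (nabla c Y x) ∧ coframe (c x) (g x) (nabla c Y x)
      = ζ' + ⁅ucx (v x) (Z x), coframe (c x) (g x) (Y x)⁆ := by
  rw [← h.conn_eq]
  exact SOU.coframe_nabla (fun y => (h.adapted y).isFrame) (h.hasDerivAt x) hY hζ

/-- The principal normal has the components `[u, e] ∈ m_⊥`, since those of the tangent vector are
constant. -/
theorem coframe_normal (h : IsFramed c g v Z) (x : ℝ) :
    IsTangent (c x) (normal c x) ∧ coframe (c x) (g x) (normal c x)
      = mcx (4 * kap n * v x * Complex.I) (kap n • Z x) 0 := by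
  have hd : HasDerivAt (fun y => coframe (c y) (g y) (deriv c y)) 0 x := by
    simp only [(h.adapted _).2.2]
    exact hasDerivAt_const x _
  have := h.coframe_nabla h.tangent hd
  rw [zero_add, (h.adapted x).2.2, lie_ucx_ee, mcx_smul, smul_zero] at this
  refine ⟨this.1, this.2.trans ?_⟩
  congr 1
  ring

/-- In `ad²(N)_∥ c_x`, the block `H` is a multiple of `v₁ ∧ v₂`; it is the only one seen by `J`. -/
theorem coframe_source (hn : 3 ≤ n) (h : IsFramed c g v Z) (x : ℝ) :
    IsTangent (c x) (source c x) ∧ coframe (c x) (g x) (source c x)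
      = mcx 0 0 ((4 * kap n ^ 3) • (Complex.I • ((Z x)ᵀ * eps * Z x))) := by
  obtain ⟨hN, cN⟩ := h.coframe_normal x
  have hA := (h.adapted x)
  have hF := hA.isFrame
  have hT := h.tangent x
  have c1 : coframe (c x) (g x) (adSq (c x) (normal c x) (deriv c x))
      = kap n • mcx (4 * ↑(4 * kap n * v x) * Complex.I * (4 * kap n * v x * Complex.I)
          - ((kap n • Z x) * (kap n • Z x)ᴴ).trace)
        ((2 * ↑(4 * kap n * v x) * Complex.I + 4 * kap n * v x * Complex.I) • (kap n • Z x))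
        ((2 : ℝ) • ((kap n • Z x)ᵀ * eps * (kap n • Z x))) := by
    rw [hF.coframe_adSq hN hT, hA.2.2, cN, lie_ee_mcx]
    have e : ((4 * kap n * v x * Complex.I : ℂ)).im = 4 * kap n * v x := by simp
    rw [e, ← lie_ucx_mcx]
    simp [Ring.lie_def, smul_sub]
  rw [mcx_smul] at c1
  have h1 := hF.isTangent_adSq hN hT
  obtain ⟨h2, c2⟩ := hA.coframe_projPar hn hT h1 c1
  refine ⟨isTangent_Jmap ⟨_, hA⟩ h2, ?_⟩
  rw [source, hA.coframe_Jmap hn h2 c2]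
  congr 1
  · simp
  · ext i j
    simp
    ring

/-- In a parallel frame `∇_x - R(c_x, ad²(c_x)⁻¹ ∇_x c_x)` is `D_x`: the components of `Q =
ad²(c_x)⁻¹ ∇_x c_x` satisfy `[e, Q] = -u`, so that the curvature term cancels the connection. Hence
inverting the operator means integrating `v₁ ∧ v₂`. -/
theorem isOpInv (hn : 3 ≤ n) (h : IsFramed c g v Z) {W : ℝ → Mat n} {K : ℝ → CMat n}
    (hW : ContDiff ℝ ∞ W) (hWt : ∀ x, IsTangent (c x) (W x))
    (hK : ∀ x, (K x)ᵀ = -K x) (hK' : ∀ x, HasDerivAt K ((Z x)ᵀ * eps * Z x) x)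
    (hc : ∀ x, coframe (c x) (g x) (W x) = mcx 0 0 ((4 * kap n ^ 3) • (Complex.I • K x))) :
    IsOpInv c (source c) W := by
  have hk := (kap_pos hn).ne'
  refine ⟨hW, fun x => ?_, ?_⟩
  · have hA := h.adapted x
    have hF := hA.isFrame
    have hM : IsM (mcx 0 (0 : ZMat n) ((2 * kap n ^ 3) • K x)) := isM_mcx (by simp [hK])
    have hT := hF.isTangent_frameVec hM
    have hcY := hF.coframe_frameVec hM
    refine ⟨_, (hA.isPar_iff hn (h.tangent x) hT hcY).2 (by simp),
      hF.coframe_injective (hWt x) (isTangent_Jmap ⟨_, hA⟩ hT) ?_⟩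
    rw [hA.coframe_Jmap hn hT hcY, hc]
    congr 1
    · simp
    · ext i j
      simp
      ring
  · have hM : ∀ x, IsM (mcx (-(v x / kap n * Complex.I)) (-((1 / kap n) • Z x)) 0) :=
      fun x => isM_mcx_zero _ _
    have hT := fun x => (h.adapted x).isFrame.isTangent_frameVec (hM x)
    have hcQ := fun x => (h.adapted x).isFrame.coframe_frameVec (hM x)
    refine ⟨fun x => frameVec (g x) (mcx (-(v x / kap n * Complex.I)) (-((1 / kap n) • Z x)) 0),
      fun x => ⟨?_, ?_⟩, fun x => ?_⟩
    · exact ((h.adapted x).isPerp_iff hn (h.tangent x) (hT x) (by simp) (hcQ x)).2 (by simp)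
    · have hF := (h.adapted x).isFrame
      refine hF.coframe_injective (hF.isTangent_adSq (h.tangent x) (hT x))
        (h.coframe_normal x).1 ?_
      rw [(h.adapted x).coframe_adSq (h.tangent x) (hT x) (hcQ x), (h.coframe_normal x).2]
      have hkC : (kap n : ℂ) ≠ 0 := by exact_mod_cast hk
      congr 1
      · apply Complex.ext
        · simp
        · simp
          field_simp
      · ext i j
        simp
        field_simp
    · have hF := (h.adapted x).isFrame
      let L : CMat n →ₗ[ℝ] Mat n :=
        { toFun := fun H => mcx 0 0 ((4 * kap n ^ 3) • (Complex.I • H))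
          map_add' := fun H H' => by simp [mcx_add]
          map_smul' := fun r H => by
            simp only [mcx_smul, RingHom.id_apply, smul_zero, mul_zero]
            rw [smul_comm Complex.I r, smul_comm _ r] }
      have hd : HasDerivAt (fun y => coframe (c y) (g y) (W y)) (L ((Z x)ᵀ * eps * Z x)) x := by
        simp only [hc]
        exact (hK' x).linearMap L
      obtain ⟨t1, c1⟩ := h.coframe_nabla hWt hd
      refine hF.coframe_injective
        (t1.sub (hF.isTangent_curv (h.tangent x) (hT x) (hWt x))) (h.coframe_source hn x).1 ?_
      rw [coframe_sub, c1, hF.coframe_curv (h.tangent x) (hT x) (hWt x), hcQ,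
        (h.adapted x).2.2, lie_ee_mcx, (h.coframe_source hn x).2]
      have e : kap n • ucx (-(v x / kap n * Complex.I) : ℂ).im (-((1 / kap n) • Z x))
          = -ucx (v x) (Z x) := by
        have hv : (-(v x / kap n * Complex.I) : ℂ).im = -(v x / kap n) := by
          simp
        have hkC : (kap n : ℂ) ≠ 0 := by exact_mod_cast hk
        rw [hv, ucx, ucx, cx_smul, cx_neg, cx_inj]
        refine ⟨?_, by simp⟩
        rw [Matrix.fromBlocks_smul, Matrix.fromBlocks_neg]
        congr 1
        · ext i j
          simp
          field_simp
        · simp [smul_smul, hk]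
        · simp [smul_smul, hk]
        · simp
      rw [e]
      have e2 : ∀ A B : Mat n, ⁅-A, B⁆ = -⁅A, B⁆ := fun A B => by simp [Ring.lie_def]; abel
      rw [e2, neg_neg, add_sub_cancel_right]
      rfl

end IsFramed

end Framed

/-! ### The curve flow equation in terms of Hasimoto variables -/

section CurveFlow

variable {n : ℕ} {I : Set ℝ} {γ g W : ℝ → ℝ → Mat n} {v : ℝ → ℝ → ℝ}
  {v₁ v₂ : ℝ → ℝ → CVec n} {K : ℝ → ℝ → CMat n}

theorem IsUnitFlow.inClass (h : IsUnitFlow I γ) {t : ℝ} (ht : t ∈ I) (x : ℝ) :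
    InClass (γ t x) (dx γ t x) := ((h.2 t ht).2 x).2.1

theorem IsHasimoto.isFramed (hn : 3 ≤ n) (hγ : IsUnitFlow I γ) (h : IsHasimoto I γ g v v₁ v₂)
    {t : ℝ} (ht : t ∈ I) : IsFramed (γ t) (g t) (v t) (fun x => zMat (v₁ t x) (v₂ t x)) where
  contDiff := (h.2 t ht).1.1
  adapted x := ((h.2 t ht).1.2 x).1
  tangent x := (hγ.inClass ht x).1
  conn_eq x := by rw [(h.2 t ht).2 x, sqrt_smul_lie_ee_perpMat hn]

theorem Space.transpose_eq {P : Mat n} (h : P ∈ Space n) : Pᵀ = -P := by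
  obtain ⟨g, -, rfl⟩ := h
  simp [Matrix.transpose_mul, J0_transpose, mul_assoc]

theorem Space.mul_self {P : Mat n} (h : P ∈ Space n) : P * P = -1 := by
  obtain ⟨g, hg, rfl⟩ := h
  have hf : IsFrame _ g := ⟨hg, rfl⟩
  simp [mul_assoc, hf.left_inv_mul, J0_mul_J0_mul, hf.right_inv]

/-- The velocity of a curve in `M` is a tangent vector. -/
theorem isTangent_of_hasDerivAt {c : ℝ → Mat n} {c' : Mat n} {s : ℝ}
    (hc : ∀ᶠ y in nhds s, c y ∈ Space n) (hd : HasDerivAt c c' s) : IsTangent (c s) c' := by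
  constructor
  · have h1 : HasDerivAt c (-c'ᵀ) s :=
      hd.matrixTranspose.neg.congr_of_eventuallyEq
        (hc.mono fun y hy => by simp [Space.transpose_eq hy])
    exact neg_eq_iff_eq_neg.1 (h1.unique hd)
  · have h1 := hd.matrixMul hd
    have h2 : HasDerivAt (fun y => c y * c y) 0 s :=
      (hasDerivAt_const s (-1 : Mat n)).congr_of_eventuallyEq
        (hc.mono fun y hy => Space.mul_self hy)
    exact eq_neg_of_add_eq_zero_left (h1.unique h2)

theorem IsUnitFlow.isTangent_dt (hI : IsOpen I) (h : IsUnitFlow I γ) {t : ℝ} (ht : t ∈ I)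
    (x : ℝ) : IsTangent (γ t x) (dt γ t x) :=
  isTangent_of_hasDerivAt (c := fun s => γ s x)
    (Filter.eventually_of_mem (hI.mem_nhds ht) fun s hs => ((h.2 s hs).2 x).1)
    (h.1.hasDerivAt_dt hI ht x)

/-- The velocity of the curve flow in block coordinates. -/
theorem flow_rhs_eq (z₁ z₂ : CVec n) (H : CMat n) :
    (1 / √(chi n)) • (perpMat 0 (Complex.I • z₁) (Complex.I • z₂)
      + parMat 0 (-(2 * Complex.I) • H))
      = kap n • mcx 0 (Complex.I • zMat z₁ z₂) (-(2 * Complex.I) • H) := by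
  have e : zMat (Complex.I • z₁) (Complex.I • z₂) = Complex.I • zMat z₁ z₂ := by
    ext i j; fin_cases i <;> simp [zMat]
  rw [perpMat_eq, parMat_eq, mcx_add, e, kap]
  simp

theorem IsLinked.coframe_eq (h : IsLinked I γ g W K) {t : ℝ} (ht : t ∈ I) (x : ℝ) :
    coframe (γ t x) (g t x) (W t x) = mcx 0 0 ((4 * kap n ^ 3) • (Complex.I • K t x)) := by
  rw [(h t ht x).2, linked_eq]

/-- The right-hand side of the curve flow equation in a parallel frame. -/
theorem coframe_flow_rhs (hn : 3 ≤ n) (hγ : IsUnitFlow I γ) (h : IsHasimoto I γ g v v₁ v₂)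
    (hW : IsLinked I γ g W K) {t : ℝ} (ht : t ∈ I) (x : ℝ) :
    IsTangent (γ t x) (Jmap (γ t x) (dx γ t x) (normal (γ t) x) - (chi n / 2) • W t x) ∧
    coframe (γ t x) (g t x)
        (Jmap (γ t x) (dx γ t x) (normal (γ t) x) - (chi n / 2) • W t x)
      = (1 / √(chi n)) • (perpMat 0 (Complex.I • v₁ t x) (Complex.I • v₂ t x)
            + parMat 0 (-(2 * Complex.I) • K t x)) := by
  have hF := h.isFramed hn hγ ht
  have hA : IsAdapted (γ t x) (dx γ t x) (g t x) := hF.adapted x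
  obtain ⟨hN, cN⟩ := hF.coframe_normal x
  refine ⟨(isTangent_Jmap ⟨_, hA⟩ hN).sub ((hW t ht x).1.smul _), ?_⟩
  rw [coframe_sub, coframe_smul, hA.coframe_Jmap hn hN cN, hW.coframe_eq ht, flow_rhs_eq,
    mcx_smul, mcx_sub, mcx_smul]
  have hk : (chi n : ℂ) * ((kap n : ℂ) * kap n) = 1 := by exact_mod_cast chi_mul_kap hn
  congr 1
  · simp
  · ext i j
    simp
    ring
  · ext i j
    simp
    linear_combination (2 * kap n * Complex.I * K t x i j) * hk

/-- The block matrix of an element of `m`, as a linear map. -/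
def mcxLin (n : ℕ) : ℂ × ZMat n × CMat n →ₗ[ℝ] Mat n where
  toFun p := mcx p.1 p.2.1 p.2.2
  map_add' p q := by simp [mcx_add]
  map_smul' c p := by simp [mcx_smul]

theorem Smooth.const_smul {F : Type*} [NormedAddCommGroup F] [NormedSpace ℝ F] {f : ℝ → ℝ → F}
    (c : ℝ) (hf : Smooth I f) : Smooth I fun t x => c • f t x := ContDiffOn.const_smul c hf

theorem Smooth.add {F : Type*} [NormedAddCommGroup F] [NormedSpace ℝ F] {f₁ f₂ : ℝ → ℝ → F}
    (h₁ : Smooth I f₁) (h₂ : Smooth I f₂) : Smooth I fun t x => f₁ t x + f₂ t x :=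
  ContDiffOn.add h₁ h₂

theorem Smooth.sub {F : Type*} [NormedAddCommGroup F] [NormedSpace ℝ F] {f₁ f₂ : ℝ → ℝ → F}
    (h₁ : Smooth I f₁) (h₂ : Smooth I f₂) : Smooth I fun t x => f₁ t x - f₂ t x :=
  ContDiffOn.sub h₁ h₂

theorem Smooth.const {F : Type*} [NormedAddCommGroup F] [NormedSpace ℝ F] (c : F) :
    Smooth I fun _ _ => c := contDiffOn_const

theorem Smooth.gen {Y : ℝ → ℝ → Mat n} (hγ : Smooth I γ) (hY : Smooth I Y) :
    Smooth I fun t x => gen (γ t x) (Y t x) :=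
  (hY.matrixMul hγ).const_smul _

theorem Smooth.coframe {Y : ℝ → ℝ → Mat n} (hγ : Smooth I γ) (hg : Smooth I g)
    (hY : Smooth I Y) : Smooth I fun t x => coframe (γ t x) (g t x) (Y t x) :=
  (hg.matrixTranspose.matrixMul (hγ.gen hY)).matrixMul hg

theorem Smooth.lie {A B : ℝ → ℝ → Mat n} (hA : Smooth I A) (hB : Smooth I B) :
    Smooth I fun t x => ⁅A t x, B t x⁆ :=
  (hA.matrixMul hB).sub (hB.matrixMul hA)

theorem Smooth.frameVec {ζ : ℝ → ℝ → Mat n} (hg : Smooth I g) (hζ : Smooth I ζ) :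
    Smooth I fun t x => frameVec (g t x) (ζ t x) :=
  (hg.matrixMul (hζ.lie (Smooth.const (J0 n)))).matrixMul hg.matrixTranspose

/-- For vector fields `W` linked to a potential `K`, the curve flow equation says that the velocity
has the components `χ^(-1/2) ((0, (i v₁, i v₂)) + (0, -2 i K))`. -/
theorem isU1CurveFlow_iff (hn : 3 ≤ n) (hI : IsOpen I) (hγ : IsUnitFlow I γ)
    (h : IsHasimoto I γ g v v₁ v₂) (hK : IsPotential I v₁ v₂ K) (hW : IsLinked I γ g W K) :
    IsU1CurveFlow I γ W ↔
        ∀ t ∈ I, ∀ x, coframe (γ t x) (g t x) (dt γ t x) =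
          (1 / √(chi n)) • (perpMat 0 (Complex.I • v₁ t x) (Complex.I • v₂ t x)
            + parMat 0 (-(2 * Complex.I) • K t x)) := by
  constructor
  · rintro ⟨-, -, hflow⟩ t ht x
    rw [(hflow t ht).2 x, (coframe_flow_rhs hn hγ h hW ht x).2]
  · intro hflow
    have hWs : Smooth I W := by
      have h1 : Smooth I fun t x => mcxLin n (0, 0, (4 * kap n ^ 3) • (Complex.I • K t x)) :=
        Smooth.linearMap (mcxLin n) (contDiffOn_const.prodMk (contDiffOn_const.prodMk
          (ContDiffOn.const_smul _ (ContDiffOn.const_smul _ hK.1))))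
      refine (h.1.frameVec h1).congr fun t ht x => ?_
      have hF := ((h.isFramed hn hγ ht).adapted x).isFrame
      rw [← hF.frameVec_coframe (hW t ht x).1, hW.coframe_eq ht]
      rfl
    refine ⟨hγ, hWs, fun t ht => ⟨?_, fun x => ?_⟩⟩
    · refine (h.isFramed hn hγ ht).isOpInv hn (hWs.slice ht) (fun x => (hW t ht x).1)
        (fun x => (hK.2 t ht x).1) (fun x => ?_) (fun x => hW.coframe_eq ht x)
      rw [← wedge_eq, ← (hK.2 t ht x).2]
      exact hK.1.hasDerivAt_dx hI ht x
    · obtain ⟨h1, h2⟩ := coframe_flow_rhs hn hγ h hW ht x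
      exact ((h.isFramed hn hγ ht).adapted x).isFrame.coframe_injective
        (hγ.isTangent_dt hI ht x) h1 ((hflow t ht x).trans h2.symm)

end CurveFlow

/-! ### Rotations driven by linear differential equations -/

section Rotation

variable {n : ℕ} {I : Set ℝ}

theorem eq_of_hasDerivAt_zero {F : Type*} [NormedAddCommGroup F] [NormedSpace ℝ F]
    (hI : IsOpen I) (hIc : I.OrdConnected) {f : ℝ → F} (h : ∀ t ∈ I, HasDerivAt f 0 t)
    {s t : ℝ} (hs : s ∈ I) (ht : t ∈ I) : f t = f s :=
  hI.is_const_of_deriv_eq_zero hIc.isPreconnected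
    (fun x hx => (h x hx).differentiableAt.differentiableWithinAt)
    (fun x hx => (h x hx).deriv) ht hs

/-- The solution of `g' = A g` with skew `A` stays in `SO(2n)`: `gᵀ g` is constant, and the
determinant is a continuous function with values `±1`. -/
theorem mem_SO_of_linear (hI : IsOpen I) (hIc : I.OrdConnected) {g A : ℝ → Mat n}
    (hg : ∀ t ∈ I, HasDerivAt g (A t * g t) t) (hA : ∀ t ∈ I, (A t)ᵀ = -A t) {s t : ℝ}
    (hs : s ∈ I) (ht : t ∈ I) (hgs : g s ∈ SO n) : g t ∈ SO n := by
  have h1 : ∀ r ∈ I, (g r)ᵀ * g r = 1 := fun r hr => by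
    rw [← SO_transpose_mul hgs]
    refine eq_of_hasDerivAt_zero hI hIc (f := fun r => (g r)ᵀ * g r) (fun y hy => ?_) hs hr
    have := (hg y hy).matrixTranspose.matrixMul (hg y hy)
    refine this.congr_deriv ?_
    rw [Matrix.transpose_mul, hA y hy]
    noncomm_ring
  have hdet : ∀ r ∈ I, (g r).det * (g r).det = 1 := fun r hr => by
    have := congrArg Matrix.det (h1 r hr)
    simpa using this
  have hc : ContinuousOn (fun r => (g r).det) I := fun r hr =>
    (ContinuousAt.comp (g := Matrix.det) (continuous_id.matrix_det).continuousAt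
      (hg r hr).continuousAt).continuousWithinAt
  have hs1 : (g s).det = 1 := (Matrix.mem_specialOrthogonalGroup_iff.1 hgs).2
  refine Matrix.mem_specialOrthogonalGroup_iff.2
    ⟨(Matrix.mem_orthogonalGroup_iff' _ _).2 (h1 t ht), ?_⟩
  rcases mul_self_eq_one_iff.1 (hdet t ht) with h | h
  · exact h
  · have h0 : (0 : ℝ) ∈ (fun r => (g r).det) '' I :=
      (hIc.isPreconnected.image _ hc).Icc_subset ⟨t, ht, rfl⟩ ⟨s, hs, rfl⟩
        (by simp [h, hs1])
    obtain ⟨r, hr, hr0⟩ := h0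
    have h2 := hdet r hr
    rw [show (g r).det = 0 from hr0] at h2
    simp at h2

/-- The solution of `g' = A g` with skew `A` transports solutions of `M' = [A, M]`. -/
theorem conj_eq_of_linear (hI : IsOpen I) (hIc : I.OrdConnected) {g A M : ℝ → Mat n}
    (hg : ∀ t ∈ I, HasDerivAt g (A t * g t) t) (hA : ∀ t ∈ I, (A t)ᵀ = -A t)
    (hM : ∀ t ∈ I, HasDerivAt M ⁅A t, M t⁆ t) {s t : ℝ} (hs : s ∈ I) (ht : t ∈ I) :
    (g t)ᵀ * M t * g t = (g s)ᵀ * M s * g s := by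
  refine eq_of_hasDerivAt_zero hI hIc (f := fun r => (g r)ᵀ * M r * g r) (fun y hy => ?_) hs ht
  have := ((hg y hy).matrixTranspose.matrixMul (hM y hy)).matrixMul (hg y hy)
  refine this.congr_deriv ?_
  rw [Matrix.transpose_mul, hA y hy, Ring.lie_def]
  noncomm_ring

end Rotation

/-! ### The infinitesimal rotation of a moving adapted frame -/

section MovingPair

variable {n : ℕ} {P ξ : Mat n}

/-- The solution `L ∈ h_⊥` of `[L, ξ] = D`, for `ξ` in the class of `e` and `D ∈ m_⊥`: since
`ad(ξ)²` has the eigenvalues `-4/χ` and `-1/χ` on `m_⊥`, it is a polynomial in `ad(ξ)`. -/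
def rotLift (ξ D : Mat n) : Mat n :=
  (chi n ^ 2 / 4) • ⁅ξ, ⁅ξ, ⁅ξ, D⁆⁆⁆ + (5 * chi n / 4) • ⁅ξ, D⁆

theorem ucx_smul (c b : ℝ) (Z : ZMat n) : c • ucx b Z = ucx (c * b) (c • Z) := by
  simp only [ucx, cx_smul, Matrix.fromBlocks_smul]
  congr 2
  · ext i j
    simp
    ring
  · simp
  · simp
  · simp
  · simp

theorem ucx_add (b b' : ℝ) (Z Z' : ZMat n) : ucx b Z + ucx b' Z' = ucx (b + b') (Z + Z') := by
  simp only [ucx, cx_add, Matrix.fromBlocks_add]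
  congr 2
  · ext i j
    simp
    ring
  · simp [Matrix.mul_add]
  · simp [Matrix.add_mul]
  · simp
  · simp

theorem mat_add_lie (A B C : Mat n) : ⁅A + B, C⁆ = ⁅A, C⁆ + ⁅B, C⁆ := by
  simp only [Ring.lie_def]
  noncomm_ring

/-- The coefficients of `rotLift` interpolate the inverse of `ad(ξ)` from `h_⊥` to `m_⊥`. -/
theorem rotLift_ee (hn : 3 ≤ n) (b : ℝ) (Z : ZMat n) :
    rotLift (ee n) (mcx (b * Complex.I) Z 0) = ucx (√(chi n) * b / 4) (√(chi n) • Z) := by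
  have h1 : ∀ (r : ℝ) (A B : Mat n), ⁅A, r • B⁆ = r • ⁅A, B⁆ := fun r A B => by
    simp [Ring.lie_def, smul_sub]
  have hs := kap_mul_sqrt hn
  have hχ := Real.mul_self_sqrt (chi_pos hn).le
  set s := √(chi n)
  have e1 : (-(4 * b * Complex.I) : ℂ).im = -(4 * b) := by simp
  have e2 : ((b : ℂ) * Complex.I).im = b := by simp
  rw [rotLift, lie_ee_mcx, e2, h1, h1, lie_ee_ucx, ← smul_neg, h1, mcx_neg, neg_zero, lie_ee_mcx,
    e1, ← hχ]
  simp only [ucx_smul, ucx_add]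
  congr 1
  · linear_combination (5 * s * b / 4 - b * s * (s * s * (kap n * kap n) + s * kap n + 1)) * hs
  · ext i j
    have hsC : (s : ℂ) * kap n = 1 := by exact_mod_cast hs
    simp
    linear_combination (5 * s * Z i j / 4 - Z i j / 4 * s *
      (s * s * (kap n * kap n) + s * kap n + 1)) * hsC

theorem IsFrame.rotLift_conj {g : Mat n} (h : IsFrame P g) (A B : Mat n) :
    rotLift (g * A * gᵀ) (g * B * gᵀ) = g * rotLift A B * gᵀ := by
  simp [rotLift, h.conj_lie, mul_add, add_mul]

/-- An infinitesimal variation `D ∈ m` of `e` inside its class lies in `m_⊥`. -/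
theorem IsM.eq_mcx_of_cubic (hn : 3 ≤ n) {D : Mat n} (hD : IsM D)
    (h : D * ee n * ee n + ee n * D * ee n + ee n * ee n * D = -(kap n * kap n) • D) :
    ∃ (b : ℝ) (Z : ZMat n), D = mcx (b * Complex.I) Z 0 := by
  obtain ⟨a, Z, H, hH, rfl⟩ := isM_iff_mcx.1 hD
  have hk := (kap_pos hn).ne'
  have hkC : (kap n : ℂ) ≠ 0 := by exact_mod_cast hk
  rw [ee_eq, mcx_smul] at h
  simp [mcx, cx_mul, cx_add, cx_inj, Matrix.fromBlocks_multiply,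
    Matrix.fromBlocks_add, Matrix.fromBlocks_inj] at h
  obtain ⟨h1, -, -, h2⟩ := h
  refine ⟨a.im, Z, mcx_inj.2 ⟨?_, rfl, ?_⟩⟩
  · have := congrFun (congrFun h1 0) 1
    simp [eps] at this
    have h3 : (kap n * kap n : ℂ) * (a + (starRingEnd ℂ) a) = 0 := by
      linear_combination -this
    have h4 : a + (starRingEnd ℂ) a = 0 := by simpa [hkC] using h3
    apply Complex.ext
    · have := congrArg Complex.re h4
      simp at this
      simp
      linarith
    · simp
  · simpa [hk] using h2

/-- Conjugation of an infinitesimal variation of the pair `(P, ξ)`. -/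
theorem anticomm_of_variation {P' ξ' η : Mat n} (h : ξ * P = -(P * ξ))
    (h1 : ξ' * P + ξ * P' = -(P' * ξ + P * ξ')) (h2 : P' = η * P - P * η) :
    (ξ' - ⁅η, ξ⁆) * P = -(P * (ξ' - ⁅η, ξ⁆)) := by
  subst h2
  have h3 : ξ' * P + P * ξ' = -(ξ * (η * P - P * η)) - (η * P - P * η) * ξ := by
    rw [← sub_eq_zero] at h1 ⊢
    rw [← h1]
    noncomm_ring
  have h4 : ξ * P + P * ξ = 0 := by rw [h, neg_add_cancel]
  rw [← sub_eq_zero]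
  calc _ = (ξ' * P + P * ξ') - (η * ξ - ξ * η) * P - P * (η * ξ - ξ * η) := by
        rw [Ring.lie_def]; noncomm_ring
    _ = (ξ * P + P * ξ) * η - η * (ξ * P + P * ξ) := by rw [h3]; noncomm_ring
    _ = 0 := by rw [h4, zero_mul, mul_zero, sub_zero]

/-- The linearization of `ξ³ = c ξ` is invariant under infinitesimal conjugation. -/
theorem cubic_of_variation {ξ' η : Mat n} {c : ℝ} (h : ξ * ξ * ξ = c • ξ)
    (h1 : ξ' * ξ * ξ + ξ * ξ' * ξ + ξ * ξ * ξ' = c • ξ') :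
    (ξ' - ⁅η, ξ⁆) * ξ * ξ + ξ * (ξ' - ⁅η, ξ⁆) * ξ + ξ * ξ * (ξ' - ⁅η, ξ⁆)
      = c • (ξ' - ⁅η, ξ⁆) := by
  calc _ = (ξ' * ξ * ξ + ξ * ξ' * ξ + ξ * ξ * ξ') - (η * (ξ * ξ * ξ) - ξ * ξ * ξ * η) := by
        rw [Ring.lie_def]; noncomm_ring
    _ = _ := by rw [h1, h, Ring.lie_def]; simp [smul_sub]

/-- The cubic equation of `e`, whose linearization characterizes `m_⊥`. -/
theorem ee_cube (n : ℕ) : ee n * ee n * ee n = -(kap n * kap n) • ee n := by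
  rw [ee_eq, mcx_smul]
  simp [mcx, cx_mul, cx_inj, Matrix.fromBlocks_multiply, Matrix.fromBlocks_inj]
  ext i j
  simp
  ring

/-- The infinitesimal rotation of a moving pair `(P, ξ)`, `ξ` in the class of `e`, with velocity
`(P', ξ')`: the transvection along `P'` corrected by the rotation of `ξ` in `h_⊥`. -/
def rotGen (P ξ P' ξ' : Mat n) : Mat n := gen P P' + rotLift ξ (ξ' - ⁅gen P P', ξ⁆)

/-- In an adapted frame, the covariant derivative of `ξ` lies in `m_⊥`. -/
theorem exists_covDeriv_eq (hn : 3 ≤ n) {P ξ : ℝ → Mat n} {P' ξ' g : Mat n} {s : ℝ}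
    (hP : HasDerivAt P P' s) (hξ : HasDerivAt ξ ξ' s)
    (hf : ∀ᶠ y in nhds s, ∃ k, IsFrame (P y) k ∧ ξ y = k * ee n * kᵀ)
    (hg : IsFrame (P s) g) (hξg : ξ s = g * ee n * gᵀ) :
    ∃ (b : ℝ) (Z : ZMat n),
      ξ' - ⁅gen (P s) P', ξ s⁆ = g * mcx (b * Complex.I) Z 0 * gᵀ := by
  have hT : IsTangent (P s) P' :=
    isTangent_of_hasDerivAt (hf.mono fun y ⟨k, hk, _⟩ => ⟨k, hk⟩) hP
  set η := gen (P s) P' with hη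
  have hηg : η = g * coframe (P s) g P' * gᵀ := hg.gen_eq P'
  have hζ := hg.isM_coframe hT
  have hPη : P' = η * P s - P s * η := by
    have := hg.frameVec_coframe hT
    rw [← hg.vec_eq, ← hηg] at this
    exact this.symm
  have hηs : ηᵀ = -η := by
    rw [hηg]
    simp [Matrix.transpose_mul, hζ.1, mul_assoc]
  have hes := (isM_ee n).1
  have hskew : ∀ᶠ y in nhds s, (ξ y)ᵀ = -ξ y := hf.mono fun y ⟨k, hk, e⟩ => by
    rw [e]
    simp [Matrix.transpose_mul, hes, mul_assoc]
  have hanti : ∀ᶠ y in nhds s, ξ y * P y = -(P y * ξ y) := hf.mono fun y ⟨k, hk, e⟩ => by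
    rw [e, hk.2]
    simp only [mul_assoc, hk.left_inv_mul]
    rw [← mul_assoc (ee n), (isM_ee n).2]
    simp [mul_assoc]
  have hcube : ∀ᶠ y in nhds s, ξ y * ξ y * ξ y = -(kap n * kap n) • ξ y :=
    hf.mono fun y ⟨k, hk, e⟩ => by
      have e3 := ee_cube n
      rw [e]
      calc _ = k * (ee n * ee n * ee n) * kᵀ := by
            simp only [mul_assoc, hk.left_inv_mul]
        _ = _ := by rw [e3]; simp
  have hξs : ξ'ᵀ = -ξ' := hξ.matrixTranspose.unique (hξ.neg.congr_of_eventuallyEq hskew)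
  have h1 : ξ' * P s + ξ s * P' = -(P' * ξ s + P s * ξ') :=
    (hξ.matrixMul hP).unique (((hP.matrixMul hξ).neg).congr_of_eventuallyEq hanti)
  have h3 : ξ' * ξ s * ξ s + ξ s * ξ' * ξ s + ξ s * ξ s * ξ' = -(kap n * kap n) • ξ' := by
    have := ((hξ.matrixMul hξ).matrixMul hξ).unique
      ((hξ.const_smul (-(kap n * kap n))).congr_of_eventuallyEq hcube)
    rw [← this]
    noncomm_ring
  have hD1 := anticomm_of_variation hanti.self_of_nhds h1 hPη
  have hD2 := cubic_of_variation (η := η) hcube.self_of_nhds h3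
  have hDs : (ξ' - ⁅η, ξ s⁆)ᵀ = -(ξ' - ⁅η, ξ s⁆) := by
    rw [Ring.lie_def]
    simp only [Matrix.transpose_sub, Matrix.transpose_mul, hηs, hξs, hskew.self_of_nhds]
    noncomm_ring
  generalize ξ' - ⁅η, ξ s⁆ = D at *
  have hM : IsM (gᵀ * D * g) := by
    constructor
    · simp [Matrix.transpose_mul, hDs, mul_assoc]
    · have := congrArg (fun Y => gᵀ * Y * g) hD1
      simp only [hg.2, mul_assoc, hg.left_inv, mul_one, mul_neg, neg_mul, hg.left_inv_mul] at this
      simpa only [mul_assoc] using this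
  have hcub : (gᵀ * D * g) * ee n * ee n + ee n * (gᵀ * D * g) * ee n
      + ee n * ee n * (gᵀ * D * g) = -(kap n * kap n) • (gᵀ * D * g) := by
    have := congrArg (fun Y => gᵀ * Y * g) hD2
    simp only [hξg, mul_assoc, hg.left_inv, mul_one, hg.left_inv_mul, add_mul, mul_add,
      smul_mul_assoc, mul_smul_comm] at this
    simpa only [mul_assoc] using this
  obtain ⟨b, Z, h⟩ := hM.eq_mcx_of_cubic hn hcub
  refine ⟨b, Z, ?_⟩
  rw [← h]
  simp only [mul_assoc, hg.right_inv, hg.right_inv_mul, mul_one]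

/-- In a frame, the infinitesimal rotation is the sum of the coframe in `m` and a connection in
`h_⊥`. -/
theorem IsFrame.rotGen_eq (hn : 3 ≤ n) {ξ P' ξ' g : Mat n} (hg : IsFrame P g)
    (hξg : ξ = g * ee n * gᵀ) {b : ℝ} {Z : ZMat n}
    (h : ξ' - ⁅gen P P', ξ⁆ = g * mcx (b * Complex.I) Z 0 * gᵀ) :
    rotGen P ξ P' ξ'
      = g * (coframe P g P' + ucx (√(chi n) * b / 4) (√(chi n) • Z)) * gᵀ := by
  rw [rotGen, h, hξg, hg.rotLift_conj, rotLift_ee hn, hg.gen_eq, mul_add, add_mul]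

/-- The infinitesimal rotation is skew and moves the pair `(P, ξ)` with its velocity. -/
theorem IsFrame.rotGen_spec (hn : 3 ≤ n) {ξ P' ξ' g : Mat n} (hg : IsFrame P g)
    (hξg : ξ = g * ee n * gᵀ) {b : ℝ} {Z : ZMat n}
    (h : ξ' - ⁅gen P P', ξ⁆ = g * mcx (b * Complex.I) Z 0 * gᵀ) (hT : IsTangent P P') :
    (rotGen P ξ P' ξ')ᵀ = -rotGen P ξ P' ξ' ∧ ⁅rotGen P ξ P' ξ', P⁆ = P' ∧
      ⁅rotGen P ξ P' ξ', ξ⁆ = ξ' := by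
  have hζ := hg.isM_coframe hT
  have hu := isH_ucx (√(chi n) * b / 4) (√(chi n) • Z)
  have hP' : P' = ⁅gen P P', P⁆ := by
    have := hg.frameVec_coframe hT
    rw [← hg.vec_eq, ← hg.gen_eq] at this
    exact this.symm
  have e := hg.rotGen_eq hn hξg h
  refine ⟨?_, ?_, ?_⟩
  · rw [e]
    simp only [Matrix.transpose_mul, Matrix.transpose_add, hζ.1, hu.1, Matrix.transpose_transpose]
    noncomm_ring
  · rw [e, mul_add, add_mul, ← hg.gen_eq, mat_add_lie, ← hP']
    rw [hg.2, hg.conj_lie _ (J0 n), Ring.lie_def, hu.2]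
    simp
  · have hs : √(chi n) * kap n = 1 := kap_mul_sqrt hn
    have hsC : (√(chi n) : ℂ) * kap n = 1 := by exact_mod_cast hs
    have e1 : ⁅ucx (√(chi n) * b / 4) (√(chi n) • Z), ee n⁆ = mcx (b * Complex.I) Z 0 := by
      rw [lie_ucx_ee, mcx_smul, smul_smul, mul_comm (kap n), hs]
      congr 1
      · push_cast
        linear_combination b * Complex.I * hsC
      · simp
      · simp
    rw [e, mul_add, add_mul, ← hg.gen_eq, mat_add_lie]
    nth_rewrite 2 [hξg]
    rw [hg.conj_lie _ (ee n), e1, ← h]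
    abel

end MovingPair

/-! ### Existence of parallel frames -/

section BilinearODE

variable {E F : Type*} [NormedAddCommGroup E] [NormedSpace ℝ E] [FiniteDimensional ℝ E]
  [NormedAddCommGroup F] [NormedSpace ℝ F] [FiniteDimensional ℝ F]

/-- `exists_linear_flow` for equations `X_x = L(M, X)` in finite dimension, with `L` bilinear. -/
theorem exists_bilinear_flow (L : F →ₗ[ℝ] E →ₗ[ℝ] E) {I : Set ℝ} (hI : IsOpen I)
    (hIc : I.OrdConnected) {M : ℝ → ℝ → F} {b : ℝ → E} (hM : Smooth I M)
    (hb : ContDiffOn ℝ ∞ b I) :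
    ∃ X : ℝ → ℝ → E, Smooth I X ∧ (∀ t ∈ I, X t 0 = b t) ∧
      ∀ t ∈ I, ∀ x, HasDerivAt (X t) (L (M t x) (X t x)) x := by
  have := FiniteDimensional.complete ℝ E
  exact exists_linear_flow hI hIc (A := fun t x => L.toContinuousBilinearMap (M t x))
    (L.toContinuousBilinearMap.contDiff.comp_contDiffOn hM) hb

/-- `exists_linear_curve` for equations `X_t = L(M, X)` in finite dimension, with `L` bilinear. -/
theorem exists_bilinear_curve (L : F →ₗ[ℝ] E →ₗ[ℝ] E) {I : Set ℝ} (hI : IsOpen I)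
    (hIc : I.OrdConnected) {M : ℝ → F} (hM : ContDiffOn ℝ ∞ M I) {t₀ : ℝ} (ht₀ : t₀ ∈ I)
    (b : E) :
    ∃ X : ℝ → E, ContDiffOn ℝ ∞ X I ∧ X t₀ = b ∧
      ∀ t ∈ I, HasDerivAt X (L (M t) (X t)) t := by
  have := FiniteDimensional.complete ℝ E
  exact exists_linear_curve hI hIc (A := fun t => L.toContinuousBilinearMap (M t))
    (L.toContinuousBilinearMap.contDiff.comp_contDiffOn hM) ht₀ b

end BilinearODE

section ParallelFrame

variable {n : ℕ} {I : Set ℝ} {γ g : ℝ → ℝ → Mat n}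

theorem IsAdapted.gen_eq {P X g : Mat n} (h : IsAdapted P X g) : gen P X = g * ee n * gᵀ := by
  rw [h.isFrame.gen_eq, h.2.2]

theorem Smooth.rotLift {ξ D : ℝ → ℝ → Mat n} (hξ : Smooth I ξ) (hD : Smooth I D) :
    Smooth I fun t x => rotLift (ξ t x) (D t x) :=
  ((hξ.lie (hξ.lie (hξ.lie hD))).const_smul _).add ((hξ.lie hD).const_smul _)

theorem Smooth.rotGen {P ξ P' ξ' : ℝ → ℝ → Mat n} (hP : Smooth I P) (hξ : Smooth I ξ)
    (hP' : Smooth I P') (hξ' : Smooth I ξ') :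
    Smooth I fun t x => rotGen (P t x) (ξ t x) (P' t x) (ξ' t x) :=
  (hP.gen hP').add (hξ.rotLift (hξ'.sub ((hP.gen hP').lie hξ)))

/-- The element of `so(2n)` corresponding to the tangent vector of the flow. -/
def tangentGen (γ : ℝ → ℝ → Mat n) (t x : ℝ) : Mat n := gen (γ t x) (dx γ t x)

theorem Smooth.tangentGen (hI : IsOpen I) (hγ : Smooth I γ) : Smooth I (tangentGen γ) :=
  hγ.gen (hγ.dx hI)

theorem IsUnitFlow.exists_isFrame (hγ : IsUnitFlow I γ) {t : ℝ} (ht : t ∈ I) (x : ℝ) :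
    ∃ k, IsFrame (γ t x) k ∧ tangentGen γ t x = k * ee n * kᵀ := by
  obtain ⟨-, k, hk⟩ := hγ.inClass ht x
  exact ⟨k, hk.isFrame, hk.gen_eq⟩

theorem isAdapted_of_conj {P X g : Mat n} (hg : g ∈ SO n) (h1 : gᵀ * P * g = J0 n)
    (h2 : gᵀ * gen P X * g = ee n) : IsAdapted P X g := by
  refine ⟨hg, ?_, h2⟩
  have h := SO_mul_transpose hg
  calc P = (g * gᵀ) * P * (g * gᵀ) := by rw [h, one_mul, mul_one]
    _ = g * (gᵀ * P * g) * gᵀ := by simp only [mul_assoc]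
    _ = _ := by rw [h1]

/-- The covariant derivative of the tangent vector of the flow, in `x` direction. -/
theorem IsUnitFlow.exists_covDeriv_dx (hn : 3 ≤ n) (hI : IsOpen I) (hγ : IsUnitFlow I γ) {t : ℝ}
    (ht : t ∈ I) (x : ℝ) {g : Mat n} (hg : IsAdapted (γ t x) (dx γ t x) g) :
    ∃ (b : ℝ) (Z : ZMat n), dx (tangentGen γ) t x - ⁅gen (γ t x) (dx γ t x), tangentGen γ t x⁆
      = g * mcx (b * Complex.I) Z 0 * gᵀ :=
  exists_covDeriv_eq hn (P := γ t) (ξ := tangentGen γ t) (hγ.1.hasDerivAt_dx hI ht x)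
    ((hγ.1.tangentGen hI).hasDerivAt_dx hI ht x)
    (Filter.Eventually.of_forall fun y => hγ.exists_isFrame ht y) hg.isFrame hg.gen_eq

/-- The covariant derivative of the tangent vector of the flow, in `t` direction. -/
theorem IsUnitFlow.exists_covDeriv_dt (hn : 3 ≤ n) (hI : IsOpen I) (hγ : IsUnitFlow I γ) {t : ℝ}
    (ht : t ∈ I) (x : ℝ) {g : Mat n} (hg : IsAdapted (γ t x) (dx γ t x) g) :
    ∃ (b : ℝ) (Z : ZMat n), dt (tangentGen γ) t x - ⁅gen (γ t x) (dt γ t x), tangentGen γ t x⁆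
      = g * mcx (b * Complex.I) Z 0 * gᵀ :=
  exists_covDeriv_eq hn (P := fun s => γ s x) (ξ := fun s => tangentGen γ s x)
    (hγ.1.hasDerivAt_dt hI ht x) ((hγ.1.tangentGen hI).hasDerivAt_dt hI ht x)
    (Filter.eventually_of_mem (hI.mem_nhds ht) fun _ hs => hγ.exists_isFrame hs x)
    hg.isFrame hg.gen_eq

/-- A smooth adapted frame along the flow, whose connection in `x` direction lies in `h_⊥`, and
whose connection in `t` direction along `x = 0` has a prescribed component `C` in `h_∥`. -/
theorem IsUnitFlow.exists_frame (hn : 3 ≤ n) (hI : IsOpen I) (hIc : I.OrdConnected)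
    (hγ : IsUnitFlow I γ) {C : ℝ → Mat n} (hC : ContDiffOn ℝ ∞ C I)
    (hCs : ∀ t ∈ I, (C t)ᵀ = -C t) (hCP : ∀ t ∈ I, ⁅C t, γ t 0⁆ = 0)
    (hCξ : ∀ t ∈ I, ⁅C t, tangentGen γ t 0⁆ = 0) :
    ∃ g : ℝ → ℝ → Mat n, Smooth I g ∧
      (∀ t ∈ I, ∀ x, IsAdapted (γ t x) (dx γ t x) (g t x)) ∧
      (∀ t ∈ I, ∀ x, dx g t x
        = rotGen (γ t x) (tangentGen γ t x) (dx γ t x) (dx (tangentGen γ) t x) * g t x) ∧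
      ∀ t ∈ I, dt g t 0
        = (rotGen (γ t 0) (tangentGen γ t 0) (dt γ t 0) (dt (tangentGen γ) t 0) + C t)
          * g t 0 := by
  rcases I.eq_empty_or_nonempty with rfl | ⟨t₀, ht₀⟩
  · exact ⟨0, contDiffOn_const, by simp, by simp, by simp⟩
  have hξ := hγ.1.tangentGen hI
  have hA : Smooth I fun t x =>
      rotGen (γ t x) (tangentGen γ t x) (dx γ t x) (dx (tangentGen γ) t x) :=
    hγ.1.rotGen hξ (hγ.1.dx hI) (hξ.dx hI)
  have hB : Smooth I fun t x =>
      rotGen (γ t x) (tangentGen γ t x) (dt γ t x) (dt (tangentGen γ) t x) + C t :=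
    (hγ.1.rotGen hξ (hγ.1.dt hI) (hξ.dt hI)).add (Smooth.of_left hC)
  have hAspec : ∀ t ∈ I, ∀ x,
      (rotGen (γ t x) (tangentGen γ t x) (dx γ t x) (dx (tangentGen γ) t x))ᵀ
        = -rotGen (γ t x) (tangentGen γ t x) (dx γ t x) (dx (tangentGen γ) t x) ∧
      ⁅rotGen (γ t x) (tangentGen γ t x) (dx γ t x) (dx (tangentGen γ) t x), γ t x⁆
        = dx γ t x ∧
      ⁅rotGen (γ t x) (tangentGen γ t x) (dx γ t x) (dx (tangentGen γ) t x), tangentGen γ t x⁆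
        = dx (tangentGen γ) t x := fun t ht x => by
    obtain ⟨hT, k, hk⟩ := hγ.inClass ht x
    obtain ⟨b, Z, h⟩ := hγ.exists_covDeriv_dx hn hI ht x hk
    exact hk.isFrame.rotGen_spec hn hk.gen_eq h hT
  have hBspec : ∀ t ∈ I,
      (rotGen (γ t 0) (tangentGen γ t 0) (dt γ t 0) (dt (tangentGen γ) t 0))ᵀ
        = -rotGen (γ t 0) (tangentGen γ t 0) (dt γ t 0) (dt (tangentGen γ) t 0) ∧
      ⁅rotGen (γ t 0) (tangentGen γ t 0) (dt γ t 0) (dt (tangentGen γ) t 0), γ t 0⁆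
        = dt γ t 0 ∧
      ⁅rotGen (γ t 0) (tangentGen γ t 0) (dt γ t 0) (dt (tangentGen γ) t 0), tangentGen γ t 0⁆
        = dt (tangentGen γ) t 0 := fun t ht => by
    obtain ⟨-, k, hk⟩ := hγ.inClass ht 0
    obtain ⟨b, Z, h⟩ := hγ.exists_covDeriv_dt hn hI ht 0 hk
    exact hk.isFrame.rotGen_spec hn hk.gen_eq h (hγ.isTangent_dt hI ht 0)
  set A : ℝ → ℝ → Mat n := fun t x =>
      rotGen (γ t x) (tangentGen γ t x) (dx γ t x) (dx (tangentGen γ) t x) with hAdef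
  set B : ℝ → Mat n := fun t =>
      rotGen (γ t 0) (tangentGen γ t 0) (dt γ t 0) (dt (tangentGen γ) t 0) with hBdef
  obtain ⟨-, k, hk⟩ := hγ.inClass ht₀ 0
  -- the frame along the line `x = 0`
  obtain ⟨b, hb, hb0, hbd⟩ := exists_bilinear_curve (LinearMap.mul ℝ (Mat n)) hI hIc
    (hB.slice_left 0) ht₀ k
  have hbd : ∀ t ∈ I, HasDerivAt b ((B t + C t) * b t) t := hbd
  have hBs : ∀ t ∈ I, (B t + C t)ᵀ = -(B t + C t) := fun t ht => by
    rw [Matrix.transpose_add, (hBspec t ht).1, hCs t ht, neg_add]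
  have hbad : ∀ t ∈ I, IsAdapted (γ t 0) (dx γ t 0) (b t) := fun t ht => by
    refine isAdapted_of_conj
      (mem_SO_of_linear hI hIc hbd hBs ht₀ ht (hb0 ▸ hk.1)) ?_ ?_
    · refine (conj_eq_of_linear hI hIc (M := fun t => γ t 0) hbd hBs (fun s hs => ?_)
        ht₀ ht).trans ?_
      · rw [mat_add_lie, (hBspec s hs).2.1, hCP s hs, add_zero]
        exact hγ.1.hasDerivAt_dt hI hs 0
      · simp only [hb0, hk.2.1, mul_assoc, hk.isFrame.left_inv_mul, hk.isFrame.left_inv, mul_one]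
    · refine (conj_eq_of_linear hI hIc (M := fun t => tangentGen γ t 0) hbd hBs (fun s hs => ?_)
        ht₀ ht).trans ?_
      · rw [mat_add_lie, (hBspec s hs).2.2, hCξ s hs, add_zero]
        exact hξ.hasDerivAt_dt hI hs 0
      · rw [hb0]
        exact hk.2.2
  -- the frame along the curves
  obtain ⟨g, hg, hg0, hgd⟩ := exists_bilinear_flow (LinearMap.mul ℝ (Mat n)) hI hIc hA hb
  have hgd : ∀ t ∈ I, ∀ x, HasDerivAt (g t) (A t x * g t x) x := hgd
  refine ⟨g, hg, fun t ht x => ?_, fun t ht x => (hgd t ht x).deriv, fun t ht => ?_⟩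
  · have h0 := hbad t ht
    have hAs : ∀ x ∈ Set.univ, (A t x)ᵀ = -A t x := fun x _ => (hAspec t ht x).1
    have hgd' : ∀ x ∈ Set.univ, HasDerivAt (g t) (A t x * g t x) x := fun x _ => hgd t ht x
    refine isAdapted_of_conj (mem_SO_of_linear isOpen_univ Set.ordConnected_univ hgd' hAs
      (Set.mem_univ 0) (Set.mem_univ x) (hg0 t ht ▸ h0.1)) ?_ ?_
    · refine (conj_eq_of_linear isOpen_univ Set.ordConnected_univ (M := γ t) hgd' hAs
        (fun y _ => ?_) (Set.mem_univ 0) (Set.mem_univ x)).trans ?_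
      · rw [(hAspec t ht y).2.1]
        exact hγ.1.hasDerivAt_dx hI ht y
      · simp only [hg0 t ht, h0.2.1, mul_assoc, h0.isFrame.left_inv_mul, h0.isFrame.left_inv,
          mul_one]
    · refine (conj_eq_of_linear isOpen_univ Set.ordConnected_univ (M := tangentGen γ t) hgd' hAs
        (fun y _ => ?_) (Set.mem_univ 0) (Set.mem_univ x)).trans ?_
      · rw [(hAspec t ht y).2.2]
        exact hξ.hasDerivAt_dx hI ht y
      · rw [hg0 t ht]
        exact h0.2.2
  · have h1 : HasDerivAt (fun s => g s 0) ((B t + C t) * b t) t :=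
      (hbd t ht).congr_of_eventuallyEq
        (Filter.eventually_of_mem (hI.mem_nhds ht) fun s hs => hg0 s hs)
    rw [hg0 t ht]
    exact h1.deriv

/-! ### Hasimoto variables -/

/-- The variable `v`, read off from `u = √χ ad(e) (v, (v₁, v₂))`. -/
def readV (n : ℕ) : Mat n →ₗ[ℝ] ℝ where
  toFun X := (clin n X (.inl 0) (.inl 0)).im / 2
  map_add' X Y := by simp; ring
  map_smul' c X := by simp; ring

/-- The variable `v₁`, read off from `u = √χ ad(e) (v, (v₁, v₂))`. -/
def readV₁ (n : ℕ) : Mat n →ₗ[ℝ] CVec n where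
  toFun X j := -star (clin n X (.inl 1) (.inr j))
  map_add' X Y := by ext j; simp; ring
  map_smul' c X := by ext j; simp

/-- The variable `v₂`, read off from `u = √χ ad(e) (v, (v₁, v₂))`. -/
def readV₂ (n : ℕ) : Mat n →ₗ[ℝ] CVec n where
  toFun X j := star (clin n X (.inl 0) (.inr j))
  map_add' X Y := by ext j; simp
  map_smul' c X := by ext j; simp

theorem clin_hPart (X : Mat n) : clin n (hPart X) = clin n X := by
  rw [← cx_clin_alin X, hPart_cx, clin_cx, clin_cx]

/-- `readV`, `readV₁`, `readV₂` recover the Hasimoto variables. -/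
theorem readV_eq {X : Mat n} {b : ℝ} {Z : ZMat n} (h : hPart X = ucx b Z) :
    readV n X = b ∧ zMat (readV₁ n X) (readV₂ n X) = Z := by
  have e : clin n X = Matrix.fromBlocks ((2 * b * Complex.I) • 1) (eps * cj Z) (Zᵀ * eps) 0 := by
    rw [← clin_hPart, h, ucx, clin_cx]
  constructor
  · simp [readV, e]
  · ext i j
    fin_cases i <;> simp [readV₁, readV₂, zMat, e, eps, cj, Matrix.vecMul, dotProduct]

theorem zMat_surjective (Z : ZMat n) : ∃ z₁ z₂, Z = zMat z₁ z₂ :=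
  ⟨Z 0, Z 1, by ext i j; fin_cases i <;> rfl⟩

/-- `h_⊥ = ad(e) m_⊥` is orthogonal to the centralizer of `e`. -/
theorem ucx_mem_hPerp (hn : 3 ≤ n) (b : ℝ) (Z : ZMat n) : ucx b Z ∈ hPerp n := by
  refine ⟨(isH_ucx b Z).1, (isH_ucx b Z).2, fun B hB => ?_⟩
  obtain ⟨z₁, z₂, rfl⟩ := zMat_surjective Z
  have e : ∀ (r : ℝ) (A B : Mat n), killing (r • A) B = r * killing A B := fun r A B => by
    simp [killing]; ring
  have e0 : ∀ A : Mat n, killing A 0 = 0 := fun A => by simp [killing]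
  have e1 : ∀ A B : Mat n, killing (-A) B = -killing A B := fun A B => by simp [killing]
  rw [← sqrt_smul_lie_ee_perpMat hn, e, lie_swap, e1, killing_lie, lie_swap, hB.2.2, neg_zero, e0]
  simp

/-- A smooth adapted frame whose connection takes values in `h_⊥` is `U(n)`-parallel, with smooth
Hasimoto variables. -/
theorem exists_isHasimoto (hn : 3 ≤ n) (hI : IsOpen I) (hg : Smooth I g)
    (hA : ∀ t ∈ I, ∀ x, IsAdapted (γ t x) (dx γ t x) (g t x))
    (hu : ∀ t ∈ I, ∀ x, ∃ b Z, conn (g t) x = ucx b Z) :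
    ∃ v v₁ v₂, Smooth I v ∧ Smooth I v₁ ∧ Smooth I v₂ ∧ IsHasimoto I γ g v v₁ v₂ := by
  have hX : Smooth I fun t x => (g t x)ᵀ * dx g t x := hg.matrixTranspose.matrixMul (hg.dx hI)
  refine ⟨_, _, _, hX.linearMap (readV n), hX.linearMap (readV₁ n), hX.linearMap (readV₂ n),
    hg, fun t ht => ⟨⟨hg.slice ht, fun x => ⟨hA t ht x, ?_⟩⟩, fun x => ?_⟩⟩
  · obtain ⟨b, Z, h⟩ := hu t ht x
    exact h ▸ ucx_mem_hPerp hn b Z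
  · obtain ⟨b, Z, h⟩ := hu t ht x
    obtain ⟨h1, h2⟩ := readV_eq (X := (g t x)ᵀ * dx g t x) h
    exact (h.trans (congrArg₂ ucx h1.symm h2.symm)).trans (sqrt_smul_lie_ee_perpMat hn _ _ _).symm

end ParallelFrame

/-! ### The zero curvature equation in blocks -/

section ZeroCurvature

variable {n : ℕ}

theorem fromBlocks_sub' {l m o k : Type*} (A A' : Matrix l o ℂ) (B B' : Matrix l k ℂ)
    (C C' : Matrix m o ℂ) (D D' : Matrix m k ℂ) :
    Matrix.fromBlocks A B C D - Matrix.fromBlocks A' B' C' D'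
      = Matrix.fromBlocks (A - A') (B - B') (C - C') (D - D') := by
  simp [sub_eq_add_neg, Matrix.fromBlocks_neg, Matrix.fromBlocks_add]

/-- The zero curvature equation for `U = e + u` and `V` with `m`-part `χ^(-1/2) ((0, (i v₁, i v₂))
+ (0, -2 i K))`, split into its blocks. The first three equations on the right are the `m`-part: a
condition on the trace of `a`, the value of `b`, and `K_x = v₁ ∧ v₂`. The others are the
`u(n)`-part: an evolution equation for `v`, the evolution equation for `Z`, and the `x` derivative
of `d`. -/
theorem zeroCurv_iff (hn : 3 ≤ n) {v vt : ℝ} {Z Zx Zt : ZMat n} {K Kx : CMat n}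
    {a ax : Matrix (Fin 2) (Fin 2) ℂ} {b bx : ZMat n} {d d' : CMat n} (ha : aᴴ = -a)
    (hd : dᴴ = -d) (hK : Kᵀ = -K) :
    ucx vt Zt - (cx (Matrix.fromBlocks ax bx (-bxᴴ) d') 0
          + kap n • mcx 0 (Complex.I • Zx) (-(2 * Complex.I) • Kx))
        + ⁅cx (Matrix.fromBlocks a b (-bᴴ) d) 0
          + kap n • mcx 0 (Complex.I • Z) (-(2 * Complex.I) • K), ee n + ucx v Z⁆ = 0 ↔
      (a * eps - eps * cj a + Complex.I • (Z * Zᴴ * eps + eps * (cj Z * Zᵀ)) = 0 ∧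
        eps * cj b = -(Complex.I • Zx) + (2 * v : ℂ) • Z + (2 * Complex.I) • (eps * cj Z * K) ∧
        Kx = Zᵀ * eps * Z) ∧
      (2 * vt * Complex.I) • 1 - ax + b * (Zᵀ * eps) + eps * cj Z * bᴴ = 0 ∧
      eps * cj Zt - bx + a * (eps * cj Z) - (2 * v * Complex.I) • b - eps * cj Z * d
        + (Complex.I / chi n) • (eps * cj Z) = 0 ∧
      d' = -(bᴴ * (eps * cj Z)) - Zᵀ * eps * b := by
  have hk := (kap_pos hn).ne'
  have hkC : (kap n : ℂ) ≠ 0 := by exact_mod_cast hk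
  have hχ : (Complex.I / chi n : ℂ) = (kap n * kap n : ℝ) • Complex.I := by
    have h : (chi n : ℂ) * ((kap n : ℂ) * kap n) = 1 := by exact_mod_cast chi_mul_kap hn
    have h0 : (chi n : ℂ) ≠ 0 := by exact_mod_cast (chi_pos hn).ne'
    rw [Complex.real_smul]
    push_cast
    field_simp
    linear_combination -h
  have key : ucx vt Zt - (cx (Matrix.fromBlocks ax bx (-bxᴴ) d') 0
          + kap n • mcx 0 (Complex.I • Zx) (-(2 * Complex.I) • Kx))
        + ⁅cx (Matrix.fromBlocks a b (-bᴴ) d) 0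
          + kap n • mcx 0 (Complex.I • Z) (-(2 * Complex.I) • K), ee n + ucx v Z⁆
      = cx (Matrix.fromBlocks
          ((2 * vt * Complex.I) • 1 - ax + b * (Zᵀ * eps) + eps * cj Z * bᴴ)
          (eps * cj Zt - bx + a * (eps * cj Z) - (2 * v * Complex.I) • b - eps * cj Z * d
            + (Complex.I / chi n) • (eps * cj Z))
          (-(eps * cj Zt - bx + a * (eps * cj Z) - (2 * v * Complex.I) • b - eps * cj Z * d
            + (Complex.I / chi n) • (eps * cj Z))ᴴ)
          (-(bᴴ * (eps * cj Z)) - Zᵀ * eps * b - d'))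
        (Matrix.fromBlocks
          (kap n • (a * eps - eps * cj a + Complex.I • (Z * Zᴴ * eps + eps * (cj Z * Zᵀ))))
          (kap n • (-(Complex.I • Zx) + (2 * v : ℂ) • Z + (2 * Complex.I) • (eps * cj Z * K)
            - eps * cj b))
          (-(kap n • (-(Complex.I • Zx) + (2 * v : ℂ) • Z + (2 * Complex.I) • (eps * cj Z * K)
            - eps * cj b))ᵀ)
          ((kap n) • (2 * Complex.I) • (Kx - Zᵀ * eps * Z))) := by
    rw [ee_eq, mcx_smul, mcx_smul, mcx, mcx, mcx, ucx, ucx, Ring.lie_def, hχ]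
    simp only [cx_add, cx_sub, cx_mul, Matrix.fromBlocks_multiply, cj_fromBlocks,
      fromBlocks_sub', Matrix.fromBlocks_add, add_zero, zero_add, zero_sub,
      Matrix.mul_zero, Matrix.zero_mul, Matrix.fromBlocks_neg, cj_zero]
    congr 2
    · simp [Matrix.mul_assoc]
      module
    · simp [Matrix.mul_assoc]
      module
    · simp [Matrix.mul_assoc, ha, hd]
      module
    · simp [Matrix.mul_assoc]
      module
    · simp [Matrix.mul_assoc]
      module
    · simp [Matrix.mul_assoc]
      match_scalars <;> ring_nf
      simp
    · simp [Matrix.mul_assoc, hK]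
      match_scalars <;> ring_nf
      simp
    · simp [Matrix.mul_assoc]
      module
  rw [key, ← cx_zero, cx_inj, ← Matrix.fromBlocks_zero, Matrix.fromBlocks_inj,
    Matrix.fromBlocks_inj]
  have e1 : ∀ {k l : Type} (X : Matrix k l ℂ), kap n • X = 0 ↔ X = 0 := fun X => by simp [hk]
  constructor
  · rintro ⟨⟨h1, h2, -, h4⟩, h5, h6, -, h8⟩
    refine ⟨⟨(e1 _).1 h5, ?_, ?_⟩, h1, h2, (sub_eq_zero.1 h4).symm⟩
    · exact (sub_eq_zero.1 ((e1 _).1 h6)).symm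
    · have := (e1 _).1 h8
      simpa [sub_eq_zero] using this
  · rintro ⟨⟨h5, h6, h8⟩, h1, h2, h4⟩
    refine ⟨⟨h1, h2, by rw [h2]; simp, sub_eq_zero.2 h4.symm⟩, by rw [h5, smul_zero], ?_, ?_, ?_⟩
    · rw [h6, sub_self, smul_zero]
    · rw [h6, sub_self, smul_zero]; simp
    · rw [h8, sub_self, smul_zero, smul_zero]

/-- The off-diagonal block of the connection in `t` direction. -/
def omOff (v : ℝ) (Z Zx : ZMat n) (K : CMat n) : ZMat n :=
  -(Complex.I • (eps * cj Zx)) - (2 * v : ℂ) • (eps * cj Z) - (2 * Complex.I) • (Z * cj K)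

theorem eps_mul_cj_inj {Z Z' : ZMat n} : eps * cj Z = eps * cj Z' ↔ Z = Z' := by
  refine ⟨fun h => ?_, fun h => h ▸ rfl⟩
  have h1 := congrArg (fun X => cj (-(eps * X))) h
  simpa using h1

/-- The off-diagonal `m`-block of the zero curvature equation determines `b`. -/
theorem omOff_iff {v : ℝ} {Z Zx b : ZMat n} {K : CMat n} :
    eps * cj b = -(Complex.I • Zx) + (2 * v : ℂ) • Z + (2 * Complex.I) • (eps * cj Z * K)
      ↔ b = omOff v Z Zx K := by
  rw [← eps_mul_cj_inj (Z := b)]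
  have e : eps * cj (omOff v Z Zx K)
      = -(Complex.I • Zx) + (2 * v : ℂ) • Z + (2 * Complex.I) • (eps * cj Z * K) := by
    simp only [omOff, cj_sub, Matrix.mul_sub]
    simp [Matrix.mul_assoc]
  rw [e]

theorem mul_cj_mul_transpose {Z : ZMat n} {K : CMat n} (hK : Kᵀ = -K) :
    Z * cj K * Zᵀ = (Z * cj K * Zᵀ) 0 1 • eps :=
  eq_smul_eps (by
    have : Kᴴ = -cj K := by rw [← cj_transpose, hK, cj_neg]
    simp [Matrix.transpose_mul, Matrix.mul_assoc, this])

theorem eps_mul_transpose_mul_eps (M : Matrix (Fin 2) (Fin 2) ℂ) :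
    eps * Mᵀ * eps = M - M.trace • 1 := by
  have h := congrArg (· * eps) (eps_mul_transpose_add M)
  simp only [Matrix.add_mul, mul_eps_mul_eps, Matrix.smul_mul, eps_mul_eps] at h
  rw [eq_sub_iff_add_eq, ← sub_eq_zero, ← sub_eq_zero.2 h]
  module

/-- The upper left block of the zero curvature equation. -/
theorem omOff_block₁₁ {v : ℝ} {Z Zx : ZMat n} {K : CMat n} (hK : Kᵀ = -K) :
    omOff v Z Zx K * (Zᵀ * eps) + eps * cj Z * (omOff v Z Zx K)ᴴ
      = -(Complex.I • (Zx * Zᴴ + Z * Zxᴴ))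
        + (Complex.I * ((Zx * Zᴴ + Z * Zxᴴ).trace
          + 2 * ((Z * cj K * Zᵀ) 0 1 + star ((Z * cj K * Zᵀ) 0 1)))) • 1 := by
  have h1 := mul_cj_mul_transpose (Z := Z) hK
  have h2 := congrArg cj h1
  have h3 := eps_mul_transpose_mul_eps (Zx * Zᴴ + Z * Zxᴴ)
  generalize (Z * cj K * Zᵀ) 0 1 = k at *
  generalize (Zx * Zᴴ + Z * Zxᴴ).trace = T at *
  have e1 : Z * (cj K * (Zᵀ * eps)) = -(k • 1) := by
    rw [← Matrix.mul_assoc, ← Matrix.mul_assoc, h1, Matrix.smul_mul, eps_mul_eps, smul_neg]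
  have e2 : eps * (cj Z * (K * Zᴴ)) = -(star k • 1) := by
    have : cj Z * (K * Zᴴ) = star k • eps := by
      simpa [Matrix.mul_assoc] using h2
    rw [this, Matrix.mul_smul, eps_mul_eps, smul_neg]
  have e3 : Zx * Zᴴ = eps * (cj Zx * (Zᵀ * eps)) + eps * (cj Z * (Zxᵀ * eps)) + T • 1
      - Z * Zxᴴ := by
    rw [eq_sub_iff_add_eq, ← sub_eq_iff_eq_add, ← h3]
    simp [Matrix.mul_assoc, Matrix.add_mul, Matrix.mul_add]
    abel
  rw [e3]
  simp only [omOff, Matrix.conjTranspose_sub, Matrix.mul_sub, Matrix.sub_mul]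
  simp [Matrix.mul_assoc, hK, e1, e2]
  module

/-- The lower right block of the zero curvature equation. -/
theorem omOff_block₂₂ {v : ℝ} {Z Zx : ZMat n} {K : CMat n} (hK : Kᵀ = -K) :
    -((omOff v Z Zx K)ᴴ * (eps * cj Z)) - Zᵀ * eps * omOff v Z Zx K
      = -(Complex.I • (Zxᵀ * cj Z + Zᵀ * cj Zx))
        + (2 * Complex.I) • ((Zᵀ * eps * Z) * cj K + K * cj (Zᵀ * eps * Z)) := by
  simp only [omOff, Matrix.conjTranspose_sub, Matrix.mul_sub, Matrix.sub_mul]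
  simp [Matrix.mul_assoc, hK]
  module

theorem star_trace_mul_conjTranspose (Z : ZMat n) : star (Z * Zᴴ).trace = (Z * Zᴴ).trace := by
  rw [← Matrix.trace_conjTranspose]
  simp

/-- The off-diagonal block of the zero curvature equation is the NLS equation. -/
theorem omOff_block₁₂ {v vx : ℝ} {Z Zx Zxx Zt : ZMat n} {K : CMat n} :
    eps * cj Zt - (-(Complex.I • (eps * cj Zxx)) - (2 * vx : ℂ) • (eps * cj Z)
        - (2 * v : ℂ) • (eps * cj Zx) - (2 * Complex.I) • (Zx * cj K + Z * cj (Zᵀ * eps * Z)))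
        + -(Complex.I • (Z * Zᴴ)) * (eps * cj Z) - (2 * v * Complex.I) • omOff v Z Zx K
        - eps * cj Z * (-(Complex.I • (Zᵀ * cj Z)) + (2 * Complex.I) • (K * cj K))
        + (Complex.I / chi n) • (eps * cj Z) = 0 ↔
      Zt - (Complex.I / chi n) • Z = Complex.I • Zxx
        + (Complex.I * (4 * v ^ 2 + (Z * Zᴴ).trace)) • Z - (2 * vx : ℂ) • Z
        - ((2 * Complex.I) • (eps * cj Zx) + (4 * v : ℂ) • (eps * cj Z)
          + (2 * Complex.I) • (Z * cj K)) * K := by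
  have hT := star_trace_mul_conjTranspose Z
  have h0 : Z * (Zᴴ * (eps * cj Z))
      = (Z * Zᴴ).trace • (eps * cj Z) - eps * (cj Z * (Zᵀ * cj Z)) := by
    have h := congrArg (· * cj Z) (eps_mul_transpose_add (Z * Zᴴ))
    simp only [Matrix.add_mul, Matrix.smul_mul, Matrix.transpose_mul] at h
    rw [eq_sub_iff_add_eq, ← h]
    simp [Matrix.mul_assoc, add_comm]
  have hχ : star (Complex.I / (chi n : ℂ)) = -(Complex.I / chi n) := by simp [neg_div]
  generalize (Z * Zᴴ).trace = T at *
  generalize Complex.I / (chi n : ℂ) = c at *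
  rw [← sub_eq_zero (a := Zt - _), ← eps_mul_cj_inj (Z := Zt - _ - _), cj_zero, Matrix.mul_zero]
  refine Eq.congr_left ?_
  simp only [Complex.star_def] at hT hχ
  simp only [omOff, cj_sub, cj_add, Matrix.mul_sub, Matrix.mul_add, Matrix.add_mul,
    smul_add, smul_sub]
  simp [Matrix.mul_assoc, h0, hT, hχ]
  match_scalars <;> (try ring_nf) <;> (try simp)

end ZeroCurvature

/-! ### The gauge of the parallel frame -/

section Gauge

variable {n : ℕ}

/-- The component in `h_∥` which the connection in `t` direction has to have, as an expression in
the point `P`, the tangent vector `ξ`, the connection `u` along the curve and the nonlocal vector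
field `w`.  Here `-χ ξ²` is the projection onto the block of size two, and the trace makes the
component in `u(2)` traceless, hence an element of `su(2)`. -/
def gaugeGen (P ξ u w : Mat n) : Mat n :=
  let p₁ := -(chi n • (ξ * ξ))
  let p₂ := 1 - p₁;
  -(P * (-(p₁ * u * p₂ * u * p₁) + (1 / 4 * (p₁ * u * p₂ * u * p₁).trace) • p₁
    + p₂ * u * p₁ * u * p₂ + (chi n ^ 3 / 8) • (w * w)))

theorem IsFrame.trace_conj {P g : Mat n} (h : IsFrame P g) (A : Mat n) :
    (g * A * gᵀ).trace = A.trace := by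
  rw [Matrix.trace_mul_comm, ← mul_assoc, h.left_inv, one_mul]

theorem IsFrame.gaugeGen_conj {P g : Mat n} (h : IsFrame P g) (A B D : Mat n) :
    gaugeGen P (g * A * gᵀ) (g * B * gᵀ) (g * D * gᵀ) = g * gaugeGen (J0 n) A B D * gᵀ := by
  have e : ∀ X Y : Mat n, g * X * gᵀ * (g * Y * gᵀ) = g * (X * Y) * gᵀ := fun X Y => by
    simp only [mul_assoc, h.left_inv_mul]
  have e1 : -(chi n • ((g * A * gᵀ) * (g * A * gᵀ))) = g * -(chi n • (A * A)) * gᵀ := by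
    rw [e]; simp
  have e2 : ∀ X, 1 - g * X * gᵀ = g * (1 - X) * gᵀ := fun X => by
    rw [mul_sub, sub_mul, mul_one, h.right_inv]
  simp only [gaugeGen]
  rw [e1, e2]
  simp only [e, h.trace_conj]
  generalize -(chi n • (A * A)) * B * (1 - -(chi n • (A * A))) * B * -(chi n • (A * A)) = X
  generalize (1 - -(chi n • (A * A))) * B * -(chi n • (A * A)) * B * (1 - -(chi n • (A * A))) = Y
  generalize -(chi n • (A * A)) = p
  rw [h.2]
  simp only [mul_add, mul_neg, mul_smul_comm, e]
  simp [add_mul]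

/-- At the base point, `gaugeGen` is the block-diagonal matrix `gaugeBlock`. -/
theorem gaugeGen_eq (hn : 3 ≤ n) (b : ℝ) (Z : ZMat n) (K : CMat n) :
    gaugeGen (J0 n) (ee n) (ucx b Z) (mcx 0 0 ((4 * kap n ^ 3) • (Complex.I • K)))
      = cx (Matrix.fromBlocks (-(Complex.I • (Z * Zᴴ)) + (Complex.I / 2 * (Z * Zᴴ).trace) • 1) 0 0
        (-(Complex.I • (Zᵀ * cj Z)) + (2 * Complex.I) • (K * cj K))) 0 := by
  have hp : -(chi n • (ee n * ee n)) = cx (Matrix.fromBlocks 1 0 0 0) 0 := by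
    rw [ee_eq, mcx, cx_mul, cx_smul, cx_neg, cx_inj]
    refine ⟨?_, by simp⟩
    simp only [cj_fromBlocks, Matrix.fromBlocks_multiply, Matrix.fromBlocks_smul,
      Matrix.fromBlocks_neg, zero_mul, zero_add]
    congr 1
    · simp [smul_smul]
      rw [chi_mul_kap hn, one_smul]
    · simp
    · simp
    · simp
  have hq : (1 : Mat n) - cx (Matrix.fromBlocks 1 0 0 0) 0
      = cx (Matrix.fromBlocks 0 0 0 1) 0 := by
    rw [one_eq_cx, cx_sub, ← Matrix.fromBlocks_one, fromBlocks_sub']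
    simp
  have e1 : cx (Matrix.fromBlocks 1 0 0 0) 0 * ucx b Z * cx (Matrix.fromBlocks 0 0 0 1) 0
      * ucx b Z * cx (Matrix.fromBlocks 1 0 0 0) 0
      = cx (Matrix.fromBlocks (Z * Zᴴ - (Z * Zᴴ).trace • 1) 0 0 0) 0 := by
    have h := eps_mul_transpose_mul_eps (Z * Zᴴ)
    rw [ucx]
    simp [cx_mul, Matrix.fromBlocks_multiply]
    rw [← h]
    simp [Matrix.mul_assoc]
  have e2 : cx (Matrix.fromBlocks 0 0 0 1) 0 * ucx b Z * cx (Matrix.fromBlocks 1 0 0 0) 0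
      * ucx b Z * cx (Matrix.fromBlocks 0 0 0 1) 0
      = cx (Matrix.fromBlocks 0 0 0 (-(Zᵀ * cj Z))) 0 := by
    rw [ucx]
    simp [cx_mul, Matrix.fromBlocks_multiply, Matrix.mul_assoc]
  have hT := star_trace_mul_conjTranspose Z
  have hre : (((Z * Zᴴ).trace.re : ℝ) : ℂ) = (Z * Zᴴ).trace := Complex.conj_eq_iff_re.1 hT
  have h6 : chi n ^ 3 * kap n ^ 6 = 1 := by
    have h := chi_mul_kap hn
    calc chi n ^ 3 * kap n ^ 6 = (chi n * (kap n * kap n)) ^ 3 := by ring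
      _ = 1 := by rw [h, one_pow]
  have h6C : (chi n : ℂ) ^ 3 * (kap n : ℂ) ^ 6 = 1 := by exact_mod_cast h6
  simp only [gaugeGen]
  rw [hp, hq, e1, e2, trace_cx, J0_eq_cx, mcx]
  simp [cx_mul, cx_add, cx_neg, cx_smul, Matrix.fromBlocks_multiply, Matrix.fromBlocks_add,
    Matrix.fromBlocks_smul, Matrix.fromBlocks_neg, cx_inj, Matrix.fromBlocks_inj,
    trace_fromBlocks']
  generalize (Z * Zᴴ).trace = T at *
  constructor
  · rw [← Complex.coe_smul]
    push_cast
    rw [hre]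
    module
  · match_scalars
    simp
    linear_combination (-2 * Complex.I ^ 3) * h6C - 2 * Complex.I * Complex.I_sq

/-- The block-diagonal part of the connection in `t` direction, made traceless in `u(2)`. -/
def gaugeBlock (Z : ZMat n) (K : CMat n) : Mat n :=
  cx (Matrix.fromBlocks (-(Complex.I • (Z * Zᴴ)) + (Complex.I / 2 * (Z * Zᴴ).trace) • 1) 0 0
        (-(Complex.I • (Zᵀ * cj Z)) + (2 * Complex.I) • (K * cj K))) 0

theorem isH_gaugeBlock (Z : ZMat n) {K : CMat n} (hK : Kᵀ = -K) : IsH (gaugeBlock Z K) := by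
  refine isH_iff.2 ⟨_, ?_, rfl⟩
  have hT := star_trace_mul_conjTranspose Z
  have hKc : Kᴴ = -cj K := by rw [← cj_transpose, hK, cj_neg]
  rw [Matrix.fromBlocks_conjTranspose, Matrix.fromBlocks_neg]
  congr 1
  · simp only [Matrix.conjTranspose_add, Matrix.conjTranspose_neg, Matrix.conjTranspose_smul,
      Matrix.conjTranspose_mul, Matrix.conjTranspose_conjTranspose, Matrix.conjTranspose_one,
      star_mul', hT]
    simp
    module
  · simp
  · simp
  · simp [hK, hKc, add_comm]

/-- `gaugeBlock` lies in the centralizer `h_∥` of `e`, because its `2 × 2` block is traceless. -/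
theorem lie_gaugeBlock_ee (Z : ZMat n) (K : CMat n) : ⁅gaugeBlock Z K, ee n⁆ = 0 := by
  have h := eps_mul_transpose_add (Z * Zᴴ)
  have hT := star_trace_mul_conjTranspose Z
  rw [gaugeBlock, ee_eq, mcx, lie_cx_zero_right, ← cx_zero, cx_inj]
  refine ⟨rfl, ?_⟩
  rw [cj_fromBlocks, Matrix.fromBlocks_multiply, Matrix.fromBlocks_multiply, fromBlocks_sub',
    ← Matrix.fromBlocks_zero]
  generalize hTT : (Z * Zᴴ).trace = T at *
  congr 1
  · have h' : Z * (Zᴴ * eps) = T • eps - eps * (cj Z * Zᵀ) := by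
      rw [← h]; simp [Matrix.mul_assoc]
    simp only [Complex.star_def] at hT
    simp [Matrix.add_mul, Matrix.mul_add, Matrix.mul_assoc, h', hT]
    module
  · simp
  · simp
  · simp

theorem Smooth.neg {I : Set ℝ} {F : Type*} [NormedAddCommGroup F] [NormedSpace ℝ F]
    {f : ℝ → ℝ → F} (hf : Smooth I f) : Smooth I fun t x => -f t x := ContDiffOn.neg hf

theorem Smooth.smul {I : Set ℝ} {F : Type*} [NormedAddCommGroup F] [NormedSpace ℝ F]
    {r : ℝ → ℝ → ℝ} {f : ℝ → ℝ → F} (hr : Smooth I r) (hf : Smooth I f) :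
    Smooth I fun t x => r t x • f t x := ContDiffOn.smul hr hf

theorem Smooth.gaugeGen {I : Set ℝ} {P ξ u w : ℝ → ℝ → Mat n} (hP : Smooth I P)
    (hξ : Smooth I ξ) (hu : Smooth I u) (hw : Smooth I w) :
    Smooth I fun t x => gaugeGen (P t x) (ξ t x) (u t x) (w t x) := by
  have h1 : Smooth I fun t x => -(chi n • (ξ t x * ξ t x)) := ((hξ.matrixMul hξ).const_smul _).neg
  have h2 : Smooth I fun t x => 1 - -(chi n • (ξ t x * ξ t x)) := (Smooth.const (1 : Mat n)).sub h1
  have h3 := (((h1.matrixMul hu).matrixMul h2).matrixMul hu).matrixMul h1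
  have h4 := (((h2.matrixMul hu).matrixMul h1).matrixMul hu).matrixMul h2
  have h5 := (h3.linearMap (Matrix.traceLinearMap (Ix n ⊕ Ix n) ℝ ℝ)).const_smul (1 / 4)
  exact (hP.matrixMul (((h3.neg.add (h5.smul h1)).add h4).add
    ((hw.matrixMul hw).const_smul (chi n ^ 3 / 8)))).neg

/-- In an adapted frame, the gauge is given by `gaugeBlock`. -/
theorem IsFrame.gaugeGen_eq (hn : 3 ≤ n) {P k u w : Mat n} (h : IsFrame P k) {b : ℝ} {Z : ZMat n}
    {K : CMat n} (hu : u = k * ucx b Z * kᵀ)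
    (hw : w = k * mcx 0 0 ((4 * kap n ^ 3) • (Complex.I • K)) * kᵀ) :
    gaugeGen P (k * ee n * kᵀ) u w = k * gaugeBlock Z K * kᵀ := by
  rw [hu, hw, h.gaugeGen_conj, SOU.gaugeGen_eq hn, gaugeBlock]

/-- The component `K` of the nonlocal vector field, read off from `4 χ^(-3/2) (0, i K)`. -/
def readK (n : ℕ) : Mat n →ₗ[ℝ] CMat n where
  toFun X := (-Complex.I / (4 * kap n ^ 3)) • (alin n X).toBlocks₂₂
  map_add' X Y := by
    rw [map_add]
    ext i j
    simp [Matrix.toBlocks₂₂, mul_add]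
  map_smul' c X := by
    rw [map_smul]
    ext i j
    simp [Matrix.toBlocks₂₂]
    ring

theorem readK_eq (hn : 3 ≤ n) (K : CMat n) :
    readK n (mcx 0 0 ((4 * kap n ^ 3) • (Complex.I • K))) = K := by
  have hk : (kap n : ℂ) ≠ 0 := by exact_mod_cast (kap_pos hn).ne'
  ext i j
  simp [readK, mcx]
  field_simp
  simp

variable {I : Set ℝ} {γ W : ℝ → ℝ → Mat n}

/-- The nonlocal vector field of a solution has the components `4 χ^(-3/2) (0, i K)`. -/
theorem IsU1CurveFlow.exists_coframe (hn : 3 ≤ n) (h : IsU1CurveFlow I γ W) {t : ℝ} (ht : t ∈ I)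
    (x : ℝ) {k : Mat n} (hk : IsAdapted (γ t x) (dx γ t x) k) :
    IsTangent (γ t x) (W t x) ∧ ∃ K : CMat n, Kᵀ = -K ∧
      coframe (γ t x) k (W t x) = mcx 0 0 ((4 * kap n ^ 3) • (Complex.I • K)) := by
  have hk0 : (kap n : ℂ) ≠ 0 := by exact_mod_cast (kap_pos hn).ne'
  obtain ⟨Y, hY, hWY⟩ := (h.2.2 t ht).1.2.1 x
  have hX := (h.1.inClass ht x).1
  rw [hWY]
  refine ⟨isTangent_Jmap ⟨k, hk⟩ hY.1, ?_⟩
  obtain ⟨a, z, H, hH, hc⟩ := hk.isFrame.exists_mcx hY.1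
  obtain ⟨-, rfl⟩ := (hk.isPar_iff hn hX hY.1 hc).1 hY
  refine ⟨(1 / (2 * kap n ^ 3)) • H, by simp [hH], (hk.coframe_Jmap hn hY.1 hc).trans ?_⟩
  congr 1
  · simp
  · ext i j
    simp
    field_simp
    ring

/-- Along a solution of the curve flow equation there is a parallel frame in which the component
in `h_∥` of the connection in `t` direction is normalized along `x = 0`. -/
theorem IsU1CurveFlow.exists_frame (hn : 3 ≤ n) (hI : IsOpen I) (hIc : I.OrdConnected)
    (h : IsU1CurveFlow I γ W) :
    ∃ (g : ℝ → ℝ → Mat n) (v : ℝ → ℝ → ℝ) (v₁ v₂ : ℝ → ℝ → CVec n) (K : ℝ → ℝ → CMat n),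
      IsHasimoto I γ g v v₁ v₂ ∧ IsLinked I γ g W K ∧ Smooth I v ∧ Smooth I v₁ ∧ Smooth I v₂ ∧
      Smooth I K ∧ (∀ t ∈ I, ∀ x, (K t x)ᵀ = -K t x) ∧
      ∀ t ∈ I, ∃ (b : ℝ) (Y : ZMat n), hPart ((g t 0)ᵀ * dt g t 0)
        = ucx b Y + gaugeBlock (zMat (v₁ t 0) (v₂ t 0)) (K t 0) := by
  have hγ := h.1
  have hξ := hγ.1.tangentGen hI
  have hA : Smooth I fun t x =>
      rotGen (γ t x) (tangentGen γ t x) (dx γ t x) (dx (tangentGen γ) t x) :=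
    hγ.1.rotGen hξ (hγ.1.dx hI) (hξ.dx hI)
  have hw : Smooth I fun t x => gen (γ t x) (W t x) := hγ.1.gen h.2.1
  have hu : ∀ t ∈ I, ∀ x, ∀ k, IsAdapted (γ t x) (dx γ t x) k → ∃ b Z,
      rotGen (γ t x) (tangentGen γ t x) (dx γ t x) (dx (tangentGen γ) t x)
        = k * (ee n + ucx b Z) * kᵀ := fun t ht x k hk => by
    obtain ⟨b, Z, hbZ⟩ := hγ.exists_covDeriv_dx hn hI ht x hk
    have := hk.isFrame.rotGen_eq hn hk.gen_eq hbZ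
    rw [hk.2.2] at this
    exact ⟨_, _, this⟩
  have hgauge : ∀ t ∈ I, ∀ k, IsAdapted (γ t 0) (dx γ t 0) k → ∀ b Z K,
      rotGen (γ t 0) (tangentGen γ t 0) (dx γ t 0) (dx (tangentGen γ) t 0)
        = k * (ee n + ucx b Z) * kᵀ →
      coframe (γ t 0) k (W t 0) = mcx 0 0 ((4 * kap n ^ 3) • (Complex.I • K)) →
      gaugeGen (γ t 0) (tangentGen γ t 0)
        (rotGen (γ t 0) (tangentGen γ t 0) (dx γ t 0) (dx (tangentGen γ) t 0)
          - tangentGen γ t 0) (gen (γ t 0) (W t 0)) = k * gaugeBlock Z K * kᵀ := by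
    intro t ht k hk b Z K e1 e2
    have e3 : tangentGen γ t 0 = k * ee n * kᵀ := hk.gen_eq
    rw [e1, e3]
    refine hk.isFrame.gaugeGen_eq hn (b := b) ?_ (e2 ▸ hk.isFrame.gen_eq _)
    rw [mul_add, add_mul, add_sub_cancel_left]
  obtain ⟨g, hg, hgA, hgx, hgt⟩ := hγ.exists_frame hn hI hIc
    (C := fun t => gaugeGen (γ t 0) (tangentGen γ t 0)
        (rotGen (γ t 0) (tangentGen γ t 0) (dx γ t 0) (dx (tangentGen γ) t 0)
          - tangentGen γ t 0) (gen (γ t 0) (W t 0)))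
    ((hγ.1.gaugeGen hξ (hA.sub hξ) hw).slice_left 0)
    (fun t ht => by
      obtain ⟨-, k, hk⟩ := hγ.inClass ht 0
      obtain ⟨b, Z, e1⟩ := hu t ht 0 k hk
      obtain ⟨-, K, hK, e2⟩ := h.exists_coframe hn ht 0 hk
      rw [hgauge t ht k hk b Z K e1 e2]
      simp [Matrix.transpose_mul, (isH_gaugeBlock Z hK).1, mul_assoc])
    (fun t ht => by
      obtain ⟨-, k, hk⟩ := hγ.inClass ht 0
      obtain ⟨b, Z, e1⟩ := hu t ht 0 k hk
      obtain ⟨-, K, hK, e2⟩ := h.exists_coframe hn ht 0 hk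
      rw [hgauge t ht k hk b Z K e1 e2, hk.2.1, hk.isFrame.conj_lie, Ring.lie_def,
        (isH_gaugeBlock Z hK).2]
      simp)
    (fun t ht => by
      obtain ⟨-, k, hk⟩ := hγ.inClass ht 0
      obtain ⟨b, Z, e1⟩ := hu t ht 0 k hk
      obtain ⟨-, K, hK, e2⟩ := h.exists_coframe hn ht 0 hk
      have e3 : tangentGen γ t 0 = k * ee n * kᵀ := hk.gen_eq
      rw [hgauge t ht k hk b Z K e1 e2, e3, hk.isFrame.conj_lie, lie_gaugeBlock_ee]
      simp)
  have hgx' : ∀ t ∈ I, ∀ x, ∃ b Z, conn (g t) x = ucx b Z ∧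
      rotGen (γ t x) (tangentGen γ t x) (dx γ t x) (dx (tangentGen γ) t x)
        = g t x * (ee n + ucx b Z) * (g t x)ᵀ := fun t ht x => by
    obtain ⟨b, Z, e1⟩ := hu t ht x _ (hgA t ht x)
    refine ⟨b, Z, ?_, e1⟩
    have e : (g t x)ᵀ * dx g t x = ee n + ucx b Z := by
      have hF := (hgA t ht x).isFrame
      rw [hgx t ht x, e1]
      simp only [mul_assoc, hF.left_inv, hF.left_inv_mul, mul_one]
    exact (congrArg hPart e).trans ((isM_ee n).hPart_add (isH_ucx b Z))
  obtain ⟨v, v₁, v₂, hv, hv₁, hv₂, hH⟩ := exists_isHasimoto hn hI hg hgA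
    fun t ht x => (hgx' t ht x).imp fun b hb => hb.imp fun Z hZ => hZ.1
  have hWK : ∀ t ∈ I, ∀ x,
      (readK n (coframe (γ t x) (g t x) (W t x)))ᵀ = -readK n (coframe (γ t x) (g t x) (W t x)) ∧
      coframe (γ t x) (g t x) (W t x) = mcx 0 0 ((4 * kap n ^ 3) •
        (Complex.I • readK n (coframe (γ t x) (g t x) (W t x)))) := fun t ht x => by
    obtain ⟨-, K, hK, e2⟩ := h.exists_coframe hn ht x (hgA t ht x)
    rw [e2, readK_eq hn]
    exact ⟨hK, rfl⟩
  refine ⟨g, v, v₁, v₂, fun t x => readK n (coframe (γ t x) (g t x) (W t x)), hH,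
    fun t ht x => ⟨(h.exists_coframe hn ht x (hgA t ht x)).1, ?_⟩, hv, hv₁, hv₂,
    (hγ.1.coframe hg h.2.1).linearMap (readK n), fun t ht x => (hWK t ht x).1, fun t ht => ?_⟩
  · rw [linked_eq]
    exact (hWK t ht x).2
  · obtain ⟨b, Z, e1, e2⟩ := hgx' t ht 0
    have hA0 := hgA t ht 0
    obtain ⟨β, Y, hβ⟩ := hγ.exists_covDeriv_dt hn hI ht 0 hA0
    have e3 := hA0.isFrame.rotGen_eq hn hA0.gen_eq hβ
    have hZ : zMat (v₁ t 0) (v₂ t 0) = Z := by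
      have h1 := (hH.2 t ht).2 0
      rw [sqrt_smul_lie_ee_perpMat hn] at h1
      exact ((readV_eq (X := (g t 0)ᵀ * dx g t 0) h1).2.symm.trans
        (readV_eq (X := (g t 0)ᵀ * dx g t 0) e1).2)
    have hC := hgauge t ht _ hA0 b Z _ e2 (hWK t ht 0).2
    refine ⟨√(chi n) * β / 4, √(chi n) • Y, ?_⟩
    have e : (g t 0)ᵀ * dt g t 0 = coframe (γ t 0) (g t 0) (dt γ t 0)
        + (ucx (√(chi n) * β / 4) (√(chi n) • Y)
          + gaugeBlock Z (readK n (coframe (γ t 0) (g t 0) (W t 0)))) := by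
      have hF := hA0.isFrame
      rw [hgt t ht, hC]
      refine (congrArg (fun M => (g t 0)ᵀ * ((M + _) * g t 0)) e3).trans ?_
      simp only [mul_assoc, mul_add, add_mul, hF.left_inv, hF.left_inv_mul, mul_one, add_assoc]
    rw [e, hZ]
    have hu1 := isH_ucx (√(chi n) * β / 4) (√(chi n) • Y)
    have hu2 := isH_gaugeBlock Z (hWK t ht 0).1
    refine (hA0.isFrame.isM_coframe (hγ.isTangent_dt hI ht 0)).hPart_add ⟨?_, ?_⟩
    · rw [Matrix.transpose_add, hu1.1, hu2.1, neg_add]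
    · rw [add_mul, mul_add, hu1.2, hu2.2]

end Gauge

/-! ### Calculus of the block variables -/

section BlockCalculus

variable {n : ℕ}

theorem _root_.HasDerivAt.cj {l m : Type*} [Fintype l] [Fintype m] {A : ℝ → Matrix l m ℂ}
    {A' : Matrix l m ℂ} {x : ℝ} (hA : HasDerivAt A A' x) :
    HasDerivAt (fun y => cj (A y)) (cj A') x :=
  hA.linearMap (cjLin l m)

theorem _root_.HasDerivAt.matrixConjTranspose {l m : Type*} [Fintype l] [Fintype m]
    {A : ℝ → Matrix l m ℂ} {A' : Matrix l m ℂ} {x : ℝ} (hA : HasDerivAt A A' x) :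
    HasDerivAt (fun y => (A y)ᴴ) A'ᴴ x :=
  hA.cj.matrixTranspose

/-- `zMat` as a real-linear map. -/
def zMatLin (n : ℕ) : CVec n × CVec n →ₗ[ℝ] ZMat n where
  toFun p := zMat p.1 p.2
  map_add' p q := by ext i j; fin_cases i <;> simp [zMat]
  map_smul' c p := by ext i j; fin_cases i <;> simp [zMat]

theorem _root_.HasDerivAt.zMat {z₁ z₂ : ℝ → CVec n} {z₁' z₂' : CVec n} {x : ℝ}
    (h₁ : HasDerivAt z₁ z₁' x) (h₂ : HasDerivAt z₂ z₂' x) :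
    HasDerivAt (fun y => zMat (z₁ y) (z₂ y)) (zMat z₁' z₂') x :=
  (h₁.prodMk h₂).linearMap (zMatLin n)

theorem Smooth.zMat {I : Set ℝ} {z₁ z₂ : ℝ → ℝ → CVec n} (h₁ : Smooth I z₁) (h₂ : Smooth I z₂) :
    Smooth I fun t x => zMat (z₁ t x) (z₂ t x) :=
  ContDiffOn.linearMap (zMatLin n) (h₁.prodMk h₂)

/-- The element of `u(n)` with blocks `a`, `b`, `d`, as a linear map. -/
def blockLin (n : ℕ) : Matrix (Fin 2) (Fin 2) ℂ × ZMat n × CMat n →ₗ[ℝ] Mat n where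
  toFun p := cx (Matrix.fromBlocks p.1 p.2.1 (-p.2.1ᴴ) p.2.2) 0
  map_add' p q := by
    simp [cx_add, Matrix.fromBlocks_add, add_comm]
  map_smul' c p := by
    simp [cx_smul, Matrix.fromBlocks_smul]

/-- `√χ ad(e)` on `m_⊥`, as a linear map. -/
def ucxLin (n : ℕ) : ℝ × ZMat n →ₗ[ℝ] Mat n where
  toFun p := ucx p.1 p.2
  map_add' _ _ := (ucx_add _ _ _ _).symm
  map_smul' _ _ := (ucx_smul _ _ _).symm

/-- The connection and the coframe in `t` direction. -/
def laxV (a : Matrix (Fin 2) (Fin 2) ℂ) (b : ZMat n) (d : CMat n) (Z : ZMat n) (K : CMat n) :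
    Mat n :=
  cx (Matrix.fromBlocks a b (-bᴴ) d) 0 + kap n • mcx 0 (Complex.I • Z) (-(2 * Complex.I) • K)

theorem hasDerivAt_laxV {a : ℝ → Matrix (Fin 2) (Fin 2) ℂ} {b Z : ℝ → ZMat n} {d K : ℝ → CMat n}
    {a' : Matrix (Fin 2) (Fin 2) ℂ} {b' Z' : ZMat n} {d' K' : CMat n} {x : ℝ}
    (ha : HasDerivAt a a' x) (hb : HasDerivAt b b' x) (hd : HasDerivAt d d' x)
    (hZ : HasDerivAt Z Z' x) (hK : HasDerivAt K K' x) :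
    HasDerivAt (fun y => laxV (a y) (b y) (d y) (Z y) (K y)) (laxV a' b' d' Z' K') x :=
  ((ha.prodMk (hb.prodMk hd)).linearMap (blockLin n)).add
    ((((hasDerivAt_const x (0 : ℂ)).prodMk ((hZ.const_smul Complex.I).prodMk
      (hK.const_smul (-(2 * Complex.I))))).linearMap (mcxLin n)).const_smul (kap n))

theorem hasDerivAt_omOff {v : ℝ → ℝ} {Z Zx : ℝ → ZMat n} {K : ℝ → CMat n} {vx : ℝ}
    {Z' Zxx : ZMat n} {K' : CMat n} {x : ℝ} (hv : HasDerivAt v vx x) (hZ : HasDerivAt Z Z' x)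
    (hZx : HasDerivAt Zx Zxx x) (hK : HasDerivAt K K' x) :
    HasDerivAt (fun y => omOff (v y) (Z y) (Zx y) (K y))
      (-(Complex.I • (eps * cj Zxx)) - (2 * vx : ℂ) • (eps * cj (Z x))
        - (2 * v x : ℂ) • (eps * cj Z') - (2 * Complex.I) • (Z' * cj (K x) + Z x * cj K')) x := by
  have e : ∀ M : ℝ → ZMat n, ∀ M', HasDerivAt M M' x →
      HasDerivAt (fun y => eps * cj (M y)) (eps * cj M') x := fun M M' hM =>
    ((hasDerivAt_const x eps).matrixMul hM.cj).congr_deriv (by rw [Matrix.zero_mul, zero_add])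
  have h1 := (e _ _ hZx).const_smul Complex.I
  have h2 := ((hv.ofReal_comp.const_mul (2 : ℂ))).smul (e _ _ hZ)
  have h3 := (hZ.matrixMul hK.cj).const_smul (2 * Complex.I)
  refine ((h1.neg.sub h2).sub h3).congr_deriv ?_
  abel

/-- The `x` derivative of `|v₁|² + |v₂|² + |K|²`, if `K_x = v₁ ∧ v₂`. -/
def densX (Z Zx : ZMat n) (K : CMat n) : ℂ :=
  (Zx * Zᴴ + Z * Zxᴴ).trace + 2 * ((Z * cj K * Zᵀ) 0 1 + star ((Z * cj K * Zᵀ) 0 1))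

theorem ofReal_re_densX (Z Zx : ZMat n) (K : CMat n) :
    (((densX Z Zx K).re : ℝ) : ℂ) = densX Z Zx K := by
  refine Complex.conj_eq_iff_re.1 ?_
  have h : star (Zx * Zᴴ + Z * Zxᴴ).trace = (Zx * Zᴴ + Z * Zxᴴ).trace := by
    rw [← Matrix.trace_conjTranspose]
    simp [add_comm]
  rw [Complex.star_def] at h
  rw [densX]
  simp only [map_add, map_mul, h, Complex.star_def, Complex.conj_conj, Complex.conj_ofNat]
  rw [add_comm ((starRingEnd ℂ) ((Z * cj K * Zᵀ) 0 1))]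

theorem trace_mul_conjTranspose_zMat (z₁ z₂ : CVec n) :
    (zMat z₁ z₂ * (zMat z₁ z₂)ᴴ).trace = ((vecSq z₁ + vecSq z₂ : ℝ) : ℂ) := by
  simp [Matrix.trace, Fin.sum_univ_two, Matrix.vecMul, dotProduct, zMat, vecSq,
    Complex.mul_conj, Complex.normSq_eq_norm_sq]

theorem trace_mul_cj {K : CMat n} (hK : Kᵀ = -K) :
    (K * cj K).trace = -((matSq K : ℝ) : ℂ) := by
  have : cj K = -Kᴴ := by rw [← cj_transpose, hK, cj_neg, neg_neg]
  rw [this, Matrix.mul_neg, Matrix.trace_neg, neg_inj]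
  simp [Matrix.trace, Matrix.mul_apply, matSq, Complex.mul_conj, Complex.normSq_eq_norm_sq]

theorem trace_wedge_mul_cj {Z : ZMat n} {K : CMat n} (hK : Kᵀ = -K) :
    ((Zᵀ * eps * Z) * cj K + K * cj (Zᵀ * eps * Z)).trace
      = -(2 * ((Z * cj K * Zᵀ) 0 1 + star ((Z * cj K * Zᵀ) 0 1))) := by
  have h1 := mul_cj_mul_transpose (Z := Z) hK
  have h2 : ((Zᵀ * eps * Z) * cj K).trace = -(2 * (Z * cj K * Zᵀ) 0 1) := by
    have : ((Zᵀ * eps * Z) * cj K).trace = (eps * (Z * cj K * Zᵀ)).trace := by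
      rw [Matrix.mul_assoc, Matrix.mul_assoc, Matrix.trace_mul_comm]
      simp [Matrix.mul_assoc]
    rw [this, h1, Matrix.mul_smul, eps_mul_eps]
    simp [eps]
    ring
  have h3 : (K * cj (Zᵀ * eps * Z)).trace = star ((Zᵀ * eps * Z) * cj K).trace := by
    rw [Matrix.trace_mul_comm, ← Matrix.trace_conjTranspose, Matrix.conjTranspose_mul,
      conjTranspose_cj, hK, Matrix.neg_mul, Matrix.trace_neg]
    have : (Zᵀ * eps * Z)ᴴ = -cj (Zᵀ * eps * Z) := by simp [Matrix.mul_assoc]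
    rw [this, Matrix.mul_neg, Matrix.trace_neg, neg_neg, Matrix.trace_mul_comm]
  rw [Matrix.trace_add, h3, h2]
  simp
  ring

/-- The real part in the derivative is taken only to have a real number: `densX` is real by
`ofReal_re_densX`. -/
theorem hasDerivAt_density {z₁ z₂ : ℝ → CVec n} {K : ℝ → CMat n} {Zx : ZMat n} {x : ℝ}
    (hZ : HasDerivAt (fun y => zMat (z₁ y) (z₂ y)) Zx x) (hK : ∀ y, (K y)ᵀ = -K y)
    (hK' : HasDerivAt K ((zMat (z₁ x) (z₂ x))ᵀ * eps * zMat (z₁ x) (z₂ x)) x) :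
    HasDerivAt (fun y => vecSq (z₁ y) + vecSq (z₂ y) + matSq (K y))
      (densX (zMat (z₁ x) (z₂ x)) Zx (K x)).re x := by
  have h1 := (hZ.matrixMul hZ.matrixConjTranspose).linearMap (Matrix.traceLinearMap (Fin 2) ℝ ℂ)
  have h2 := (hK'.matrixMul hK'.cj).linearMap (Matrix.traceLinearMap (Fin (n - 2)) ℝ ℂ)
  have h3 := (h1.sub h2).linearMap Complex.reLm
  refine (h3.congr_of_eventuallyEq (Filter.Eventually.of_forall fun y => ?_)).congr_deriv ?_
  · simp [trace_mul_conjTranspose_zMat, trace_mul_cj (hK y)]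
  · simp only [Matrix.traceLinearMap_apply, Complex.reLm_coe]
    rw [trace_wedge_mul_cj (hK x), densX, sub_neg_eq_add]

end BlockCalculus

/-! ### The NLS system in matrix form -/

section MatrixNLS

variable {n : ℕ}

theorem zMat_inj {z₁ z₂ w₁ w₂ : CVec n} : zMat z₁ z₂ = zMat w₁ w₂ ↔ z₁ = w₁ ∧ z₂ = w₂ :=
  ⟨fun h => ⟨congrFun h 0, congrFun h 1⟩, by rintro ⟨rfl, rfl⟩; rfl⟩

/-- The evolution equations of `v₁` and `v₂` are the rows of one equation for `Z`; the sign of `K`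
in the second one comes from `ε`, which maps the rows `z₁`, `z₂` to `z₂`, `-z₁`. -/
theorem nls_iff (v : ℝ → ℝ → ℝ) (v₁ v₂ : ℝ → ℝ → CVec n) (K : ℝ → ℝ → CMat n) (t x : ℝ) :
    (dt v₁ t x - (Complex.I / (chi n : ℂ)) • v₁ t x = nlsRHS v v₁ v₂ K t x ∧
      dt v₂ t x - (Complex.I / (chi n : ℂ)) • v₂ t x =
        nlsRHS v v₂ v₁ (fun s y => -K s y) t x) ↔
    zMat (dt v₁ t x) (dt v₂ t x) - (Complex.I / chi n) • zMat (v₁ t x) (v₂ t x)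
      = Complex.I • zMat (dx (dx v₁) t x) (dx (dx v₂) t x)
        + (Complex.I * (4 * v t x ^ 2 + (zMat (v₁ t x) (v₂ t x) * (zMat (v₁ t x) (v₂ t x))ᴴ).trace))
          • zMat (v₁ t x) (v₂ t x) - (2 * dx v t x : ℂ) • zMat (v₁ t x) (v₂ t x)
        - ((2 * Complex.I) • (eps * cj (zMat (dx v₁ t x) (dx v₂ t x)))
          + (4 * v t x : ℂ) • (eps * cj (zMat (v₁ t x) (v₂ t x)))
          + (2 * Complex.I) • (zMat (v₁ t x) (v₂ t x) * cj (K t x))) * K t x := by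
  rw [trace_mul_conjTranspose_zMat, ← zMat_inj]
  have e : ∀ a b : CVec n, eps * cj (zMat a b) = zMat (star b) (-star a) := fun a b => by
    ext i j
    fin_cases i <;> simp [eps, zMat, cj, Matrix.vecMul, dotProduct]
  have e1 : ∀ (a b : CVec n) (M : CMat n), zMat a b * M = zMat (a ᵥ* M) (b ᵥ* M) :=
    fun a b M => by
      ext i j
      fin_cases i <;> simp [zMat, Matrix.mul_apply, Matrix.vecMul, dotProduct]
  have e2 : ∀ (c : ℂ) (a b : CVec n), c • zMat a b = zMat (c • a) (c • b) := fun c a b => by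
    ext i j
    fin_cases i <;> simp [zMat]
  have e3 : ∀ a b c d : CVec n, zMat a b + zMat c d = zMat (a + c) (b + d) := fun a b c d => by
    ext i j
    fin_cases i <;> simp [zMat]
  have e4 : ∀ a b c d : CVec n, zMat a b - zMat c d = zMat (a - c) (b - d) := fun a b c d => by
    ext i j
    fin_cases i <;> simp [zMat]
  simp only [e, e1, e2, e3, e4]
  refine Eq.congr rfl ?_
  have hm : ∀ M : CMat n, (-M).map (starRingEnd ℂ) = -cj M := fun M => cj_neg M
  rw [zMat_inj]
  constructor
  · simp only [nlsRHS, cj]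
    push_cast
    simp only [add_assoc]
  · simp only [nlsRHS, hm]
    push_cast
    simp only [Matrix.vecMul_neg, smul_neg]
    rw [← Matrix.neg_vecMul]
    congr 1
    · congr 2
      ring_nf
    · congr 1
      module

end MatrixNLS

/-! ### From the curve flow equation to the NLS system -/

section FlowToNLS

variable {n : ℕ} {I : Set ℝ} {γ g W : ℝ → ℝ → Mat n} {v : ℝ → ℝ → ℝ}
  {v₁ v₂ : ℝ → ℝ → CVec n} {K : ℝ → ℝ → CMat n}

/-- The Maurer–Cartan equation. -/
theorem flatness (hI : IsOpen I) (hg : Smooth I g) (hO : ∀ t ∈ I, ∀ x, g t x ∈ SO n) {t : ℝ}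
    (ht : t ∈ I) (x : ℝ) :
    dt (fun t x => (g t x)ᵀ * dx g t x) t x - dx (fun t x => (g t x)ᵀ * dt g t x) t x
      + ⁅(g t x)ᵀ * dt g t x, (g t x)ᵀ * dx g t x⁆ = 0 := by
  have h1 : HasDerivAt (fun s => (g s x)ᵀ * dx g s x)
      ((dt g t x)ᵀ * dx g t x + (g t x)ᵀ * dt (dx g) t x) t :=
    (hg.hasDerivAt_dt hI ht x).matrixTranspose.matrixMul ((hg.dx hI).hasDerivAt_dt hI ht x)
  have h2 : HasDerivAt (fun y => (g t y)ᵀ * dt g t y)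
      ((dx g t x)ᵀ * dt g t x + (g t x)ᵀ * dx (dt g) t x) x :=
    (hg.hasDerivAt_dx hI ht x).matrixTranspose.matrixMul ((hg.dt hI).hasDerivAt_dx hI ht x)
  have e1 : dt (fun t x => (g t x)ᵀ * dx g t x) t x
      = (dt g t x)ᵀ * dx g t x + (g t x)ᵀ * dt (dx g) t x := h1.deriv
  have e2 : dx (fun t x => (g t x)ᵀ * dt g t x) t x
      = (dx g t x)ᵀ * dt g t x + (g t x)ᵀ * dx (dt g) t x := h2.deriv
  have s1 : ((g t x)ᵀ * dt g t x)ᵀ = -((g t x)ᵀ * dt g t x) :=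
    transpose_mul_deriv_skew (g := fun s => g s x)
    (Filter.eventually_of_mem (hI.mem_nhds ht) fun s hs => SO_transpose_mul (hO s hs x))
    (hg.hasDerivAt_dt hI ht x)
  have s2 : ((g t x)ᵀ * dx g t x)ᵀ = -((g t x)ᵀ * dx g t x) := transpose_mul_deriv_skew
    (.of_forall fun y => SO_transpose_mul (hO t ht y)) (hg.hasDerivAt_dx hI ht x)
  have hi := SO_mul_transpose (hO t ht x)
  have f : ∀ A B : Mat n, Aᵀ * B = ((g t x)ᵀ * A)ᵀ * ((g t x)ᵀ * B) := fun A B => by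
    rw [Matrix.transpose_mul, Matrix.transpose_transpose]
    calc Aᵀ * B = Aᵀ * (g t x * (g t x)ᵀ) * B := by rw [hi, mul_one]
      _ = _ := by simp only [mul_assoc]
  rw [e1, e2, hg.dx_dt hI ht x, f (dt g t x), f (dx g t x), s1, s2, Ring.lie_def]
  noncomm_ring

/-- The velocity of a moving point, in a moving frame. -/
theorem coframe_deriv {P k : ℝ → Mat n} {P' k' : Mat n} {s : ℝ}
    (hf : ∀ᶠ y in nhds s, IsFrame (P y) (k y)) (hP : HasDerivAt P P' s)
    (hk : HasDerivAt k k' s) : coframe (P s) (k s) P' = mPart ((k s)ᵀ * k') := by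
  have h1 : HasDerivAt P ((k' * J0 n + k s * 0) * (k s)ᵀ + k s * J0 n * k'ᵀ) s :=
    (((hk.matrixMul (hasDerivAt_const s (J0 n))).matrixMul
      hk.matrixTranspose)).congr_of_eventuallyEq (hf.mono fun y hy => hy.2)
  have e := hP.unique h1
  have hF := hf.self_of_nhds
  have hskew := transpose_mul_deriv_skew (hf.mono fun y hy => hy.left_inv) hk
  have hk' : k'ᵀ = -((k s)ᵀ * k') * (k s)ᵀ := by
    rw [← hskew, Matrix.transpose_mul, Matrix.transpose_transpose, mul_assoc, hF.right_inv,
      mul_one]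
  rw [hF.coframe_eq, e, hk', mPart]
  have hi := hF.left_inv_mul
  have hj := hF.left_inv
  have hkk : k' = k s * ((k s)ᵀ * k') := (hF.right_inv_mul _).symm
  rw [hkk]
  generalize (k s)ᵀ * k' = U at *
  simp only [mul_zero, add_zero, mul_assoc, hi, hj, mul_one, mul_add, add_mul, neg_mul, mul_neg,
    J0_mul_J0]
  module

/-- The blocks of an element of `so(2n)` with respect to `u(n) ⊕ m`. -/
theorem eq_laxV {V : Mat n} {Z : ZMat n} {K : CMat n} (hV : Vᵀ = -V)
    (hm : mPart V = kap n • mcx 0 (Complex.I • Z) (-(2 * Complex.I) • K)) :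
    V = laxV (clin n V).toBlocks₁₁ (clin n V).toBlocks₁₂ (clin n V).toBlocks₂₂ Z K ∧
      (clin n V).toBlocks₁₁ᴴ = -(clin n V).toBlocks₁₁ ∧
      (clin n V).toBlocks₂₂ᴴ = -(clin n V).toBlocks₂₂ := by
  obtain ⟨S, hS, e⟩ := isH_iff.1 (isH_hPart hV)
  have hc : clin n V = S := by rw [← clin_hPart, e, clin_cx]
  rw [hc]
  have h := hS
  rw [← Matrix.fromBlocks_toBlocks S, Matrix.fromBlocks_conjTranspose, Matrix.fromBlocks_neg,
    Matrix.fromBlocks_inj] at h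
  refine ⟨?_, h.1, h.2.2.2⟩
  rw [laxV, h.2.2.1, neg_neg, Matrix.fromBlocks_toBlocks, ← hm, ← e, add_comm, mPart_add_hPart]

/-- The trace of the upper left block, from the `m`-part of the zero curvature equation. -/
theorem trace_eq_of_zeroCurv {a : Matrix (Fin 2) (Fin 2) ℂ} {Z : ZMat n} (ha : aᴴ = -a)
    (h : a * eps - eps * cj a + Complex.I • (Z * Zᴴ * eps + eps * (cj Z * Zᵀ)) = 0) :
    a.trace = -(Complex.I * (Z * Zᴴ).trace) := by
  have h1 := eps_mul_transpose_add a
  have h2 := eps_mul_transpose_add (Z * Zᴴ)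
  have hc : cj a = -aᵀ := by rw [← conjTranspose_transpose', ha, Matrix.transpose_neg]
  rw [Matrix.transpose_mul, conjTranspose_transpose'] at h2
  rw [hc, Matrix.mul_neg, sub_neg_eq_add, add_comm (a * eps), h1, add_comm (Z * Zᴴ * eps), h2,
    smul_smul, ← add_smul, ← zero_smul ℂ eps, smul_eps_inj] at h
  exact eq_neg_of_add_eq_zero_left h

/-- The upper left block of the complex-linear part, as a linear map. -/
def blk₁₁ (n : ℕ) : Mat n →ₗ[ℝ] Matrix (Fin 2) (Fin 2) ℂ where
  toFun V := (clin n V).toBlocks₁₁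
  map_add' X Y := by rw [map_add]; rfl
  map_smul' c X := by rw [map_smul]; rfl

/-- The upper right block of the complex-linear part, as a linear map. -/
def blk₁₂ (n : ℕ) : Mat n →ₗ[ℝ] ZMat n where
  toFun V := (clin n V).toBlocks₁₂
  map_add' X Y := by rw [map_add]; rfl
  map_smul' c X := by rw [map_smul]; rfl

/-- The lower right block of the complex-linear part, as a linear map. -/
def blk₂₂ (n : ℕ) : Mat n →ₗ[ℝ] CMat n where
  toFun V := (clin n V).toBlocks₂₂
  map_add' X Y := by rw [map_add]; rfl
  map_smul' c X := by rw [map_smul]; rfl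

theorem eq_of_hasDerivAt_zero_real {F : Type*} [NormedAddCommGroup F] [NormedSpace ℝ F]
    {f : ℝ → F} (h : ∀ x, HasDerivAt f 0 x) (x : ℝ) : f x = f 0 :=
  eq_of_hasDerivAt_zero isOpen_univ Set.ordConnected_univ (fun t _ => h t) (Set.mem_univ 0)
    (Set.mem_univ x)

/-- In the frame of `IsU1CurveFlow.exists_frame` the Maurer–Cartan equation gives the NLS system.
The `x` derivatives of the diagonal blocks of the connection in `t` direction are known from the
zero curvature equation; their constants of integration vanish by the gauge along `x = 0` and, in
the center of `u(2)`, by the condition on the trace. -/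
theorem IsU1CurveFlow.exists_nls (hn : 3 ≤ n) (hI : IsOpen I) (hIc : I.OrdConnected)
    (h : IsU1CurveFlow I γ W) :
    ∃ (g : ℝ → ℝ → Mat n) (v : ℝ → ℝ → ℝ) (v₁ v₂ : ℝ → ℝ → CVec n) (K : ℝ → ℝ → CMat n),
      IsHasimoto I γ g v v₁ v₂ ∧ IsLinked I γ g W K ∧ IsU1NLS I v v₁ v₂ K := by
  obtain ⟨g, v, v₁, v₂, K, hH, hL, hv, hv₁, hv₂, hK, hKs, h0⟩ := h.exists_frame hn hI hIc
  have hγ := h.1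
  have hg := hH.1
  have hF := fun t ht => hH.isFramed hn hγ (t := t) ht
  have hA : ∀ t ∈ I, ∀ x, IsAdapted (γ t x) (dx γ t x) (g t x) := fun t ht => (hF t ht).adapted
  have hO : ∀ t ∈ I, ∀ x, g t x ∈ SO n := fun t ht x => (hA t ht x).1
  -- the connection along the curves
  have hU : ∀ t ∈ I, ∀ x, (g t x)ᵀ * dx g t x
      = ee n + ucx (v t x) (zMat (v₁ t x) (v₂ t x)) := fun t ht x => by
    rw [← mPart_add_hPart ((g t x)ᵀ * dx g t x)]
    congr 1
    · rw [← (hA t ht x).2.2]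
      exact (coframe_deriv (P := γ t) (.of_forall fun y => (hA t ht y).isFrame)
        (hγ.1.hasDerivAt_dx hI ht x) (hg.hasDerivAt_dx hI ht x)).symm
    · exact (hF t ht).conn_eq x
  -- the coframe in `t` direction
  have hE : ∀ t ∈ I, ∀ x, mPart ((g t x)ᵀ * dt g t x)
      = kap n • mcx 0 (Complex.I • zMat (v₁ t x) (v₂ t x)) (-(2 * Complex.I) • K t x) :=
    fun t ht x => by
      have e1 : coframe (γ t x) (g t x) (dt γ t x) = mPart ((g t x)ᵀ * dt g t x) :=
        coframe_deriv (P := fun s => γ s x) (k := fun s => g s x)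
          (Filter.eventually_of_mem (hI.mem_nhds ht) fun s hs => (hA s hs x).isFrame)
          (hγ.1.hasDerivAt_dt hI ht x) (hg.hasDerivAt_dt hI ht x)
      rw [← e1, (h.2.2 t ht).2 x, (coframe_flow_rhs hn hγ hH hL ht x).2, flow_rhs_eq]
  have hVs : ∀ t ∈ I, ∀ x, ((g t x)ᵀ * dt g t x)ᵀ = -((g t x)ᵀ * dt g t x) := fun t ht x =>
    transpose_mul_deriv_skew (g := fun s => g s x)
      (Filter.eventually_of_mem (hI.mem_nhds ht) fun s hs => SO_transpose_mul (hO s hs x))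
      (hg.hasDerivAt_dt hI ht x)
  have hV : Smooth I fun t x => (g t x)ᵀ * dt g t x :=
    hg.matrixTranspose.matrixMul (hg.dt hI)
  set V : ℝ → ℝ → Mat n := fun t x => (g t x)ᵀ * dt g t x with hVdef
  have hVe := fun t ht x => eq_laxV (hVs t ht x) (hE t ht x)
  have hZd : ∀ t ∈ I, ∀ x, HasDerivAt (fun y => zMat (v₁ t y) (v₂ t y))
      (zMat (dx v₁ t x) (dx v₂ t x)) x := fun t ht x =>
    (hv₁.hasDerivAt_dx hI ht x).zMat (hv₂.hasDerivAt_dx hI ht x)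
  have hKd := fun t ht x => hK.hasDerivAt_dx hI (t := t) ht x
  have hVd := fun t ht x => hV.hasDerivAt_dx hI (t := t) ht x
  have hVx : ∀ t ∈ I, ∀ x, dx V t x = laxV (blk₁₁ n (dx V t x)) (blk₁₂ n (dx V t x))
      (blk₂₂ n (dx V t x)) (zMat (dx v₁ t x) (dx v₂ t x)) (dx K t x) := fun t ht x => by
    have h1 := hasDerivAt_laxV ((hVd t ht x).linearMap (blk₁₁ n)) ((hVd t ht x).linearMap (blk₁₂ n))
      ((hVd t ht x).linearMap (blk₂₂ n)) (hZd t ht x) (hKd t ht x)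
    exact (hVd t ht x).unique (h1.congr_of_eventuallyEq
      (.of_forall fun y => (hVe t ht y).1))
  have hUt : ∀ t ∈ I, ∀ x, dt (fun t x => (g t x)ᵀ * dx g t x) t x
      = ucx (dt v t x) (zMat (dt v₁ t x) (dt v₂ t x)) := fun t ht x => by
    rw [dt_congr hI hU ht x]
    exact ((((hv.hasDerivAt_dt hI ht x).prodMk ((hv₁.hasDerivAt_dt hI ht x).zMat
      (hv₂.hasDerivAt_dt hI ht x))).linearMap (ucxLin n)).const_add (ee n)).deriv
  have hzc := fun t (ht : t ∈ I) x => by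
    have h1 := flatness hI hg hO ht x
    rw [hUt t ht x, hVx t ht x, hU t ht x] at h1
    have h2 : V t x = _ := (hVe t ht x).1
    rw [show (g t x)ᵀ * dt g t x = _ from h2] at h1
    exact (zeroCurv_iff hn (hVe t ht x).2.1 (hVe t ht x).2.2 (hKs t ht x)).1 h1
  have hZZ : ∀ t ∈ I, ∀ x, HasDerivAt
      (fun y => zMat (v₁ t y) (v₂ t y) * (zMat (v₁ t y) (v₂ t y))ᴴ)
      (zMat (dx v₁ t x) (dx v₂ t x) * (zMat (v₁ t x) (v₂ t x))ᴴ
        + zMat (v₁ t x) (v₂ t x) * (zMat (dx v₁ t x) (dx v₂ t x))ᴴ) x := fun t ht x =>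
    (hZd t ht x).matrixMul (hZd t ht x).matrixConjTranspose
  have hb : ∀ t ∈ I, ∀ x, (clin n (V t x)).toBlocks₁₂
      = omOff (v t x) (zMat (v₁ t x) (v₂ t x)) (zMat (dx v₁ t x) (dx v₂ t x)) (K t x) :=
    fun t ht x => omOff_iff.1 (hzc t ht x).1.2.1
  have htr : ∀ t ∈ I, ∀ x, ((clin n (V t x)).toBlocks₁₁).trace
      = -(Complex.I * (zMat (v₁ t x) (v₂ t x) * (zMat (v₁ t x) (v₂ t x))ᴴ).trace) := fun t ht x =>
    trace_eq_of_zeroCurv (hVe t ht x).2.1 (hzc t ht x).1.1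
  have ha' : ∀ t ∈ I, ∀ x, HasDerivAt (fun y => (clin n (V t y)).toBlocks₁₁)
      (blk₁₁ n (dx V t x)) x := fun t ht x => (hVd t ht x).linearMap (blk₁₁ n)
  have hd' : ∀ t ∈ I, ∀ x, HasDerivAt (fun y => (clin n (V t y)).toBlocks₂₂)
      (blk₂₂ n (dx V t x)) x := fun t ht x => (hVd t ht x).linearMap (blk₂₂ n)
  have h11 : ∀ t ∈ I, ∀ x, (2 * dt v t x * Complex.I) • (1 : Matrix (Fin 2) (Fin 2) ℂ)
      - blk₁₁ n (dx V t x) - Complex.I • (zMat (dx v₁ t x) (dx v₂ t x) * (zMat (v₁ t x) (v₂ t x))ᴴ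
        + zMat (v₁ t x) (v₂ t x) * (zMat (dx v₁ t x) (dx v₂ t x))ᴴ)
      + (Complex.I * densX (zMat (v₁ t x) (v₂ t x)) (zMat (dx v₁ t x) (dx v₂ t x)) (K t x)) • 1
      = 0 := fun t ht x => by
    have e := (hzc t ht x).2.1
    rw [hb t ht x, add_assoc, omOff_block₁₁ (hKs t ht x)] at e
    rw [← e, densX]
    abel
  have htr' : ∀ t ∈ I, ∀ x, (blk₁₁ n (dx V t x)).trace = -(Complex.I *
      (zMat (dx v₁ t x) (dx v₂ t x) * (zMat (v₁ t x) (v₂ t x))ᴴ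
        + zMat (v₁ t x) (v₂ t x) * (zMat (dx v₁ t x) (dx v₂ t x))ᴴ).trace) := fun t ht x => by
    have e1 := (ha' t ht x).linearMap (Matrix.traceLinearMap (Fin 2) ℝ ℂ)
    have e2 := (((hZZ t ht x).linearMap (Matrix.traceLinearMap (Fin 2) ℝ ℂ)).const_mul
      Complex.I).neg
    exact e1.unique (e2.congr_of_eventuallyEq (.of_forall fun y => htr t ht y))
  -- the trace of the upper left block of the zero curvature equation is the equation for `v`
  have hvt : ∀ t ∈ I, ∀ x, ((dt v t x : ℝ) : ℂ)
      = -(1 / 2) * densX (zMat (v₁ t x) (v₂ t x)) (zMat (dx v₁ t x) (dx v₂ t x)) (K t x) :=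
    fun t ht x => by
      have e := congrArg Matrix.trace (h11 t ht x)
      simp only [Matrix.trace_add, Matrix.trace_sub, Matrix.trace_smul, Matrix.trace_one,
        htr' t ht x, Matrix.trace_zero, smul_eq_mul, Fintype.card_fin] at e
      refine mul_left_cancel₀ Complex.I_ne_zero ?_
      push_cast at e
      linear_combination e / 4
  -- hence the upper left block is determined by its value at `x = 0`
  have hV0 : ∀ t ∈ I, ∃ β : ℝ, (clin n (V t 0)).toBlocks₁₁ = (2 * β * Complex.I) • 1
        + (-(Complex.I • (zMat (v₁ t 0) (v₂ t 0) * (zMat (v₁ t 0) (v₂ t 0))ᴴ))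
          + (Complex.I / 2 * (zMat (v₁ t 0) (v₂ t 0) * (zMat (v₁ t 0) (v₂ t 0))ᴴ).trace) • 1) ∧
      (clin n (V t 0)).toBlocks₂₂
        = -(Complex.I • ((zMat (v₁ t 0) (v₂ t 0))ᵀ * cj (zMat (v₁ t 0) (v₂ t 0))))
          + (2 * Complex.I) • (K t 0 * cj (K t 0)) := fun t ht => by
    obtain ⟨β, Y, e⟩ := h0 t ht
    have e1 : clin n (V t 0) = _ := (clin_hPart (V t 0)).symm.trans (congrArg (clin n) e)
    rw [map_add, ucx, gaugeBlock, clin_cx, clin_cx, Matrix.fromBlocks_add] at e1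
    rw [e1, Matrix.toBlocks_fromBlocks₁₁, Matrix.toBlocks_fromBlocks₂₂, zero_add]
    exact ⟨β, rfl, rfl⟩
  have ha : ∀ t ∈ I, ∀ x, (clin n (V t x)).toBlocks₁₁
      = -(Complex.I • (zMat (v₁ t x) (v₂ t x) * (zMat (v₁ t x) (v₂ t x))ᴴ)) := fun t ht x => by
    have hc : ∀ y, HasDerivAt (fun y => (clin n (V t y)).toBlocks₁₁
        + Complex.I • (zMat (v₁ t y) (v₂ t y) * (zMat (v₁ t y) (v₂ t y))ᴴ)) 0 y := fun y => by
      refine ((ha' t ht y).add ((hZZ t ht y).const_smul Complex.I)).congr_deriv ?_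
      have e := h11 t ht y
      rw [hvt t ht y] at e
      rw [← neg_eq_zero, ← e]
      module
    have e0 := eq_of_hasDerivAt_zero_real hc x
    obtain ⟨β, e1, -⟩ := hV0 t ht
    have e2 := htr t ht 0
    rw [e1] at e2
    simp only [Matrix.trace_add, Matrix.trace_neg, Matrix.trace_smul, Matrix.trace_one,
      smul_eq_mul, Fintype.card_fin] at e2
    -- the trace makes the constant of integration vanish
    have e3 : (2 * β * Complex.I : ℂ)
        = -(Complex.I / 2 * (zMat (v₁ t 0) (v₂ t 0) * (zMat (v₁ t 0) (v₂ t 0))ᴴ).trace) := by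
      push_cast at e2
      linear_combination e2 / 2
    simp only [e1, e3] at e0
    rw [eq_neg_iff_add_eq_zero, e0]
    module
  have hKx : ∀ t ∈ I, ∀ x, dx K t x
      = (zMat (v₁ t x) (v₂ t x))ᵀ * eps * zMat (v₁ t x) (v₂ t x) := fun t ht x =>
    (hzc t ht x).1.2.2
  have hd : ∀ t ∈ I, ∀ x, (clin n (V t x)).toBlocks₂₂
      = -(Complex.I • ((zMat (v₁ t x) (v₂ t x))ᵀ * cj (zMat (v₁ t x) (v₂ t x))))
        + (2 * Complex.I) • (K t x * cj (K t x)) := fun t ht x => by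
    have hc : ∀ y, HasDerivAt (fun y => (clin n (V t y)).toBlocks₂₂
        - (-(Complex.I • ((zMat (v₁ t y) (v₂ t y))ᵀ * cj (zMat (v₁ t y) (v₂ t y))))
          + (2 * Complex.I) • (K t y * cj (K t y)))) 0 y := fun y => by
      have hK' := hKd t ht y
      rw [hKx t ht y] at hK'
      have h1 := ((hZd t ht y).matrixTranspose.matrixMul (hZd t ht y).cj).const_smul Complex.I
      have h2 := (hK'.matrixMul hK'.cj).const_smul (2 * Complex.I)
      refine ((hd' t ht y).sub (h1.neg.add h2)).congr_deriv ?_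
      rw [(hzc t ht y).2.2.2, hb t ht y, omOff_block₂₂ (hKs t ht y), sub_self]
    obtain ⟨β, -, e1⟩ := hV0 t ht
    have e0 := eq_of_hasDerivAt_zero_real hc x
    rw [e1, sub_self] at e0
    exact sub_eq_zero.1 e0
  refine ⟨g, v, v₁, v₂, K, hH, hL, hv, hv₁, hv₂, ⟨hK, fun t ht x => ⟨hKs t ht x, ?_⟩⟩,
    fun t ht x => ⟨?_, (nls_iff v v₁ v₂ K t x).2 ?_⟩⟩
  · rw [wedge_eq, hKx t ht x]
  · have e : dx (fun s y => vecSq (v₁ s y) + vecSq (v₂ s y) + matSq (K s y)) t x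
        = (densX (zMat (v₁ t x) (v₂ t x)) (zMat (dx v₁ t x) (dx v₂ t x)) (K t x)).re :=
      (hasDerivAt_density (hZd t ht x) (hKs t ht) (hKx t ht x ▸ hKd t ht x)).deriv
    rw [e]
    have e2 := hvt t ht x
    rw [← ofReal_re_densX] at e2
    refine Complex.ofReal_injective ?_
    rw [e2]
    push_cast
    ring
  · refine (omOff_block₁₂ (v := v t x) (Zx := zMat (dx v₁ t x) (dx v₂ t x))).1 ?_
    have e := (hzc t ht x).2.2.1
    have hb' : blk₁₂ n (dx V t x) = _ := ((hVd t ht x).linearMap (blk₁₂ n)).unique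
      ((hasDerivAt_omOff (hv.hasDerivAt_dx hI ht x) (hZd t ht x)
        (((hv₁.dx hI).hasDerivAt_dx hI ht x).zMat ((hv₂.dx hI).hasDerivAt_dx hI ht x))
        (hKd t ht x)).congr_of_eventuallyEq (.of_forall fun y => hb t ht y))
    rw [hb t ht x, ha t ht x, hd t ht x, hb', hKx t ht x] at e
    exact e

end FlowToNLS

/-! ### Integration of the zero curvature equation -/

section Integration

variable {n : ℕ} {I : Set ℝ}

theorem transpose_mem_SO {g : Mat n} (hg : g ∈ SO n) : gᵀ ∈ SO n := by
  obtain ⟨h1, h2⟩ := Matrix.mem_specialOrthogonalGroup_iff.1 hg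
  refine Matrix.mem_specialOrthogonalGroup_iff.2 ⟨?_, by rw [Matrix.det_transpose, h2]⟩
  rw [Matrix.mem_orthogonalGroup_iff]
  exact (congrArg (gᵀ * ·) (Matrix.transpose_transpose g)).trans (SO_transpose_mul hg)

/-- The converse of `flatness`: the zero curvature equation is the integrability condition of
`g_x = g U`, `g_t = g V`. -/
theorem exists_frame_of_zeroCurv (hI : IsOpen I) (hIc : I.OrdConnected) {U V : ℝ → ℝ → Mat n}
    (hU : Smooth I U) (hV : Smooth I V) (hUs : ∀ t ∈ I, ∀ x, (U t x)ᵀ = -U t x)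
    (hVs : ∀ t ∈ I, ∀ x, (V t x)ᵀ = -V t x)
    (hz : ∀ t ∈ I, ∀ x, dt U t x - dx V t x + ⁅V t x, U t x⁆ = 0) :
    ∃ g : ℝ → ℝ → Mat n, Smooth I g ∧ ∀ t ∈ I, ∀ x, g t x ∈ SO n ∧ dx g t x = g t x * U t x ∧
      dt g t x = g t x * V t x := by
  obtain rfl | ⟨t₀, ht₀⟩ := I.eq_empty_or_nonempty
  · exact ⟨0, Smooth.const 0, by simp⟩
  obtain ⟨b, hb, hb0, hb'⟩ := exists_bilinear_curve (LinearMap.mul ℝ (Mat n)) hI hIc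
    (hV.slice_left 0).neg ht₀ 1
  obtain ⟨h, hh, h0, hh'⟩ := exists_bilinear_flow (LinearMap.mul ℝ (Mat n)) hI hIc
    (M := fun t x => -U t x) (ContDiffOn.neg hU) hb
  have hbd : ∀ t ∈ I, HasDerivAt b (-V t 0 * b t) t := hb'
  have hhd : ∀ t ∈ I, ∀ x, HasDerivAt (h t) (-U t x * h t x) x := hh'
  have hbO : ∀ t ∈ I, b t ∈ SO n := fun t ht =>
    mem_SO_of_linear hI hIc hbd (fun s hs => by simp [hVs s hs]) ht₀ ht (hb0 ▸ one_mem _)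
  have hO : ∀ t ∈ I, ∀ x, h t x ∈ SO n := fun t ht x =>
    mem_SO_of_linear isOpen_univ Set.ordConnected_univ (fun y _ => hhd t ht y)
      (fun y _ => by simp [hUs t ht]) (Set.mem_univ 0) (Set.mem_univ x) (h0 t ht ▸ hbO t ht)
  have hdx : ∀ t ∈ I, ∀ x, dx h t x = -U t x * h t x := fun t ht x => (hhd t ht x).deriv
  have hdt : ∀ t ∈ I, ∀ x, dt h t x = -V t x * h t x := fun t ht x => by
    -- `E = h_t + V h` solves `E_x = -U E`, with `E = 0` at `x = 0`
    have hE : ∀ y, HasDerivAt (fun y => dt h t y + V t y * h t y)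
        (-U t y * (dt h t y + V t y * h t y)) y := fun y => by
      have h1 := (hh.dt hI).hasDerivAt_dx hI ht y
      have h2 : HasDerivAt (fun s => -U s y * h s y)
          (-dt U t y * h t y + -U t y * dt h t y) t :=
        (hU.hasDerivAt_dt hI ht y).neg.matrixMul (hh.hasDerivAt_dt hI ht y)
      have e : dx (dt h) t y = -dt U t y * h t y + -U t y * dt h t y := by
        rw [hh.dx_dt hI ht, dt_congr hI hdx ht y]
        exact h2.deriv
      rw [e] at h1
      have h3 := (hV.hasDerivAt_dx hI ht y).matrixMul (hhd t ht y)
      refine (h1.add h3).congr_deriv ?_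
      have e2 : dx V t y = dt U t y + ⁅V t y, U t y⁆ := by
        rw [eq_comm, ← sub_eq_zero, ← hz t ht y]
        abel
      rw [e2, Ring.lie_def]
      noncomm_ring
    have hc : ∀ y, HasDerivAt (fun y => (h t y)ᵀ * (dt h t y + V t y * h t y)) 0 y := fun y => by
      refine ((hhd t ht y).matrixTranspose.matrixMul (hE y)).congr_deriv ?_
      simp [Matrix.transpose_mul, hUs t ht, mul_assoc]
    have e0 : dt h t 0 = -V t 0 * b t :=
      (dt_congr hI (f := fun s _ => b s) (f₁ := fun s _ => h s 0) (fun s hs _ => h0 s hs)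
        ht 0).trans (hbd t ht).deriv
    have e1 := eq_of_hasDerivAt_zero_real hc x
    rw [e0, h0 t ht, neg_mul, neg_add_cancel, mul_zero] at e1
    have e2 := congrArg (h t x * ·) e1
    simp only [mul_zero, ← mul_assoc, SO_mul_transpose (hO t ht x), one_mul] at e2
    rw [neg_mul]
    exact eq_neg_of_add_eq_zero_left e2
  refine ⟨fun t x => (h t x)ᵀ, hh.matrixTranspose, fun t ht x =>
    ⟨transpose_mem_SO (hO t ht x), ?_, ?_⟩⟩
  · refine (hh.hasDerivAt_dx hI ht x).matrixTranspose.deriv.trans ?_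
    rw [hdx t ht x, Matrix.transpose_mul, Matrix.transpose_neg, hUs t ht, neg_neg]
  · refine (hh.hasDerivAt_dt hI ht x).matrixTranspose.deriv.trans ?_
    rw [hdt t ht x, Matrix.transpose_mul, Matrix.transpose_neg, hVs t ht, neg_neg]

end Integration

/-! ### From the NLS system to the curve flow equation -/

section NLSToFlow

variable {n : ℕ} {I : Set ℝ} {v : ℝ → ℝ → ℝ} {v₁ v₂ : ℝ → ℝ → CVec n} {K : ℝ → ℝ → CMat n}

theorem Smooth.cj {l m : Type*} [Fintype l] [Fintype m] {A : ℝ → ℝ → Matrix l m ℂ}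
    (hA : Smooth I A) : Smooth I fun t x => cj (A t x) :=
  hA.linearMap (cjLin l m)

theorem Smooth.matrixConjTranspose {l m : Type*} [Fintype l] [Fintype m]
    {A : ℝ → ℝ → Matrix l m ℂ} (hA : Smooth I A) : Smooth I fun t x => (A t x)ᴴ :=
  hA.cj.matrixTranspose

theorem Smooth.const_smul_complex {l m : Type*} [Fintype l] [Fintype m] (c : ℂ)
    {A : ℝ → ℝ → Matrix l m ℂ} (hA : Smooth I A) : Smooth I fun t x => c • A t x :=
  ContDiffOn.const_smul c hA

theorem Smooth.omOff {Z Zx : ℝ → ℝ → ZMat n} (hv : Smooth I v) (hZ : Smooth I Z)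
    (hZx : Smooth I Zx) (hK : Smooth I K) :
    Smooth I fun t x => omOff (v t x) (Z t x) (Zx t x) (K t x) := by
  have e : ∀ M : ℝ → ℝ → ZMat n, Smooth I M → Smooth I fun t x => eps * SOU.cj (M t x) :=
    fun M hM => (Smooth.const eps).matrixMul hM.cj
  have h2 : Smooth I fun t x => (2 * v t x : ℂ) • (eps * SOU.cj (Z t x)) :=
    ContDiffOn.smul (contDiffOn_const.mul (Complex.ofRealCLM.contDiff.comp_contDiffOn hv)) (e _ hZ)
  have h1 : Smooth I fun t x => -(Complex.I • (eps * SOU.cj (Zx t x))) :=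
    ContDiffOn.neg ((e _ hZx).const_smul_complex Complex.I)
  exact (h1.sub h2).sub ((hZ.matrixMul hK.cj).const_smul_complex (2 * Complex.I))

theorem Smooth.prodMk {E F : Type*} [NormedAddCommGroup E] [NormedSpace ℝ E]
    [NormedAddCommGroup F] [NormedSpace ℝ F] {f : ℝ → ℝ → E} {k : ℝ → ℝ → F} (hf : Smooth I f)
    (hk : Smooth I k) : Smooth I fun t x => (f t x, k t x) :=
  ContDiffOn.prodMk hf hk

theorem Smooth.laxV {a : ℝ → ℝ → Matrix (Fin 2) (Fin 2) ℂ} {b Z : ℝ → ℝ → ZMat n}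
    {d : ℝ → ℝ → CMat n} (ha : Smooth I a) (hb : Smooth I b) (hd : Smooth I d) (hZ : Smooth I Z)
    (hK : Smooth I K) :
    Smooth I fun t x => laxV (a t x) (b t x) (d t x) (Z t x) (K t x) :=
  ((ha.prodMk (hb.prodMk hd)).linearMap (blockLin n)).add
    ((((Smooth.const (0 : ℂ)).prodMk ((hZ.const_smul_complex Complex.I).prodMk
        (hK.const_smul_complex (-(2 * Complex.I))))).linearMap (mcxLin n)).const_smul (kap n))

theorem isH_block {a : Matrix (Fin 2) (Fin 2) ℂ} {b : ZMat n} {d : CMat n} (ha : aᴴ = -a)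
    (hd : dᴴ = -d) : IsH (cx (Matrix.fromBlocks a b (-bᴴ) d) 0) := by
  refine isH_iff.2 ⟨_, ?_, rfl⟩
  rw [Matrix.fromBlocks_conjTranspose, Matrix.fromBlocks_neg]
  simp [ha, hd]

/-- The connection and the coframe in `t` direction, of a solution of the NLS system. -/
def nlsV (v : ℝ) (Z Zx : ZMat n) (K : CMat n) : Mat n :=
  laxV (-(Complex.I • (Z * Zᴴ))) (omOff v Z Zx K)
    (-(Complex.I • (Zᵀ * cj Z)) + (2 * Complex.I) • (K * cj K)) Z K

theorem Smooth.nlsV {Z Zx : ℝ → ℝ → ZMat n} (hv : Smooth I v) (hZ : Smooth I Z)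
    (hZx : Smooth I Zx) (hK : Smooth I K) :
    Smooth I fun t x => nlsV (v t x) (Z t x) (Zx t x) (K t x) := by
  have ha : Smooth I fun t x => -(Complex.I • (Z t x * (Z t x)ᴴ)) :=
    ContDiffOn.neg ((hZ.matrixMul hZ.matrixConjTranspose).const_smul_complex Complex.I)
  have hd : Smooth I fun t x => -(Complex.I • ((Z t x)ᵀ * SOU.cj (Z t x)))
        + (2 * Complex.I) • (K t x * SOU.cj (K t x)) :=
    Smooth.add (ContDiffOn.neg ((hZ.matrixTranspose.matrixMul hZ.cj).const_smul_complex Complex.I))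
      ((hK.matrixMul hK.cj).const_smul_complex _)
  exact Smooth.laxV ha (hv.omOff hZ hZx hK) hd hZ hK

theorem conjTranspose_block₁₁ (Z : ZMat n) :
    (-(Complex.I • (Z * Zᴴ)))ᴴ = -(-(Complex.I • (Z * Zᴴ))) := by simp

theorem conjTranspose_block₂₂ (Z : ZMat n) {K : CMat n} (hK : Kᵀ = -K) :
    (-(Complex.I • (Zᵀ * cj Z)) + (2 * Complex.I) • (K * cj K))ᴴ
      = -(-(Complex.I • (Zᵀ * cj Z)) + (2 * Complex.I) • (K * cj K)) := by
  have hKc : Kᴴ = -cj K := by rw [← cj_transpose, hK, cj_neg]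
  simp [hK, hKc, add_comm]

/-- `nlsV` takes values in `so(2n)`, and its `m`-part is the velocity of the curve flow. -/
theorem nlsV_eq (v : ℝ) (Z Zx : ZMat n) {K : CMat n} (hK : Kᵀ = -K) :
    (nlsV v Z Zx K)ᵀ = -nlsV v Z Zx K ∧
      mPart (nlsV v Z Zx K) = kap n • mcx 0 (Complex.I • Z) (-(2 * Complex.I) • K) := by
  have hH := isH_block (b := omOff v Z Zx K) (conjTranspose_block₁₁ Z) (conjTranspose_block₂₂ Z hK)
  have hM : IsM (kap n • mcx 0 (Complex.I • Z) (-(2 * Complex.I) • K)) := by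
    rw [mcx_smul]
    exact isM_mcx (by simp [hK])
  rw [nlsV, laxV]
  refine ⟨by rw [Matrix.transpose_add, hH.1, hM.1, neg_add], ?_⟩
  rw [add_comm]
  exact hM.mPart_add hH

/-- The NLS system implies the zero curvature equation for `e + u` and `nlsV`. -/
theorem IsU1NLS.zeroCurv (hn : 3 ≤ n) (hI : IsOpen I) (h : IsU1NLS I v v₁ v₂ K) {t : ℝ}
    (ht : t ∈ I) (x : ℝ) :
    dt (fun t x => ee n + ucx (v t x) (zMat (v₁ t x) (v₂ t x))) t x
      - dx (fun t x => nlsV (v t x) (zMat (v₁ t x) (v₂ t x))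
          (zMat (dx v₁ t x) (dx v₂ t x)) (K t x)) t x
      + ⁅nlsV (v t x) (zMat (v₁ t x) (v₂ t x)) (zMat (dx v₁ t x) (dx v₂ t x)) (K t x),
        ee n + ucx (v t x) (zMat (v₁ t x) (v₂ t x))⁆ = 0 := by
  obtain ⟨hv, hv₁, hv₂, hK, hnls⟩ := h
  have hKs := fun x => (hK.2 t ht x).1
  have hKx : HasDerivAt (K t)
      ((zMat (v₁ t x) (v₂ t x))ᵀ * eps * zMat (v₁ t x) (v₂ t x)) x := by
    rw [← wedge_eq, ← (hK.2 t ht x).2]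
    exact hK.1.hasDerivAt_dx hI ht x
  have hZd : HasDerivAt (fun y => zMat (v₁ t y) (v₂ t y)) (zMat (dx v₁ t x) (dx v₂ t x)) x :=
    (hv₁.hasDerivAt_dx hI ht x).zMat (hv₂.hasDerivAt_dx hI ht x)
  have hUt : dt (fun t x => ee n + ucx (v t x) (zMat (v₁ t x) (v₂ t x))) t x
      = ucx (dt v t x) (zMat (dt v₁ t x) (dt v₂ t x)) :=
    ((((hv.hasDerivAt_dt hI ht x).prodMk ((hv₁.hasDerivAt_dt hI ht x).zMat
      (hv₂.hasDerivAt_dt hI ht x))).linearMap (ucxLin n)).const_add (ee n)).deriv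
  have had := ((hZd.matrixMul hZd.matrixConjTranspose).const_smul Complex.I).neg
  have hdd := ((hZd.matrixTranspose.matrixMul hZd.cj).const_smul
    Complex.I).neg.add ((hKx.matrixMul hKx.cj).const_smul (2 * Complex.I))
  have hbd := hasDerivAt_omOff (hv.hasDerivAt_dx hI ht x) hZd
    (((hv₁.dx hI).hasDerivAt_dx hI ht x).zMat ((hv₂.dx hI).hasDerivAt_dx hI ht x)) hKx
  have hVx := (hasDerivAt_laxV had hbd hdd hZd hKx).deriv
  have hVx' : dx (fun t x => nlsV (v t x) (zMat (v₁ t x) (v₂ t x))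
          (zMat (dx v₁ t x) (dx v₂ t x)) (K t x)) t x = _ := hVx
  rw [hUt, hVx']
  refine (zeroCurv_iff hn (conjTranspose_block₁₁ _) (conjTranspose_block₂₂ _ (hKs x)) (hKs x)).2
    ⟨⟨?_, omOff_iff.2 rfl, rfl⟩, ?_, ?_, ?_⟩
  · simp [Matrix.mul_assoc]
  · rw [add_assoc, omOff_block₁₁ (hKs x)]
    have e := (hasDerivAt_density hZd hKs hKx).deriv
    have e1 : dt v t x = -(1 / 2) * (densX (zMat (v₁ t x) (v₂ t x))
        (zMat (dx v₁ t x) (dx v₂ t x)) (K t x)).re := by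
      rw [(hnls t ht x).1, ← e]
      rfl
    have e2 := ofReal_re_densX (zMat (v₁ t x) (v₂ t x)) (zMat (dx v₁ t x) (dx v₂ t x)) (K t x)
    rw [e1]
    push_cast
    rw [e2, densX]
    module
  · exact omOff_block₁₂.2 ((nls_iff v v₁ v₂ K t x).1 (hnls t ht x).2)
  · rw [omOff_block₂₂ (hKs x)]

/-- `e` is a unit vector. -/
theorem metric_self_of_isAdapted (hn : 3 ≤ n) {P X g : Mat n} (h : IsAdapted P X g) :
    metric P X X = 1 := by
  rw [h.isFrame.metric_eq, h.2.2, ee_eq, killing_mcx _ _ _ _ _ _ (by simp)]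
  have e := chi_mul_kap hn
  simp [chi] at e ⊢
  linear_combination e

/-- The frame integrating the zero curvature equation projects to the curve flow. -/
theorem IsU1NLS.exists_flow (hn : 3 ≤ n) (hI : IsOpen I) (hIc : I.OrdConnected)
    (h : IsU1NLS I v v₁ v₂ K) :
    ∃ γ g W : ℝ → ℝ → Mat n,
        IsU1CurveFlow I γ W ∧ IsHasimoto I γ g v v₁ v₂ ∧ IsLinked I γ g W K := by
  obtain ⟨hv, hv₁, hv₂, hK, -⟩ := id h
  have hKs := fun t ht x => (hK.2 t ht x).1
  have hZ := hv₁.zMat hv₂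
  obtain ⟨g, hg, hgUV⟩ := exists_frame_of_zeroCurv hI hIc
    ((Smooth.const (ee n)).add ((hv.prodMk hZ).linearMap (ucxLin n)))
    (hv.nlsV hZ ((hv₁.dx hI).zMat (hv₂.dx hI)) hK.1)
    (fun t _ x => (Matrix.transpose_add _ _).trans
      ((congrArg₂ (· + ·) (isM_ee n).1 (isH_ucx _ _).1).trans (neg_add _ _).symm))
    (fun t ht x => (nlsV_eq _ _ _ (hKs t ht x)).1)
    (fun t ht x => h.zeroCurv hn hI ht x)
  have hO := fun t ht x => (hgUV t ht x).1
  set γ : ℝ → ℝ → Mat n := fun t x => g t x * J0 n * (g t x)ᵀ with hγdef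
  have hγs : Smooth I γ := (hg.matrixMul (Smooth.const (J0 n))).matrixMul hg.matrixTranspose
  have hF : ∀ t ∈ I, ∀ x, IsFrame (γ t x) (g t x) := fun t ht x => ⟨hO t ht x, rfl⟩
  have hSp : ∀ t ∈ I, ∀ x, γ t x ∈ Space n := fun t ht x => ⟨g t x, hO t ht x, rfl⟩
  have hgU : ∀ t ∈ I, ∀ x, (g t x)ᵀ * dx g t x
      = ee n + ucx (v t x) (zMat (v₁ t x) (v₂ t x)) := fun t ht x => by
    rw [(hgUV t ht x).2.1, (hF t ht x).left_inv_mul]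
    rfl
  have hA : ∀ t ∈ I, ∀ x, IsAdapted (γ t x) (dx γ t x) (g t x) := fun t ht x => by
    refine ⟨hO t ht x, rfl, ?_⟩
    have e := coframe_deriv (P := γ t) (.of_forall fun y => hF t ht y)
      (hγs.hasDerivAt_dx hI ht x) (hg.hasDerivAt_dx hI ht x)
    rw [e, hgU t ht x]
    exact (isM_ee n).mPart_add (isH_ucx _ _)
  have hγ : IsUnitFlow I γ := ⟨hγs, fun t ht => ⟨hγs.slice ht, fun x => ⟨hSp t ht x,
    ⟨isTangent_of_hasDerivAt (.of_forall fun y => hSp t ht y) (hγs.hasDerivAt_dx hI ht x),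
      g t x, hA t ht x⟩, metric_self_of_isAdapted hn (hA t ht x)⟩⟩⟩
  have hH : IsHasimoto I γ g v v₁ v₂ := by
    have hc : ∀ t ∈ I, ∀ x, conn (g t) x = ucx (v t x) (zMat (v₁ t x) (v₂ t x)) :=
      fun t ht x => by
        rw [conn, show (g t x)ᵀ * deriv (g t) x = _ from hgU t ht x]
        exact (isM_ee n).hPart_add (isH_ucx _ _)
    refine ⟨hg, fun t ht => ⟨⟨hg.slice ht, fun x => ⟨hA t ht x, ?_⟩⟩, fun x => ?_⟩⟩
    · rw [hc t ht x]
      exact ucx_mem_hPerp hn _ _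
    · rw [hc t ht x, sqrt_smul_lie_ee_perpMat hn]
  have hWM : ∀ t ∈ I, ∀ x, IsM (mcx 0 (0 : ZMat n) ((4 * kap n ^ 3) • (Complex.I • K t x))) :=
    fun t ht x => isM_mcx (by simp [hKs t ht])
  have hL : IsLinked I γ g
      (fun t x => frameVec (g t x) (mcx 0 0 ((4 * kap n ^ 3) • (Complex.I • K t x)))) K :=
    fun t ht x => ⟨(hF t ht x).isTangent_frameVec (hWM t ht x), by
      rw [linked_eq, (hF t ht x).coframe_frameVec (hWM t ht x)]⟩
  refine ⟨γ, g, _, (isU1CurveFlow_iff hn hI hγ hH hK hL).2 fun t ht x => ?_, hH, hL⟩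
  have e := coframe_deriv (P := fun s => γ s x) (k := fun s => g s x)
    (Filter.eventually_of_mem (hI.mem_nhds ht) fun s hs => hF s hs x)
    (hγs.hasDerivAt_dt hI ht x) (hg.hasDerivAt_dt hI ht x)
  rw [(hgUV t ht x).2.2, (hF t ht x).left_inv_mul, (nlsV_eq _ _ _ (hKs t ht x)).2] at e
  exact e.trans (flow_rhs_eq _ _ _).symm

end NLSToFlow

/-! ### Invariance under `SO(2n)` -/

section Invariance

variable {n : ℕ} {I : Set ℝ} {γ g W : ℝ → ℝ → Mat n} {A P X Z h : Mat n}

theorem gen_conj (hA : A ∈ SO n) (P Z : Mat n) :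
    gen (A * P * Aᵀ) (A * Z * Aᵀ) = A * gen P Z * Aᵀ := by
  have e : A * Z * Aᵀ * (A * P * Aᵀ) = A * Z * (Aᵀ * A) * P * Aᵀ := by simp only [mul_assoc]
  rw [gen, gen, e, SO_transpose_mul hA, mul_one]
  simp [mul_assoc]

/-- An isometry moves points, tangent vectors and frames together and does not change components.
-/
theorem coframe_conj (hA : A ∈ SO n) (P h Z : Mat n) :
    coframe (A * P * Aᵀ) (A * h) (A * Z * Aᵀ) = coframe P h Z := by
  rw [coframe, gen_conj hA, Matrix.transpose_mul, coframe]
  calc hᵀ * Aᵀ * (A * gen P Z * Aᵀ) * (A * h)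
      = hᵀ * (Aᵀ * A) * gen P Z * (Aᵀ * A) * h := by simp only [mul_assoc]
    _ = _ := by rw [SO_transpose_mul hA, mul_one, mul_one]

theorem IsTangent.conj (hA : A ∈ SO n) (hZ : IsTangent P Z) :
    IsTangent (A * P * Aᵀ) (A * Z * Aᵀ) := by
  have e : ∀ B C : Mat n, A * B * Aᵀ * (A * C * Aᵀ) = A * (B * C) * Aᵀ := fun B C => by
    calc _ = A * B * (Aᵀ * A) * C * Aᵀ := by simp only [mul_assoc]
      _ = _ := by rw [SO_transpose_mul hA, mul_one]; simp only [mul_assoc]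
  refine ⟨by simp [Matrix.transpose_mul, hZ.1, mul_assoc], ?_⟩
  rw [e, e, hZ.2]
  simp

theorem IsAdapted.conj (hA : A ∈ SO n) (hh : IsAdapted P X h) :
    IsAdapted (A * P * Aᵀ) (A * X * Aᵀ) (A * h) :=
  ⟨mul_mem hA hh.1, by rw [hh.2.1, Matrix.transpose_mul]; simp only [mul_assoc],
    by rw [coframe_conj hA, hh.2.2]⟩

theorem Space.conj (hA : A ∈ SO n) (hP : P ∈ Space n) : A * P * Aᵀ ∈ Space n := by
  obtain ⟨h, hh, rfl⟩ := hP
  exact ⟨A * h, mul_mem hA hh, by rw [Matrix.transpose_mul]; simp only [mul_assoc]⟩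

theorem Smooth.conj (hγ : Smooth I γ) (A : Mat n) : Smooth I fun t x => A * γ t x * Aᵀ :=
  ((Smooth.const A).matrixMul hγ).matrixMul (Smooth.const Aᵀ)

theorem _root_.HasDerivAt.conjMat {c : ℝ → Mat n} {c' : Mat n} {x : ℝ} (hc : HasDerivAt c c' x)
    (A : Mat n) : HasDerivAt (fun y => A * c y * Aᵀ) (A * c' * Aᵀ) x :=
  (((hasDerivAt_const x A).matrixMul hc).matrixMul (hasDerivAt_const x Aᵀ)).congr_deriv (by simp)

theorem dx_conj (hI : IsOpen I) (hγ : Smooth I γ) (A : Mat n) {t : ℝ} (ht : t ∈ I)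
    (x : ℝ) : dx (fun t x => A * γ t x * Aᵀ) t x = A * dx γ t x * Aᵀ :=
  ((hγ.hasDerivAt_dx hI ht x).conjMat A).deriv

theorem dt_conj (hI : IsOpen I) (hγ : Smooth I γ) (A : Mat n) {t : ℝ} (ht : t ∈ I)
    (x : ℝ) : dt (fun t x => A * γ t x * Aᵀ) t x = A * dt γ t x * Aᵀ :=
  ((hγ.hasDerivAt_dt hI ht x).conjMat A).deriv

theorem IsUnitFlow.conj (hn : 3 ≤ n) (hI : IsOpen I) (hA : A ∈ SO n) (hγ : IsUnitFlow I γ) :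
    IsUnitFlow I fun t x => A * γ t x * Aᵀ := by
  refine ⟨hγ.1.conj A, fun t ht => ⟨(hγ.1.conj A).slice ht, fun x => ?_⟩⟩
  obtain ⟨hT, k, hk⟩ := hγ.inClass ht x
  have e : deriv (fun x => A * γ t x * Aᵀ) x = A * dx γ t x * Aᵀ := dx_conj hI hγ.1 A ht x
  rw [e]
  exact ⟨Space.conj hA ((hγ.2 t ht).2 x).1, ⟨hT.conj hA, A * k, hk.conj hA⟩,
    metric_self_of_isAdapted hn (hk.conj hA)⟩

theorem IsHasimoto.conj {v : ℝ → ℝ → ℝ} {v₁ v₂ : ℝ → ℝ → CVec n} (hI : IsOpen I)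
    (hA : A ∈ SO n) (hγ : IsUnitFlow I γ) (h : IsHasimoto I γ g v v₁ v₂) :
    IsHasimoto I (fun t x => A * γ t x * Aᵀ) (fun t x => A * g t x) v v₁ v₂ := by
  have hg : Smooth I fun t x => A * g t x := (Smooth.const A).matrixMul h.1
  have hc : ∀ t ∈ I, ∀ x, conn (fun x => A * g t x) x = conn (g t) x := fun t ht x => by
    have e : HasDerivAt (fun x => A * g t x) (A * deriv (g t) x) x :=
      ((hasDerivAt_const x A).matrixMul (h.1.hasDerivAt_dx hI ht x)).congr_deriv
        (by rw [zero_mul, zero_add]; rfl)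
    have e' : deriv (fun x => A * g t x) x = A * deriv (g t) x := e.deriv
    rw [conn, e', Matrix.transpose_mul, mul_assoc, ← mul_assoc Aᵀ, SO_transpose_mul hA,
      one_mul, conn]
  refine ⟨hg, fun t ht => ⟨⟨hg.slice ht, fun x => ⟨?_, ?_⟩⟩, fun x => ?_⟩⟩
  · have e : deriv (fun x => A * γ t x * Aᵀ) x = A * dx γ t x * Aᵀ := dx_conj hI hγ.1 A ht x
    rw [e]
    exact ((h.2 t ht).1.2 x).1.conj hA
  · rw [hc t ht x]
    exact ((h.2 t ht).1.2 x).2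
  · rw [hc t ht x]
    exact (h.2 t ht).2 x

/-- By `isU1CurveFlow_iff` the equation is one between components in a parallel frame, and these
are unchanged when the frame is moved along. -/
theorem IsU1CurveFlow.conj (hn : 3 ≤ n) (hI : IsOpen I) (hIc : I.OrdConnected) (hA : A ∈ SO n)
    (h : IsU1CurveFlow I γ W) :
    IsU1CurveFlow I (fun t x => A * γ t x * Aᵀ) (fun t x => A * W t x * Aᵀ) := by
  obtain ⟨g, v, v₁, v₂, K, hH, hL, hnls⟩ := h.exists_nls hn hI hIc
  have hK := hnls.2.2.2.1
  refine (isU1CurveFlow_iff hn hI (h.1.conj hn hI hA) (hH.conj hI hA h.1) hK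
    fun t ht x => ⟨(hL t ht x).1.conj hA, ?_⟩).2 fun t ht x => ?_
  · rw [coframe_conj hA]
    exact (hL t ht x).2
  · rw [dt_conj hI h.1.1 A ht x, coframe_conj hA]
    exact (isU1CurveFlow_iff hn hI h.1 hH hK hL).1 h t ht x

end Invariance

/-! ### Preservation of arclength -/

section Arclength

variable {n : ℕ} {c : ℝ → Mat n}

/-- A curve, viewed as a stationary flow, has a parallel frame. -/
theorem IsUnitCurve.exists_isFramed (hn : 3 ≤ n) (hc : IsUnitCurve c) :
    ∃ (g : ℝ → Mat n) (v : ℝ → ℝ) (Z : ℝ → ZMat n), IsFramed c g v Z ∧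
      ∀ x, ∃ Z', HasDerivAt Z Z' x := by
  have hI := isOpen_univ (X := ℝ)
  have hγ : IsUnitFlow Set.univ fun _ : ℝ => c :=
    ⟨ContDiff.contDiffOn (hc.1.comp contDiff_snd), fun _ _ => hc⟩
  obtain ⟨g, hg, hA, hgx, -⟩ := hγ.exists_frame hn hI Set.ordConnected_univ
    (C := fun _ => 0) contDiffOn_const (by simp) (by simp [Ring.lie_def])
    (by simp [Ring.lie_def])
  obtain ⟨v, v₁, v₂, -, hv₁, hv₂, hH⟩ := exists_isHasimoto hn hI hg hA fun t ht x => by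
    obtain ⟨b, Z, hbZ⟩ := hγ.exists_covDeriv_dx hn hI ht x (hA t ht x)
    have hF := (hA t ht x).isFrame
    have e := hF.rotGen_eq hn (hA t ht x).gen_eq hbZ
    rw [(hA t ht x).2.2] at e
    refine ⟨√(chi n) * b / 4, √(chi n) • Z, ?_⟩
    have e2 : (g t x)ᵀ * dx g t x = ee n + ucx (√(chi n) * b / 4) (√(chi n) • Z) := by
      rw [hgx t ht x]
      refine (congrArg (fun M => (g t x)ᵀ * (M * g t x)) e).trans ?_
      simp only [mul_assoc, hF.left_inv, hF.left_inv_mul, mul_one]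
    exact (congrArg hPart e2).trans ((isM_ee n).hPart_add (isH_ucx _ _))
  exact ⟨g 0, v 0, _, hH.isFramed hn hγ (Set.mem_univ 0), fun x =>
    ⟨_, (hv₁.hasDerivAt_dx hI (Set.mem_univ 0) x).zMat (hv₂.hasDerivAt_dx hI (Set.mem_univ 0) x)⟩⟩

theorem killing_add_left (A B C : Mat n) : killing (A + B) C = killing A C + killing B C := by
  rw [killing, killing, killing, Matrix.add_mul, Matrix.trace_add, mul_add]

theorem killing_neg_left (A B : Mat n) : killing (-A) B = -killing A B := by
  rw [killing, killing, Matrix.neg_mul, Matrix.trace_neg, mul_neg]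

/-- `e` is orthogonal to every vector whose block of size two vanishes. -/
theorem killing_mcx_ee (Z : ZMat n) (H : CMat n) : killing (mcx 0 Z H) (ee n) = 0 := by
  rw [ee_eq, killing_mcx _ _ _ _ _ _ (by simp)]
  simp

/-- The component of `[u, J N]` along `e` is proportional to the real part of `i |Z|²`. -/
theorem metric_nabla_Jmap_normal (hn : 3 ≤ n) (hc : IsUnitCurve c) (x : ℝ) :
    metric (c x) (nabla c (fun y => Jmap (c y) (deriv c y) (normal c y)) x) (deriv c x) = 0 := by
  obtain ⟨g, v, Z, hF, hZ⟩ := hc.exists_isFramed hn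
  obtain ⟨Z', hZ'⟩ := hZ x
  have hcJ : ∀ y, coframe (c y) (g y) (Jmap (c y) (deriv c y) (normal c y))
      = mcx 0 (Complex.I • (kap n • Z y)) 0 := fun y => by
    rw [(hF.adapted y).coframe_Jmap hn (hF.coframe_normal y).1 (hF.coframe_normal y).2, smul_zero]
  have hd : HasDerivAt (fun y => coframe (c y) (g y) (Jmap (c y) (deriv c y) (normal c y)))
      (mcx 0 (Complex.I • (kap n • Z')) 0) x := by
    simp only [hcJ]
    exact (((hasDerivAt_const x (0 : ℂ)).prodMk (((hZ'.const_smul (kap n)).const_smul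
      Complex.I).prodMk (hasDerivAt_const x (0 : CMat n)))).linearMap (mcxLin n))
  have e := (hF.coframe_nabla (fun y => isTangent_Jmap ⟨_, hF.adapted y⟩
    (hF.coframe_normal y).1) hd).2
  rw [(hF.adapted x).isFrame.metric_eq, e, (hF.adapted x).2.2, hcJ, killing_add_left,
    killing_mcx_ee, lie_swap, killing_neg_left, killing_lie, lie_ucx_ee, mcx_smul,
    killing_mcx _ _ _ _ _ _ (by simp)]
  -- `i |Z|²` is imaginary
  have hT := congrArg Complex.im (star_trace_mul_conjTranspose (Z x))
  have hT' : (Z x * (Z x)ᴴ).trace.im = 0 := by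
    rw [Complex.star_def, Complex.conj_im] at hT
    linarith
  simp [hT']

/-- The components of `W` lie in the block `H` and commute with `e`, so neither the source nor the
curvature term has a component along `e`. -/
theorem IsOpInv.metric_nabla (hn : 3 ≤ n) (hc : IsUnitCurve c) {W : ℝ → Mat n}
    (hW : IsOpInv c (source c) W) (x : ℝ) : metric (c x) (nabla c W x) (deriv c x) = 0 := by
  obtain ⟨g, v, Z, hF, -⟩ := hc.exists_isFramed hn
  obtain ⟨-, hWp, Q, hQ, hWQ⟩ := hW
  have hA := hF.adapted x
  have hX := hF.tangent x
  obtain ⟨Y, hY, hWY⟩ := hWp x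
  obtain ⟨a, z, H, hH, hcY⟩ := hA.isFrame.exists_mcx hY.1
  obtain ⟨-, rfl⟩ := (hA.isPar_iff hn hX hY.1 hcY).1 hY
  have hWc := hA.coframe_Jmap hn hY.1 hcY
  have hWt := isTangent_Jmap ⟨_, hA⟩ hY.1
  rw [← hWY] at hWc hWt
  -- the components of `W` commute with those of the tangent vector
  have h0 : ⁅coframe (c x) (g x) (W x), ee n⁆ = 0 := by
    rw [hWc, lie_swap, lie_ee_mcx, Complex.zero_im, smul_zero,
      show ucx 0 (0 : ZMat n) = 0 from (ucxLin n).map_zero, smul_zero, neg_zero]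
  have e0 : ∀ A : Mat n, killing A 0 = 0 := fun A => by simp [killing]
  rw [sub_eq_iff_eq_add.1 (hWQ x), hA.isFrame.metric_eq, coframe_add, (hF.coframe_source hn x).2,
    hA.isFrame.coframe_curv hX (hQ x).1.1 hWt, hA.2.2, killing_add_left, killing_mcx_ee,
    killing_neg_left, killing_lie, h0, e0]
  simp

end Arclength

end SOU

end

theorem mainTheorem4 (n : ℕ) (hn : 3 ≤ n) (I : Set ℝ) (hI : IsOpen I) (hIc : I.OrdConnected) :
    -- `J_γ` is a degenerate almost complex structure
    (∀ P X : Mat n, P ∈ Space n → InClass P X →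
      (∀ Z, IsTangent P Z →
        IsTangent P (Jmap P X Z) ∧ Jmap P X (adSq P X Z) = adSq P X (Jmap P X Z)) ∧
      (∀ Z, IsPerp P X Z →
        IsPerp P X (Jmap P X Z) ∧ Jmap P X (Jmap P X (Jmap P X Z)) = -Jmap P X Z) ∧
      (∃ Z, IsPerp P X Z ∧ Z ≠ 0 ∧ Jmap P X Z = 0) ∧
      (∃ Z, IsPerp P X Z ∧ Jmap P X Z ≠ 0)) ∧
    -- the curve flow equation in terms of the Hasimoto variables of a parallel frame
    (∀ (γ g W : ℝ → ℝ → Mat n) (v : ℝ → ℝ → ℝ) (v₁ v₂ : ℝ → ℝ → CVec n) (K : ℝ → ℝ → CMat n),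
      IsUnitFlow I γ → IsHasimoto I γ g v v₁ v₂ → IsPotential I v₁ v₂ K → IsLinked I γ g W K →
      (IsU1CurveFlow I γ W ↔
        ∀ t ∈ I, ∀ x, coframe (γ t x) (g t x) (dt γ t x) =
          (1 / √(chi n)) • (perpMat 0 (Complex.I • v₁ t x) (Complex.I • v₂ t x)
            + parMat 0 (-(2 * Complex.I) • K t x)))) ∧
    -- from solutions of the curve flow equation to solutions of the NLS system
    (∀ γ W : ℝ → ℝ → Mat n, IsU1CurveFlow I γ W →
      ∃ (g : ℝ → ℝ → Mat n) (v : ℝ → ℝ → ℝ) (v₁ v₂ : ℝ → ℝ → CVec n) (K : ℝ → ℝ → CMat n),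
        IsHasimoto I γ g v v₁ v₂ ∧ IsLinked I γ g W K ∧ IsU1NLS I v v₁ v₂ K) ∧
    -- from solutions of the NLS system to solutions of the curve flow equation
    (∀ (v : ℝ → ℝ → ℝ) (v₁ v₂ : ℝ → ℝ → CVec n) (K : ℝ → ℝ → CMat n), IsU1NLS I v v₁ v₂ K →
      ∃ γ g W : ℝ → ℝ → Mat n,
        IsU1CurveFlow I γ W ∧ IsHasimoto I γ g v v₁ v₂ ∧ IsLinked I γ g W K) ∧
    -- invariance under `SO(2n)`
    (∀ A ∈ SO n, ∀ γ W : ℝ → ℝ → Mat n, IsU1CurveFlow I γ W →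
      IsU1CurveFlow I (fun t x => A * γ t x * Aᵀ) (fun t x => A * W t x * Aᵀ)) ∧
    -- the local and the nonlocal part of the flow both preserve the arclength
    (∀ c : ℝ → Mat n, IsUnitCurve c →
      (∀ x, metric (c x)
        (nabla c (fun y => Jmap (c y) (deriv c y) (normal c y)) x) (deriv c x) = 0) ∧
      (∀ W, IsOpInv c (source c) W → ∀ x, metric (c x) (nabla c W x) (deriv c x) = 0)) := by
  exact ⟨fun P X _ hX =>
      ⟨fun Z hZ => ⟨isTangent_Jmap hX.2 hZ, Jmap_adSq hn hX hZ⟩, fun Z hZ => hZ.Jmap hn hX,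
        exists_isPerp_Jmap_eq_zero hn hX, exists_isPerp_Jmap_ne_zero hn hX⟩,
    fun γ g W v v₁ v₂ K hγ hH hK hL => isU1CurveFlow_iff hn hI hγ hH hK hL,
    fun γ W h => h.exists_nls hn hI hIc,
    fun v v₁ v₂ K h => h.exists_flow hn hI hIc,
    fun A hA γ W h => h.conj hn hI hIc hA,
    fun c hc => ⟨metric_nabla_Jmap_normal hn hc, fun W hW => hW.metric_nabla hn hc⟩⟩
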